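/- **Setting.** Let $\tau:(0,\infty)\to(0,\infty)$ be $C^1$ with $1/\tau\in L^1(0,1)$ and $\tau_0\mathbf 1_{x\ge1}x^{\nu_0}\le\tau(x)\le\tau_1\max(1,x)$ for all $x>0$, for some $\nu_0\le1$ and $\tau_1\ge\tau_0>0$. Let $B:(0,\infty)\to[0,\infty)$ be continuous with connected support and $B_0\mathbf 1_{x\ge x_0}x^{\gamma_0}\le B(x)\le B_1\max(1,x^{\gamma_1})$ for all $x>0$, for some $\gamma_1\ge\gamma_0>0$, $B_1\ge B_0>0$, $x_0>0$. Let $\wp$ be a finite positive measure on $(0,1)$ with $\int_0^1 z\,\wp(\mathrm dz)=1$, and put $\underline\alpha=\inf\{a\in\mathbb R:\int_0^1z^a\,\wp(\mathrm dz)<\infty\}\in[-\infty,0]$. For $\alpha\in\mathbb R$ let $L^1_\alpha=L^1((0,\infty);(1+x)^\alpha\,\mathrm dx)$. Let $$\mathcal F_+f(x)=\int_0^1B\Big(\frac xz\Big)f\Big(\frac xz\Big)\frac{\wp(\mathrm dz)}z .$$ Let $\lambda\in\mathbb R$ (for instance the Perron eigenvalue of the growth-fragmentation operator), and let $(S_t)_{t\ge0}$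 be the $C_0$-semigroup on $L^1_1$ generated by $\mathcal A_0f=-(\tau f)'-\lambda f-Bf$ with domain $\{f\in L^1_1:(\tau f)'\in L^1_1,\ (\tau f)(0)=0,\ Bf\in L^1_1\}$. **Assumption.** Assume that either 1. $\wp$ is absolutely continuous with respect to the Lebesgue measure, or 2. $\operatorname{supp}\wp\subset[\varepsilon,1-\varepsilon]$ for some $\varepsilon>0$, and $\tau$ is constant. **Proposition.** Let $\alpha>\max(1,\underline\alpha+\gamma_1-\gamma_0)$ and $t>0$. For every $s\in(0,t)$ the composition $S_{t-s}\mathcal F_+S_s$ is a bounded operator on $L^1_\alpha$; for every $f\in L^1_\alpha$ the function $s\mapsto S_{t-s}\mathcal F_+S_sf$ is Bochner integrable on $(0,t)$ with values in $L^1_\alpha$; and $$f\mapsto\int_0^tS_{t-s}\mathcal F_+S_sf\,\mathrm ds$$ is a weakly compact bounded linear operator on $L^1_\alpha$, that is, it maps the closed unit ball to a relatively weakly compact set. -/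

import Mathlib

open MeasureTheory Set Filter Topology
open scoped ENNReal

namespace GrowthFragmentation

noncomputable section

/-! ### Coefficients -/

/-- Hypothesis on the growth rate `τ : (0,∞) → (0,∞)` (values outside `(0,∞)` are irrelevant). -/
structure IsGrowthRate (τ : ℝ → ℝ) : Prop where
  pos : ∀ x, 0 < x → 0 < τ x
  contDiffOn : ContDiffOn ℝ 1 τ (Ioi 0)
  integrableOn_inv : IntegrableOn (fun x => 1 / τ x) (Ioo 0 1)
  bounds : ∃ ν₀ τ₀ τ₁ : ℝ, ν₀ ≤ 1 ∧ 0 < τ₀ ∧ τ₀ ≤ τ₁ ∧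
    (∀ x, 1 ≤ x → τ₀ * x ^ ν₀ ≤ τ x) ∧ (∀ x, 0 < x → τ x ≤ τ₁ * max 1 x)

/-- Hypothesis on the total fragmentation rate `B : (0,∞) → [0,∞)` with exponents `γ₀ ≤ γ₁`
(values outside `(0,∞)` are irrelevant).  The support is taken inside `(0,∞)`. -/
structure IsFragmentationRate (B : ℝ → ℝ) (γ₀ γ₁ : ℝ) : Prop where
  nonneg : ∀ x, 0 < x → 0 ≤ B x
  continuousOn : ContinuousOn B (Ioi 0)
  connected_support : IsConnected (Ioi 0 ∩ closure {x | 0 < x ∧ B x ≠ 0})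
  exponent_pos : 0 < γ₀
  exponent_le : γ₀ ≤ γ₁
  bounds : ∃ B₀ B₁ x₀ : ℝ, 0 < B₀ ∧ B₀ ≤ B₁ ∧ 0 < x₀ ∧
    (∀ x, x₀ ≤ x → B₀ * x ^ γ₀ ≤ B x) ∧ (∀ x, 0 < x → B x ≤ B₁ * max 1 (x ^ γ₁))

/-- Hypothesis on the fragmentation kernel: a finite positive measure on the open interval
`(0,1)`, seen as a measure on `ℝ` carried by `(0,1)`, with first moment `1`. -/
structure IsFragmentationKernel (p : Measure ℝ) : Prop where
  finite : IsFiniteMeasure p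
  carried : p (Ioo 0 1)ᶜ = 0
  mass_cons : ∫ z, z ∂p = 1

/-- The (possibly infinite) moment `∫₀¹ z^a p(dz)`. -/
def moment (p : Measure ℝ) (a : ℝ) : ℝ≥0∞ := ∫⁻ z in Ioo 0 1, ENNReal.ofReal (z ^ a) ∂p

/-- The infimum, in `[-∞, ∞]`, of the exponents `a ∈ ℝ` for which the moment of order `a`
is finite. -/
def alphaInf (p : Measure ℝ) : EReal := sInf ((fun a : ℝ => (a : EReal)) '' {a | moment p a < ∞})

/-! ### Weighted Lebesgue spaces -/

/-- Lebesgue measure on `(0,∞)`. -/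
def halfLine : Measure ℝ := volume.restrict (Ioi 0)

/-- The measure `(1+x)^α dx` on `(0,∞)`. -/
def weight (α : ℝ) : Measure ℝ := halfLine.withDensity fun x => ENNReal.ofReal ((1 + x) ^ α)

/-- The space `L¹_α = L¹((0,∞); (1+x)^α dx)`, with norm `∫₀^∞ |f(x)| (1+x)^α dx`. -/
abbrev L1 (α : ℝ) : Type := Lp ℝ 1 (weight α)

/-! ### Semigroups and their generators -/

/-- `(S t)_{t ≥ 0}` is a strongly continuous semigroup of bounded operators. Only the
values of `S` at nonnegative times matter. -/
structure IsC0Semigroup {E : Type*} [NormedAddCommGroup E] [NormedSpace ℝ E]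
    (S : ℝ → E →L[ℝ] E) : Prop where
  zero : S 0 = ContinuousLinearMap.id ℝ E
  add : ∀ s t, 0 ≤ s → 0 ≤ t → S (s + t) = (S s).comp (S t)
  continuousOn : ∀ f, ContinuousOn (fun t => S t f) (Ici 0)

/-- `A`, given by its graph, is the infinitesimal generator of `S`: `f` lies in the domain of `A`
and `A f = g` exactly when `(S h f - f) / h → g` as `h → 0+`. -/
def HasGenerator {E : Type*} [NormedAddCommGroup E] [NormedSpace ℝ E]
    (S : ℝ → E →L[ℝ] E) (A : E → E → Prop) : Prop :=
  ∀ f g : E, A f g ↔ Tendsto (fun h : ℝ => h⁻¹ • (S h f - f)) (𝓝[>] 0) (𝓝 g)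

/-- The graph of the transport operator `A₀ f = -(τ f)' - λ f - B f` in `L¹_1`, with domain
`{f ∈ L¹_1 : (τ f)' ∈ L¹_1, (τ f)(0) = 0, B f ∈ L¹_1}`.  That `τ f` has weak derivative
`k ∈ L¹_1` and vanishes at `0` means that `τ(x) f(x) = ∫₀ˣ k(y) dy` for almost every `x`. -/
def TransportOperator (τ B : ℝ → ℝ) (lam : ℝ) (f g : L1 1) : Prop :=
  ∃ k : L1 1,
    (∀ᵐ x ∂halfLine, τ x * f x = ∫ y in Ioc 0 x, k y) ∧
    Integrable (fun x => B x * f x) (weight 1) ∧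
    ∀ᵐ x ∂halfLine, g x = -k x - lam * f x - B x * f x

/-- For a bounded operator `T` on `L¹_1` and `f, g ∈ L¹_α` with `α ≥ 1`
(so that `L¹_α ⊆ L¹_1`), this says that `T f = g`. -/
def ActsAs (T : L1 1 →L[ℝ] L1 1) {α : ℝ} (f g : L1 α) : Prop :=
  ∃ f₁ : L1 1, f₁ =ᵐ[halfLine] f ∧ T f₁ =ᵐ[halfLine] g

/-! ### The positive part of the fragmentation operator -/

/-- `F₊ f(x) = ∫₀¹ B(x/z) f(x/z) p(dz)/z`. -/
def fragPlus (B : ℝ → ℝ) (p : Measure ℝ) (f : ℝ → ℝ) (x : ℝ) : ℝ :=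
  ∫ z in Ioo 0 1, B (x / z) * f (x / z) / z ∂p

/-- For `f, g ∈ L¹_α` this says that `f` lies in `L¹((1+B(x))(1+x)^α dx)`, the domain of
`F₊` as an operator with values in `L¹_α`, and that `F₊ f = g`. For such `f` and `α ≥ 0` the
integral that defines `F₊ f(x)` converges absolutely for almost every `x`. -/
def FragPlusOperator (B : ℝ → ℝ) (p : Measure ℝ) {α : ℝ} (f g : L1 α) : Prop :=
  Integrable (fun x => B x * f x) (weight α) ∧ g =ᵐ[halfLine] fragPlus B p f

/-- `g = S_{t-s} F₊ S_s f` in `L¹_α`. -/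
def DuhamelTerm (S : ℝ → L1 1 →L[ℝ] L1 1) (B : ℝ → ℝ) (p : Measure ℝ) (t s : ℝ) {α : ℝ}
    (f g : L1 α) : Prop :=
  ∃ u v : L1 α, ActsAs (S s) f u ∧ FragPlusOperator B p u v ∧ ActsAs (S (t - s)) v g

/-! ### Weak compactness -/

/-- A bounded operator is weakly compact if the image of the closed unit ball is relatively
compact for the weak topology. -/
def IsWeaklyCompact {E F : Type*} [NormedAddCommGroup E] [NormedSpace ℝ E]
    [NormedAddCommGroup F] [NormedSpace ℝ F] (T : E →L[ℝ] F) : Prop :=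
  IsCompact (closure (toWeakSpace ℝ F '' (T '' Metric.closedBall 0 1)))

end

end GrowthFragmentation

open GrowthFragmentation

/-! The theorem is about particles. Under `S s` mass follows the characteristics of x' = τ(x) and is
damped by exp(-λs) times the probability of not splitting up to time s; `F₊` replaces a particle of
size b by fragments zb, with z distributed according to p. Only an upper bound for absolute values
is needed: for every test weight φ, the integral of φ |S_{t-s} F₊ S_s f| is at most the integral of
|f(y)| against `duhamelKernel`, the damped mean of φ at time t for a particle that starts from y and
splits exactly once, at time s (`exists_duhamel`). Everything reduces to estimates of this kernel
integrated over s.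

This picture of the semigroup is derived from its generator. With an integrating factor m, and with
the travel time from 0 as coordinate, the primitive of m S_t f satisfies an integrated form of the
transport equation on a quadrant. It is therefore a translate of the primitive of m f
(`eq_translation_of_integrated_transport`, `integral_intFactor_semigroup`), and comparison of signed
measures gives `lintegral_enorm_semigroup_le`. Moreover, for s > 0 the survival probability of a
large particle decays faster than B grows, so `S s` maps L¹_α into the domain of `F₊`
(`exists_frag_mul_survival_le`).

Weak compactness comes from the Dunford-Pettis criterion
`isCompact_closure_weak_of_uniformlyIntegrable`, through three estimates that are uniform in the
starting size y. Boundedness: B times survival is the density of the splitting time, so its integral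
over s is at most 1 (`exists_lintegral_duhamelKernel_le`). Large y: with a single split allowed,
either the parent or the fragment must survive for time t/2, which is exponentially unlikely unless
the fragment is a tiny fraction of its parent, and p gives such fractions little mass
(`exists_lintegral_duhamelKernel_tail_le`). Bounded y: the final position has a uniformly absolutely
continuous law (`IsDispersing`).

The two cases of the assumption enter only in this last point. If p has a density, then for fixed s
the random fraction z spreads the position, because the flow is expanding in z by a definite factor.
If τ = c is constant, the position is z(y + cs) + c(t - s), whose derivative in s is -c(1 - z); for
z ≤ 1 - ε the random splitting time spreads it, even when p is singular. -/

/-! ### Weak compactness in Banach spaces and in L¹ -/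

section WeakCompactness

open scoped Pointwise

variable {E : Type*} [NormedAddCommGroup E] [NormedSpace ℝ E]

/-- A bounded set that is, for every `ε > 0`, within distance `ε` of a weakly compact set is
relatively weakly compact. -/
theorem isCompact_closure_weak_of_approx [CompleteSpace E] {s : Set E}
    (hs : Bornology.IsBounded s)
    (h : ∀ ε > 0, ∃ W : Set E, IsCompact (toWeakSpace ℝ E '' W) ∧
      ∀ x ∈ s, ∃ y ∈ W, ‖x - y‖ ≤ ε) :
    IsCompact (closure (toWeakSpace ℝ E '' s)) := by
  -- In the bidual it remains to see that every weak-* limit point Φ of the set comes from the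
  -- space. The space is norm closed in its bidual, so it is enough to approximate Φ in norm.
  refine NormedSpace.isCompact_closure_of_isBounded ℝ E _ ?_ ?_
  · rwa [preimage_image_eq _ (toWeakSpace ℝ E).injective]
  intro Φ hΦ
  have hclosed : IsClosed (range (NormedSpace.inclusionInDoubleDualLi (𝕜 := ℝ) (E := E))) :=
    (NormedSpace.inclusionInDoubleDualLi (𝕜 := ℝ)
      (E := E)).isometry.isUniformInducing.isComplete_range.isClosed
  have key : WeakDual.toStrongDual Φ ∈
      range (NormedSpace.inclusionInDoubleDualLi (𝕜 := ℝ) (E := E)) := by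
    rw [← hclosed.closure_eq]
    refine (Metric.mem_closure_iff (α := StrongDual ℝ (StrongDual ℝ E))).2 fun ε hε => ?_
    obtain ⟨W, hW, hsW⟩ := h (ε / 2) (by positivity)
    -- A sum of two weak-* compact sets, the ball by Banach-Alaoglu. It is therefore weak-* closed
    -- and contains Φ along with the set itself.
    have hC : IsCompact ((NormedSpace.inclusionInDoubleDualWeak ℝ E '' (toWeakSpace ℝ E '' W)) +
        (WeakDual.toStrongDual ⁻¹' Metric.closedBall (0 : StrongDual ℝ (StrongDual ℝ E)) (ε / 2))) :=
      (hW.image (NormedSpace.inclusionInDoubleDualWeak ℝ E).continuous).add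
        (WeakDual.isCompact_closedBall _ _)
    have hsub : NormedSpace.inclusionInDoubleDualWeak ℝ E '' (toWeakSpace ℝ E '' s) ⊆
        ((NormedSpace.inclusionInDoubleDualWeak ℝ E '' (toWeakSpace ℝ E '' W)) +
        (WeakDual.toStrongDual ⁻¹' Metric.closedBall (0 : StrongDual ℝ (StrongDual ℝ E)) (ε / 2))) := by
      rintro _ ⟨_, ⟨x, hx, rfl⟩, rfl⟩
      obtain ⟨y, hy, hxy⟩ := hsW x hx
      refine ⟨_, ⟨_, ⟨y, hy, rfl⟩, rfl⟩,
        NormedSpace.inclusionInDoubleDualWeak ℝ E (toWeakSpace ℝ E (x - y)), ?_, ?_⟩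
      · refine (mem_closedBall_zero_iff (E := StrongDual ℝ (StrongDual ℝ E))).2 ?_
        exact ((NormedSpace.inclusionInDoubleDualLi (𝕜 := ℝ) (E := E)).norm_map (x - y)).le.trans hxy
      · simp only [← map_add]
        congr 2
        abel
    obtain ⟨_, ⟨_, ⟨y, hy, rfl⟩, rfl⟩, Ψ, hΨ, rfl⟩ :=
      (closure_minimal hsub hC.isClosed) hΦ
    refine ⟨_, ⟨y, rfl⟩, ?_⟩
    have hΨ' : ‖WeakDual.toStrongDual Ψ‖ ≤ ε / 2 :=
      (mem_closedBall_zero_iff (E := StrongDual ℝ (StrongDual ℝ E))).1 hΨ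
    refine (dist_eq_norm (E := StrongDual ℝ (StrongDual ℝ E)) _ _).trans_lt ?_
    refine lt_of_le_of_lt (le_of_eq_of_le ?_ hΨ') (half_lt_self hε)
    congr 1
    exact add_sub_cancel_left (G := StrongDual ℝ (StrongDual ℝ E)) _ _
  obtain ⟨x, hx⟩ := key
  exact ⟨toWeakSpace ℝ E x, WeakDual.toStrongDual.injective hx⟩

/-- A bounded linear map from a Hilbert space sends closed balls to weakly compact sets. -/
theorem isCompact_toWeakSpace_image_closedBall {F : Type*} [NormedAddCommGroup F]
    [InnerProductSpace ℝ F] [CompleteSpace F] (T : F →L[ℝ] E) (r : ℝ) :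
    IsCompact (toWeakSpace ℝ E '' (T '' Metric.closedBall 0 r)) := by
  let Ψ : WeakDual ℝ F → WeakSpace ℝ E := fun φ =>
    toWeakSpace ℝ E (T ((InnerProductSpace.toDual ℝ F).symm (WeakDual.toStrongDual φ)))
  have hΨ : Continuous Ψ := by
    refine (NormedSpace.isEmbedding_inclusionInDoubleDualWeak ℝ E).isInducing.continuous_iff.2 ?_
    refine WeakDual.continuous_of_continuous_eval fun ℓ => ?_
    -- Pairing with ℓ after T is evaluation at a fixed vector, the Riesz representative of ℓ ∘ T.
    -- Hence the map is continuous from the weak-* topology, where balls are compact.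
    have : ∀ φ : WeakDual ℝ F, NormedSpace.inclusionInDoubleDualWeak ℝ E (Ψ φ) ℓ =
        φ ((InnerProductSpace.toDual ℝ F).symm (ℓ.comp T)) := by
      intro φ
      have h1 : ∀ z, inner ℝ ((InnerProductSpace.toDual ℝ F).symm (ℓ.comp T)) z = ℓ (T z) :=
        fun z => InnerProductSpace.toDual_symm_apply (𝕜 := ℝ)
      have h2 : ∀ z, inner ℝ ((InnerProductSpace.toDual ℝ F).symm (WeakDual.toStrongDual φ)) z
          = φ z :=
        fun z => InnerProductSpace.toDual_symm_apply (𝕜 := ℝ)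
      rw [← h2, real_inner_comm, h1]
      rfl
    simp only [Function.comp_apply, this]
    exact WeakDual.eval_continuous _
  convert (WeakDual.isCompact_closedBall (𝕜 := ℝ) (0 : StrongDual ℝ F) r).image hΨ using 1
  ext y
  constructor
  · rintro ⟨_, ⟨x, hx, rfl⟩, rfl⟩
    refine ⟨StrongDual.toWeakDual (InnerProductSpace.toDual ℝ F x), ?_, ?_⟩
    · refine (mem_closedBall_zero_iff (E := StrongDual ℝ F)).2 ?_
      exact ((InnerProductSpace.toDual ℝ F).norm_map x).le.trans (mem_closedBall_zero_iff.1 hx)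
    · change toWeakSpace ℝ E (T ((InnerProductSpace.toDual ℝ F).symm
        (InnerProductSpace.toDual ℝ F x))) = _
      rw [LinearIsometryEquiv.symm_apply_apply]
  · rintro ⟨φ, hφ, rfl⟩
    refine ⟨_, ⟨_, ?_, rfl⟩, rfl⟩
    rw [mem_closedBall_zero_iff, LinearIsometryEquiv.norm_map]
    exact (mem_closedBall_zero_iff (E := StrongDual ℝ F)).1 hφ


/-- The easy half of the Dunford-Pettis theorem: a bounded, uniformly integrable and tight subset
of `L¹` is relatively weakly compact. -/
theorem isCompact_closure_weak_of_uniformlyIntegrable {Ω : Type*} [MeasurableSpace Ω]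
    {μ : Measure Ω} {s : Set (Lp ℝ 1 μ)} (hs : Bornology.IsBounded s)
    (h : ∀ ε : ℝ, 0 < ε → ∃ A : Set Ω, MeasurableSet A ∧ μ A ≠ ∞ ∧ ∃ δ : ℝ, 0 < δ ∧
      ∀ f ∈ s, ∀ D : Set Ω, MeasurableSet D → μ (D ∩ A) ≤ ENNReal.ofReal δ →
        ∫⁻ x in D, ‖f x‖ₑ ∂μ ≤ ENNReal.ofReal ε) :
    IsCompact (closure (toWeakSpace ℝ (Lp ℝ 1 μ) '' s)) := by
  refine isCompact_closure_weak_of_approx hs fun ε hε => ?_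
  obtain ⟨A, hA, hμA, δ, hδ, hsA⟩ := h ε hε
  obtain ⟨C, hC, hsC⟩ := hs.exists_pos_norm_le
  -- Truncation level: by Chebyshev, |f| ≥ M on a set of measure at most C / M = δ.
  set M : ℝ := C / δ with hM
  have hMpos : 0 < M := by positivity
  -- Multiplication by the indicator of A, bounded from L² to L¹ since A has finite measure.
  -- Truncated functions supported in A lie in the image of one fixed L² ball.
  let T : Lp ℝ 2 μ →L[ℝ] Lp ℝ 1 μ :=
    (ContinuousLinearMap.mul ℝ ℝ).holderL μ 2 2 1 (indicatorConstLp 2 hA hμA 1)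
  have hT : ∀ g : Lp ℝ 2 μ, T g =ᵐ[μ] A.indicator g := by
    intro g
    refine ((ContinuousLinearMap.mul ℝ ℝ).coeFn_holder (r := 1)
      (indicatorConstLp 2 hA hμA (1 : ℝ)) g).trans ?_
    filter_upwards [indicatorConstLp_coeFn (p := 2) (hs := hA) (hμs := hμA) (c := (1 : ℝ))]
      with x hx
    rw [hx]
    by_cases hxA : x ∈ A <;> simp [hxA]
  set r : ℝ := (μ A ^ (1 / (2 : ℝ)) * ENNReal.ofReal M).toReal
  refine ⟨T '' Metric.closedBall 0 r, isCompact_toWeakSpace_image_closedBall T r, fun f hf => ?_⟩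
  have hfm : StronglyMeasurable f := Lp.stronglyMeasurable f
  set E' : Set Ω := A ∩ {x | ‖f x‖ₑ < ENNReal.ofReal M} with hE'
  have hE'm : MeasurableSet E' :=
    hA.inter (measurableSet_lt hfm.measurable.enorm measurable_const)
  have hsub : A.indicator (E'.indicator f) = E'.indicator f := by
    rw [indicator_indicator, inter_eq_right.2 inter_subset_left]
  have : IsFiniteMeasure (μ.restrict A) := isFiniteMeasure_restrict.2 hμA
  have hbd : ∀ x, ‖E'.indicator f x‖ ≤ M := by
    intro x
    by_cases hx : x ∈ E'
    · rw [indicator_of_mem hx]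
      have := hx.2
      rw [mem_ofPred_eq, ← ofReal_norm] at this
      exact ((ENNReal.ofReal_lt_ofReal_iff hMpos).1 this).le
    · rw [indicator_of_notMem hx, norm_zero]
      exact hMpos.le
  have hmem : MemLp (E'.indicator f) 2 μ := by
    rw [← hsub, memLp_indicator_iff_restrict hA]
    exact MemLp.of_bound (hfm.indicator hE'm).aestronglyMeasurable M (ae_of_all _ hbd)
  have hnorm : ‖hmem.toLp _‖ ≤ r := by
    rw [Lp.norm_toLp]
    refine ENNReal.toReal_mono (by finiteness) ?_
    rw [← hsub, eLpNorm_indicator_eq_eLpNorm_restrict hA]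
    refine (eLpNorm_le_of_ae_bound (ae_of_all _ hbd)).trans (le_of_eq ?_)
    simp
  refine ⟨T (hmem.toLp _), ⟨_, mem_closedBall_zero_iff.2 hnorm, rfl⟩, ?_⟩
  have hTf : T (hmem.toLp _) =ᵐ[μ] E'.indicator f := by
    refine (hT _).trans ?_
    filter_upwards [hmem.coeFn_toLp] with x hx
    rw [← congrFun hsub x]
    by_cases hxA : x ∈ A
    · simp only [indicator_of_mem hxA, hx]
    · simp only [indicator_of_notMem hxA]
  have hdiff : ⇑(f - T (hmem.toLp _)) =ᵐ[μ] E'ᶜ.indicator f := by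
    filter_upwards [Lp.coeFn_sub f (T (hmem.toLp _)), hTf] with x hx hx'
    rw [hx, Pi.sub_apply, hx', ← Pi.sub_apply, ← indicator_compl]
  rw [Lp.norm_def]
  refine ENNReal.toReal_le_of_le_ofReal hε.le ?_
  rw [eLpNorm_congr_ae hdiff, eLpNorm_indicator_eq_eLpNorm_restrict hE'm.compl,
    eLpNorm_one_eq_lintegral_enorm]
  refine hsA f hf _ hE'm.compl ?_
  have hcheb := mul_meas_ge_le_lintegral (μ := μ) hfm.measurable.enorm (ENNReal.ofReal M)
  have hsubset : E'ᶜ ∩ A ⊆ {x | ENNReal.ofReal M ≤ ‖f x‖ₑ} := by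
    rintro x ⟨hx, hxA⟩
    by_contra hlt
    exact hx ⟨hxA, mem_ofPred_eq.symm ▸ not_le.1 hlt⟩
  refine (measure_mono hsubset).trans ?_
  rw [← eLpNorm_one_eq_lintegral_enorm] at hcheb
  have hfC : eLpNorm f 1 μ ≤ ENNReal.ofReal C := by
    rw [← ENNReal.ofReal_toReal (Lp.eLpNorm_ne_top f), ← Lp.norm_def]
    exact ENNReal.ofReal_le_ofReal (hsC f hf)
  have h2 : ENNReal.ofReal C = ENNReal.ofReal M * ENNReal.ofReal δ := by
    rw [← ENNReal.ofReal_mul hMpos.le, hM, div_mul_cancel₀ _ hδ.ne']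
  exact (ENNReal.mul_le_mul_iff_right (by simpa using hMpos) ENNReal.ofReal_ne_top).1
    ((hcheb.trans hfC).trans_eq h2)

end WeakCompactness

/-! ### Uniqueness for the integrated transport equation -/

/-- An integrated form of `∂ₜ v + ∂ₐ v = 0`, `v(t, 0) = 0`, on the quadrant forces `v` to be
constant along characteristics. -/
theorem eq_translation_of_integrated_transport {v : ℝ → ℝ → ℝ}
    (hv : ContinuousOn (Function.uncurry v) (Ici 0 ×ˢ Ici 0))
    (h : ∀ t, 0 ≤ t → ∀ a, 0 ≤ a → ∫ s in (0)..t, v s a = ∫ r in (0)..a, (v 0 r - v t r))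
    {t a : ℝ} (ht : 0 ≤ t) (ha : 0 ≤ a) : v t a = v 0 (max (a - t) 0) := by
  set w : ℝ → ℝ → ℝ := fun s a => v (max s 0) (max a 0) with hw
  have hwc : Continuous (Function.uncurry w) := by
    refine hv.comp_continuous (f := fun q : ℝ × ℝ => (max q.1 0, max q.2 0)) (by fun_prop) ?_
    exact fun q => ⟨mem_Ici.2 (le_max_right _ _), mem_Ici.2 (le_max_right _ _)⟩
  have hw_eq : ∀ s a, 0 ≤ s → 0 ≤ a → w s a = v s a := fun s a hs ha => by
    simp only [hw, max_eq_left hs, max_eq_left ha]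
  have hw1 : ∀ a, Continuous fun s => w s a := fun a =>
    hwc.comp (Continuous.prodMk continuous_id continuous_const)
  have hw2 : ∀ s, Continuous fun a => w s a := fun s =>
    hwc.comp (Continuous.prodMk continuous_const continuous_id)
  -- Here v is only continuous, but its time primitive V is C¹ in the open quadrant: the hypothesis
  -- expresses V also as a primitive in a.
  set V : ℝ → ℝ → ℝ := fun t a => ∫ s in (0)..t, w s a with hV
  have hVeq : ∀ t, 0 ≤ t → ∀ a, 0 ≤ a → V t a = ∫ r in (0)..a, (w 0 r - w t r) := by
    intro t ht a ha
    have h1 : V t a = ∫ s in (0)..t, v s a :=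
      intervalIntegral.integral_congr fun s hs => hw_eq _ _ (uIcc_of_le ht ▸ hs).1 ha
    rw [h1, h t ht a ha]
    refine intervalIntegral.integral_congr fun r hr => ?_
    have hr0 : 0 ≤ r := (uIcc_of_le ha ▸ hr).1
    simp only [hw_eq _ _ le_rfl hr0, hw_eq _ _ ht hr0]
  have hVt : ∀ t a, HasDerivAt (fun t => V t a) (w t a) t := fun t a =>
    intervalIntegral.integral_hasDerivAt_right ((hw1 a).intervalIntegrable _ _)
      (hw1 a).stronglyMeasurable.stronglyMeasurableAtFilter (hw1 a).continuousAt
  have hVa : ∀ t a, 0 < t → 0 < a → HasDerivAt (fun a => V t a) (w 0 a - w t a) a := by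
    intro t a ht ha
    have hc : Continuous fun r => w 0 r - w t r := (hw2 0).sub (hw2 t)
    refine (intervalIntegral.integral_hasDerivAt_right (hc.intervalIntegrable 0 a)
      hc.stronglyMeasurable.stronglyMeasurableAtFilter hc.continuousAt).congr_of_eventuallyEq ?_
    filter_upwards [lt_mem_nhds ha] with r hr using hVeq t ht.le r hr.le
  have hVc : Continuous (Function.uncurry V) := by
    have := intervalIntegral.continuous_parametric_primitive_of_continuous (μ := volume)
      (f := fun a s => w s a) (a₀ := 0)
      (hwc.comp continuous_swap)
    exact this.comp continuous_swap
  set W : ℝ → ℝ := fun a => ∫ r in (0)..a, w 0 r with hW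
  have hWd : ∀ a, HasDerivAt W (w 0 a) a := fun a =>
    intervalIntegral.integral_hasDerivAt_right ((hw2 0).intervalIntegrable _ _)
      (hw2 0).stronglyMeasurable.stronglyMeasurableAtFilter (hw2 0).continuousAt
  have hWc : Continuous W := continuous_iff_continuousAt.2 fun a => (hWd a).continuousAt
  have hVd : ∀ t a, 0 < t → 0 < a →
      HasFDerivAt (Function.uncurry V) ((w t a • ContinuousLinearMap.id ℝ ℝ).coprod
        ((w 0 a - w t a) • ContinuousLinearMap.id ℝ ℝ)) (t, a) := by
    have hconv : ∀ {f : ℝ → ℝ} {c x : ℝ}, HasDerivAt f c x →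
        HasFDerivAt f (c • ContinuousLinearMap.id ℝ ℝ) x := by
      intro f c x hf
      have : c • ContinuousLinearMap.id ℝ ℝ = ContinuousLinearMap.toSpanSingleton ℝ c := by
        ext
        simp
      exact this ▸ hf.hasFDerivAt
    intro t a ht ha
    have hpos : ∀ᶠ q : ℝ × ℝ in 𝓝 (t, a), 0 < q.1 ∧ 0 < q.2 :=
      (prod_mem_nhds (lt_mem_nhds ht) (lt_mem_nhds ha))
    -- Continuous partial derivatives give joint differentiability, which is needed to differentiate
    -- along diagonals.
    refine (hasStrictFDerivAt_uncurry_coprod (𝕜 := ℝ) (f := V) (u := (t, a))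
      (f₁ := fun t a => w t a • ContinuousLinearMap.id ℝ ℝ)
      (f₂ := fun t a => (w 0 a - w t a) • ContinuousLinearMap.id ℝ ℝ)
      ?_ ?_ ?_ ?_).hasFDerivAt
    · exact Eventually.of_forall fun q => hconv (hVt q.1 q.2)
    · filter_upwards [hpos] with q hq using hconv (hVa q.1 q.2 hq.1 hq.2)
    · exact (hwc.smul continuous_const).continuousAt
    · exact ((((hw2 0).comp continuous_snd).sub hwc).smul continuous_const).continuousAt
  -- The two partial derivatives of V add up to w(0, a) = W'(a), so V - W is constant in the
  -- direction (1, 1).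
  have hdiag : ∀ t a, 0 ≤ t → 0 ≤ a → ∀ h, 0 ≤ h → V (t + h) (a + h) - W (a + h) = V t a - W a := by
    intro t a ht ha h hh
    rcases hh.eq_or_lt with rfl | hh
    · simp
    set q : ℝ → ℝ := fun h => V (t + h) (a + h) - W (a + h) with hq
    have hqc : Continuous q :=
      (hVc.comp (f := fun h => (t + h, a + h)) (by fun_prop)).sub (hWc.comp (by fun_prop))
    have hqd : ∀ r ∈ Ioo 0 h, HasDerivAt q 0 r := by
      intro h hh
      have h1 := (hVd (t + h) (a + h) (by linarith [hh.1]) (by linarith [hh.1]))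
      have h2 : HasDerivAt (fun h => (t + h, a + h)) ((1 : ℝ), (1 : ℝ)) h :=
        ((hasDerivAt_id h).const_add t).prodMk ((hasDerivAt_id h).const_add a)
      have h3 := h1.comp_hasDerivAt h h2
      have h4 : HasDerivAt (fun h => W (a + h)) (w 0 (a + h)) h := by
        simpa using (hWd (a + h)).comp_const_add a h
      exact (h3.sub h4).congr_deriv (by simp)
    obtain ⟨c, -, hc⟩ := exists_hasDerivAt_eq_slope q (fun _ => 0) hh hqc.continuousOn hqd
    have : q h - q 0 = 0 := by
      rcases div_eq_zero_iff.1 hc.symm with h | h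
      · exact h
      · linarith
    simpa [hq, sub_eq_zero] using this
  have hw0 : ∀ t, 0 < t → w t 0 = 0 := by
    intro t ht
    have h1 : (fun t => V t 0) =ᶠ[𝓝 t] fun _ => 0 := by
      filter_upwards [lt_mem_nhds ht] with s hs
      rw [hVeq s hs.le 0 le_rfl, intervalIntegral.integral_same]
    exact (hVt t 0).unique ((hasDerivAt_const t (0 : ℝ)).congr_of_eventuallyEq h1)
  have hw00 : w 0 0 = 0 := by
    have h1 : Tendsto (fun s => w s 0) (𝓝[>] 0) (𝓝 (w 0 0)) :=
      (hw1 0).continuousAt.tendsto.mono_left nhdsWithin_le_nhds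
    refine tendsto_nhds_unique h1 (tendsto_const_nhds.congr' ?_)
    filter_upwards [self_mem_nhdsWithin] with s hs using (hw0 s hs).symm
  have hwneg : ∀ r ≤ 0, w 0 r = 0 := fun r hr => by
    have : w 0 r = w 0 0 := by simp only [hw, max_eq_right hr, max_self]
    rw [this, hw00]
  have hWneg : ∀ r ≤ 0, W r = 0 := by
    intro r hr
    have : W r = ∫ _ in (0)..r, (0 : ℝ) :=
      intervalIntegral.integral_congr fun s hs => hwneg s (uIcc_of_ge hr ▸ hs).2
    rw [this, intervalIntegral.integral_zero]
  have hVformula : ∀ t, 0 ≤ t → ∀ a, 0 ≤ a → V t a = W a - W (a - t) := by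
    intro t ht a ha
    -- Follow the diagonal back to the boundary: it leaves through t = 0 or through a = 0, and V
    -- vanishes on both sides. The claim then follows by differentiating in t.
    rcases le_total t a with hta | hta
    · have := hdiag 0 (a - t) le_rfl (by linarith) t ht
      simp only [zero_add, sub_add_cancel] at this
      have h0 : V 0 (a - t) = 0 := intervalIntegral.integral_same
      linarith
    · have := hdiag (t - a) 0 (by linarith) le_rfl a ha
      simp only [zero_add, sub_add_cancel] at this
      have h0 : V (t - a) 0 = 0 := by
        rw [hVeq _ (by linarith) 0 le_rfl, intervalIntegral.integral_same]
      have h1 : W (a - t) = 0 := hWneg _ (by linarith)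
      have h2 : W 0 = 0 := hWneg 0 le_rfl
      linarith
  have key : w t a = w 0 (a - t) := by
    rcases ht.eq_or_lt with rfl | ht'
    · simp
    have h1 : (fun t => V t a) =ᶠ[𝓝 t] fun t => W a - W (a - t) := by
      filter_upwards [lt_mem_nhds ht'] with s hs using hVformula s hs.le a ha
    have h2 : HasDerivAt (fun t => W a - W (a - t)) (w 0 (a - t)) t := by
      have := ((hWd (a - t)).comp_const_sub a t).const_sub (W a)
      simpa using this
    exact (hVt t a).unique (h2.congr_of_eventuallyEq h1)
  rw [hw_eq t a ht ha] at key
  rw [key]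
  simp only [hw, max_self]

/-! ### Coefficients, characteristics and survival -/

/-- Normalised coefficients: growth rate `τ` and fragmentation rate `B`, extended to the whole
line by `1` and `0`, with the bounds in the form in which they are used. -/
structure RegularCoefficients (τ B : ℝ → ℝ) (τ₁ B₀ B₁ x₀ γ₀ γ₁ : ℝ) : Prop where
  growth_pos : ∀ x, 0 < τ x
  growth_eq_one : ∀ x ≤ 0, τ x = 1
  growth_continuousOn : ContinuousOn τ (Ioi 0)
  growth_integrable : IntegrableOn (fun x => 1 / τ x) (Ioo 0 1)
  growth_le : ∀ x, 0 < x → τ x ≤ τ₁ * (1 + x)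
  frag_nonneg : ∀ x, 0 ≤ B x
  frag_eq_zero : ∀ x ≤ 0, B x = 0
  frag_continuousOn : ContinuousOn B (Ioi 0)
  frag_le : ∀ x, 0 < x → B x ≤ B₁ * (1 + x) ^ γ₁
  le_frag : ∀ x, x₀ ≤ x → B₀ * x ^ γ₀ ≤ B x
  pos_γ₀ : 0 < γ₀
  pos_γ₁ : 0 < γ₁
  pos_x₀ : 0 < x₀
  pos_B₀ : 0 < B₀
  pos_B₁ : 0 < B₁
  pos_τ₁ : 0 < τ₁

/-- The data needed to integrate along the characteristics of `∂ₜ u + ∂ₓ (τ u) = -B u`: the travel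
time `∫₀ˣ dy / τ(y)`, extended to an order isomorphism of the line, and a primitive of `B / τ`. -/
structure Characteristics (τ B : ℝ → ℝ) where
  time : ℝ ≃o ℝ
  time_zero : time 0 = 0
  hasDerivAt_time : ∀ x, 0 < x → HasDerivAt time (1 / τ x) x
  loss : ℝ → ℝ
  continuous_loss : Continuous loss
  hasDerivAt_loss : ∀ x, 0 < x → HasDerivAt loss (B x / τ x) x

theorem measurable_of_continuousOn_Ioi {f : ℝ → ℝ} {c : ℝ} (hf : ContinuousOn f (Ioi 0))
    (h : ∀ x ≤ 0, f x = c) : Measurable f := by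
  have : f = (Ioi (0 : ℝ)).piecewise f (fun _ => c) := by
    ext x
    by_cases hx : x ∈ Ioi (0 : ℝ)
    · rw [piecewise_eq_of_mem _ _ _ hx]
    · rw [piecewise_eq_of_notMem _ _ _ hx, h x (not_lt.1 hx)]
  rw [this]
  exact hf.measurable_piecewise continuousOn_const measurableSet_Ioi

namespace RegularCoefficients

variable {τ B : ℝ → ℝ} {τ₁ B₀ B₁ x₀ γ₀ γ₁ : ℝ}

theorem measurable_growth (h : RegularCoefficients τ B τ₁ B₀ B₁ x₀ γ₀ γ₁) : Measurable τ :=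
  measurable_of_continuousOn_Ioi h.growth_continuousOn h.growth_eq_one

theorem measurable_frag (h : RegularCoefficients τ B τ₁ B₀ B₁ x₀ γ₀ γ₁) : Measurable B :=
  measurable_of_continuousOn_Ioi h.frag_continuousOn h.frag_eq_zero

theorem frag_le_of_le (h : RegularCoefficients τ B τ₁ B₀ B₁ x₀ γ₀ γ₁) {x R : ℝ} (hR : 0 ≤ R)
    (hx : x ≤ R) : B x ≤ B₁ * (1 + R) ^ γ₁ := by
  have := h.pos_B₁
  rcases le_or_gt x 0 with hx0 | hx0
  · rw [h.frag_eq_zero x hx0]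
    positivity
  · exact (h.frag_le x hx0).trans (mul_le_mul_of_nonneg_left
      (Real.rpow_le_rpow (by linarith) (by linarith) h.pos_γ₁.le) this.le)

theorem intervalIntegrable_inv_growth (h : RegularCoefficients τ B τ₁ B₀ B₁ x₀ γ₀ γ₁) (a b : ℝ) :
    IntervalIntegrable (fun x => 1 / τ x) volume a b := by
  have hloc : ∀ R : ℝ, 1 ≤ R → IntegrableOn (fun x => 1 / τ x) (Icc (-R) R) := by
    intro R hR
    have h1 : IntegrableOn (fun x => 1 / τ x) (Icc (-R) 0) := by
      refine (integrableOn_const (C := (1 : ℝ)) (by simp)).congr_fun (fun x hx => ?_)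
        measurableSet_Icc
      simp [h.growth_eq_one x hx.2]
    have h2 : IntegrableOn (fun x => 1 / τ x) (Icc 1 R) := by
      refine ContinuousOn.integrableOn_Icc ?_
      exact continuousOn_const.div (h.growth_continuousOn.mono fun x hx =>
        mem_Ioi.2 (by linarith [hx.1])) fun x _ => (h.growth_pos x).ne'
    refine ((h1.union h.growth_integrable).union h2).mono_set fun x hx => ?_
    rcases le_or_gt x 0 with h0 | h0
    · exact Or.inl (Or.inl ⟨hx.1, h0⟩)
    · rcases lt_or_ge x 1 with h3 | h3
      · exact Or.inl (Or.inr ⟨h0, h3⟩)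
      · exact Or.inr ⟨h3, hx.2⟩
  have hR : (1 : ℝ) ≤ |a| + |b| + 1 := by linarith [abs_nonneg a, abs_nonneg b]
  refine ((hloc _ hR).mono_set ?_).intervalIntegrable
  refine uIcc_subset_Icc ⟨?_, ?_⟩ ⟨?_, ?_⟩ <;>
    linarith [neg_abs_le a, neg_abs_le b, le_abs_self a, le_abs_self b, abs_nonneg a, abs_nonneg b]

theorem intervalIntegrable_frag_div_growth (h : RegularCoefficients τ B τ₁ B₀ B₁ x₀ γ₀ γ₁)
    (a b : ℝ) : IntervalIntegrable (fun x => B x / τ x) volume a b := by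
  refine ((h.intervalIntegrable_inv_growth a b).const_mul
    (B₁ * (1 + (|a| + |b|)) ^ γ₁)).mono_fun
    (h.measurable_frag.div h.measurable_growth).aestronglyMeasurable ?_
  refine (ae_restrict_iff' measurableSet_uIoc).2 (ae_of_all _ fun x hx => ?_)
  have hx' : x ≤ |a| + |b| := by
    have := hx.2
    rcases le_max_iff.1 this with h | h <;>
      linarith [le_abs_self a, le_abs_self b, abs_nonneg a, abs_nonneg b]
  have h1 := h.frag_le_of_le (by positivity) hx'
  have h2 := h.growth_pos x
  have h3 := h.frag_nonneg x
  beta_reduce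
  rw [Real.norm_of_nonneg (by positivity), Real.norm_of_nonneg
    (mul_nonneg (h3.trans h1) (by positivity)), mul_one_div]
  gcongr

/-- The travel time is a global coordinate because characteristics do not blow up: τ(x) ≤ τ₁(1 + x)
yields log(1 + x) ≤ τ₁ H(x), so reaching infinity takes infinite time. On the negative axis τ is 1
and the travel time is the identity, which makes H onto the whole line. -/
theorem exists_characteristics (h : RegularCoefficients τ B τ₁ B₀ B₁ x₀ γ₀ γ₁) :
    Nonempty (Characteristics τ B) := by
  set H : ℝ → ℝ := fun x => ∫ y in (0)..x, 1 / τ y with hH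
  have hcont : Continuous H := intervalIntegral.continuous_primitive
    (fun a b => h.intervalIntegrable_inv_growth a b) 0
  have hderiv : ∀ x, 0 < x → HasDerivAt H (1 / τ x) x := fun x hx =>
    intervalIntegral.integral_hasDerivAt_right (h.intervalIntegrable_inv_growth 0 x)
      (measurable_const.div h.measurable_growth).stronglyMeasurable.stronglyMeasurableAtFilter
      (continuousAt_const.div (h.growth_continuousOn.continuousAt (Ioi_mem_nhds hx))
        (h.growth_pos x).ne')
  have hmono : StrictMono H := by
    intro a b hab
    have : 0 < ∫ y in a..b, 1 / τ y :=
      intervalIntegral.intervalIntegral_pos_of_pos (h.intervalIntegrable_inv_growth a b)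
        (fun x => one_div_pos.2 (h.growth_pos x)) hab
    rw [← intervalIntegral.integral_interval_sub_left (h.intervalIntegrable_inv_growth 0 b)
      (h.intervalIntegrable_inv_growth 0 a)] at this
    exact sub_pos.1 this
  have h0 : H 0 = 0 := intervalIntegral.integral_same
  have hneg : ∀ x ≤ 0, H x = x := by
    intro x hx
    have : H x = ∫ _ in (0)..x, (1 : ℝ) := intervalIntegral.integral_congr fun y hy => by
      simp [h.growth_eq_one y (uIcc_of_ge hx ▸ hy).2]
    rw [this, integral_one, sub_zero]
  have hlog : ∀ x, 0 ≤ x → Real.log (1 + x) ≤ τ₁ * H x := by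
    intro x hx
    have hm : MonotoneOn (fun x => τ₁ * H x - Real.log (1 + x)) (Ici 0) := by
      refine monotoneOn_of_deriv_nonneg (convex_Ici 0) ?_ ?_ ?_
      · refine (hcont.const_mul τ₁).continuousOn.sub (ContinuousOn.log (by fun_prop) ?_)
        intro x hx
        have : (0 : ℝ) ≤ x := hx
        positivity
      all_goals
        rw [interior_Ici]
        intro x hx
        have hx : 0 < x := hx
        have hd : HasDerivAt (fun x => τ₁ * H x - Real.log (1 + x))
            (τ₁ * (1 / τ x) - 1 / (1 + x)) x :=
          ((hderiv x hx).const_mul τ₁).sub (((hasDerivAt_id x).const_add 1).log (by positivity))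
      · exact hd.differentiableAt.differentiableWithinAt
      · rw [hd.deriv, mul_one_div, sub_nonneg, div_le_div_iff₀ (by positivity) (h.growth_pos x),
          one_mul]
        exact h.growth_le x hx
    have := hm (mem_Ici.2 le_rfl) (mem_Ici.2 hx) hx
    simp only [h0, mul_zero, add_zero, Real.log_one, sub_zero] at this
    linarith
  have hsurj : Function.Surjective H := by
    refine hcont.surjective ?_ ?_
    · refine tendsto_atTop_mono' atTop ?_ ((Real.tendsto_log_atTop.comp
        (tendsto_atTop_add_const_left atTop 1 tendsto_id)).const_mul_atTop (inv_pos.2 h.pos_τ₁))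
      filter_upwards [eventually_ge_atTop 0] with x hx
      rw [inv_mul_le_iff₀ h.pos_τ₁]
      exact hlog x hx
    · refine tendsto_id.congr' ?_
      filter_upwards [eventually_le_atBot 0] with x hx using (hneg x hx).symm
  exact ⟨{
    time := StrictMono.orderIsoOfSurjective H hmono hsurj
    time_zero := h0
    hasDerivAt_time := hderiv
    loss := fun x => ∫ y in (0)..x, B y / τ y
    continuous_loss := intervalIntegral.continuous_primitive
      (fun a b => h.intervalIntegrable_frag_div_growth a b) 0
    hasDerivAt_loss := fun x hx =>
      intervalIntegral.integral_hasDerivAt_right (h.intervalIntegrable_frag_div_growth 0 x)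
        (h.measurable_frag.div h.measurable_growth).stronglyMeasurable.stronglyMeasurableAtFilter
        ((h.frag_continuousOn.continuousAt (Ioi_mem_nhds hx)).div
          (h.growth_continuousOn.continuousAt (Ioi_mem_nhds hx)) (h.growth_pos x).ne') }⟩

end RegularCoefficients

namespace Characteristics

variable {τ B : ℝ → ℝ} (X : Characteristics τ B)

/-- The characteristic flow: `X.flow s y` is the position at time `s` of the characteristic that
starts from `y`. -/
noncomputable def flow (s y : ℝ) : ℝ := X.time.symm (X.time y + s)

theorem time_flow (s y : ℝ) : X.time (X.flow s y) = X.time y + s :=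
  X.time.apply_symm_apply _

theorem time_pos {y : ℝ} : 0 < X.time y ↔ 0 < y := by
  rw [← X.time_zero, X.time.lt_iff_lt, X.time_zero]

theorem flow_zero (y : ℝ) : X.flow 0 y = y := by simp [flow]

theorem flow_flow (s t y : ℝ) : X.flow s (X.flow t y) = X.flow (t + s) y := by
  simp [flow, add_assoc]

theorem flow_le_flow {s y s' y' : ℝ} (hs : s ≤ s') (hy : y ≤ y') : X.flow s y ≤ X.flow s' y' :=
  X.time.symm.monotone (add_le_add (X.time.monotone hy) hs)

theorem le_flow {s : ℝ} (hs : 0 ≤ s) (y : ℝ) : y ≤ X.flow s y := by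
  simpa [X.flow_zero] using X.flow_le_flow hs (le_refl y)

theorem flow_pos {s y : ℝ} (hs : 0 ≤ s) (hy : 0 < y) : 0 < X.flow s y :=
  hy.trans_le (X.le_flow hs y)

theorem flow_le_iff {s y x : ℝ} : X.flow s y ≤ x ↔ X.time y + s ≤ X.time x := by
  rw [flow, X.time.symm_apply_le]

theorem continuous_flow : Continuous fun q : ℝ × ℝ => X.flow q.1 q.2 :=
  X.time.symm.continuous.comp ((X.time.continuous.comp continuous_snd).add continuous_fst)

theorem measurable_flow (s : ℝ) : Measurable (X.flow s) :=
  (X.continuous_flow.comp (by fun_prop : Continuous fun y : ℝ => (s, y))).measurable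

theorem hasDerivAt_time_symm (hτ : ∀ x, 0 < τ x) {a : ℝ} (ha : 0 < a) :
    HasDerivAt X.time.symm (τ (X.time.symm a)) a := by
  have hpos : 0 < X.time.symm a := by rwa [← X.time_pos, X.time.apply_symm_apply]
  have := HasDerivAt.of_local_left_inverse (f := X.time) (g := X.time.symm) (a := a)
    X.time.symm.continuous.continuousAt (X.hasDerivAt_time _ hpos)
    (one_div_ne_zero (hτ _).ne') (Eventually.of_forall X.time.apply_symm_apply)
  rwa [one_div, inv_inv] at this

theorem hasDerivAt_flow (hτ : ∀ x, 0 < τ x) {s y : ℝ} (h : 0 < X.flow s y) :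
    HasDerivAt (fun s => X.flow s y) (τ (X.flow s y)) s := by
  have h' : 0 < X.time y + s := by rwa [← X.time_flow, X.time_pos]
  exact (X.hasDerivAt_time_symm hτ h').comp_const_add (X.time y) s

theorem hasDerivAt_loss_flow (hτ : ∀ x, 0 < τ x) {s y : ℝ} (h : 0 < X.flow s y) :
    HasDerivAt (fun s => X.loss (X.flow s y)) (B (X.flow s y)) s := by
  have := (X.hasDerivAt_loss _ h).comp s (X.hasDerivAt_flow hτ h)
  rwa [div_mul_cancel₀ _ (hτ _).ne'] at this

/-- The probability that a particle on the characteristic from `y` does not split before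
time `s`. -/
noncomputable def survival (s y : ℝ) : ℝ := Real.exp (-(X.loss (X.flow s y) - X.loss y))

theorem survival_pos (s y : ℝ) : 0 < X.survival s y := Real.exp_pos _

theorem continuous_survival : Continuous fun q : ℝ × ℝ => X.survival q.1 q.2 :=
  Real.continuous_exp.comp ((X.continuous_loss.comp X.continuous_flow).sub
    (X.continuous_loss.comp continuous_snd)).neg

theorem hasDerivAt_survival (hτ : ∀ x, 0 < τ x) {s y : ℝ} (h : 0 < X.flow s y) :
    HasDerivAt (fun s => X.survival s y) (-(B (X.flow s y) * X.survival s y)) s := by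
  have := ((X.hasDerivAt_loss_flow hτ h).sub_const (X.loss y)).neg.exp
  refine this.congr_deriv ?_
  simp only [survival, Pi.neg_apply]
  ring

/-- If the splitting rate is at least `c` along the characteristic from `y` then survival decays
at least like `exp (-c s)`. -/
theorem survival_le_exp (hτ : ∀ x, 0 < τ x) {y c s : ℝ} (hy : 0 < y) (hs : 0 ≤ s)
    (hc : ∀ x, y ≤ x → c ≤ B x) : X.survival s y ≤ Real.exp (-(s * c)) := by
  refine Real.exp_le_exp.2 (neg_le_neg ?_)
  -- The loss grows at rate B along the flow, and B ≥ c at every point ahead of y.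
  have hm : MonotoneOn (fun s => X.loss (X.flow s y) - s * c) (Ici 0) := by
    have hd : ∀ s, 0 ≤ s → HasDerivAt (fun s => X.loss (X.flow s y) - s * c)
        (B (X.flow s y) - 1 * c) s := fun s hs =>
      (X.hasDerivAt_loss_flow hτ (X.flow_pos hs hy)).sub ((hasDerivAt_id s).mul_const c)
    refine monotoneOn_of_deriv_nonneg (convex_Ici 0)
      (fun s hs => (hd s hs).continuousAt.continuousWithinAt) ?_ ?_ <;>
    · rw [interior_Ici]
      intro s hs
      have hs : 0 ≤ s := (mem_Ioi.1 hs).le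
      first
        | exact (hd s hs).differentiableAt.differentiableWithinAt
        | rw [(hd s hs).deriv]; linarith [hc _ (X.le_flow hs y)]
  have := hm (mem_Ici.2 le_rfl) (mem_Ici.2 hs) hs
  simp only [X.flow_zero, zero_mul, sub_zero] at this
  linarith

theorem survival_le_one (hτ : ∀ x, 0 < τ x) (hB : ∀ x, 0 ≤ B x) {y s : ℝ} (hy : 0 < y)
    (hs : 0 ≤ s) : X.survival s y ≤ 1 := by
  simpa using X.survival_le_exp hτ hy hs (c := 0) fun x _ => hB x

/-- The probability of splitting in a time interval is at most the probability of having survived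
until its beginning. -/
theorem lintegral_frag_mul_survival_le (hτ : ∀ x, 0 < τ x) (hB : ∀ x, 0 ≤ B x) {y a b : ℝ}
    (hy : 0 < y) (ha : 0 ≤ a) (hab : a ≤ b) :
    ∫⁻ s in Ioo a b, ENNReal.ofReal (B (X.flow s y) * X.survival s y) ≤
      ENNReal.ofReal (X.survival a y) := by
  have hcont : ContinuousOn (fun s => -X.survival s y) (Icc a b) :=
    (X.continuous_survival.comp (by fun_prop : Continuous fun s : ℝ => (s, y))).neg.continuousOn
  -- The splitting density is the derivative of minus survival, so its integral telescopes.
  have hd : ∀ s ∈ Ioo a b, HasDerivAt (fun s => -X.survival s y)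
      (B (X.flow s y) * X.survival s y) s := by
    intro s hs
    have := (X.hasDerivAt_survival hτ (X.flow_pos (ha.trans hs.1.le) hy)).neg
    rwa [neg_neg] at this
  have hnn : ∀ s, 0 ≤ B (X.flow s y) * X.survival s y := fun s =>
    mul_nonneg (hB _) (X.survival_pos s y).le
  have hint : IntegrableOn (fun s => B (X.flow s y) * X.survival s y) (Ioc a b) :=
    intervalIntegral.integrableOn_deriv_of_nonneg hcont hd fun s _ => hnn s
  have hint' := (intervalIntegrable_iff_integrableOn_Ioc_of_le hab).2 hint
  rw [setLIntegral_congr Ioo_ae_eq_Ioc, ← ofReal_integral_eq_lintegral_ofReal hint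
    (ae_of_all _ hnn), ← intervalIntegral.integral_of_le hab,
    intervalIntegral.integral_eq_sub_of_hasDerivAt_of_le hab hcont hd hint']
  refine ENNReal.ofReal_le_ofReal ?_
  linarith [X.survival_pos b y]

/-- Gronwall: log(1 + flow) has derivative τ/(1 + flow) ≤ τ₁ in time. -/
theorem one_add_flow_le {τ₁ : ℝ} (hτ : ∀ x, 0 < τ x) (hle : ∀ x, 0 < x → τ x ≤ τ₁ * (1 + x))
    {s y : ℝ} (hs : 0 ≤ s) (hy : 0 < y) : 1 + X.flow s y ≤ Real.exp (τ₁ * s) * (1 + y) := by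
  have hd : ∀ s, 0 ≤ s → HasDerivAt (fun s => τ₁ * s - Real.log (1 + X.flow s y))
      (τ₁ * 1 - τ (X.flow s y) / (1 + X.flow s y)) s := fun s hs =>
    ((hasDerivAt_id s).const_mul τ₁).sub (((X.hasDerivAt_flow hτ
      (X.flow_pos hs hy)).const_add 1).log (by linarith [X.flow_pos hs hy]))
  have hm : MonotoneOn (fun s => τ₁ * s - Real.log (1 + X.flow s y)) (Ici 0) := by
    refine monotoneOn_of_deriv_nonneg (convex_Ici 0)
      (fun s hs => (hd s hs).continuousAt.continuousWithinAt) ?_ ?_ <;>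
    · rw [interior_Ici]
      intro s hs
      have hs : 0 ≤ s := (mem_Ioi.1 hs).le
      first
        | exact (hd s hs).differentiableAt.differentiableWithinAt
        | rw [(hd s hs).deriv, mul_one, sub_nonneg, div_le_iff₀ (by linarith [X.flow_pos hs hy])]
          exact hle _ (X.flow_pos hs hy)
  have := hm (mem_Ici.2 le_rfl) (mem_Ici.2 hs) hs
  simp only [X.flow_zero, mul_zero, zero_sub] at this
  rw [← Real.log_le_log_iff (by linarith [X.flow_pos hs hy]) (by positivity),
    Real.log_mul (Real.exp_pos _).ne' (by positivity), Real.log_exp]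
  linarith

end Characteristics

/-! ### Signed measures, generators and the integrating factor -/

/-- If the signed measure `a μ` is the image of `b ν` under `T`, then `|a| μ` is at most the image
of `|b| ν`. -/
theorem lintegral_enorm_le_of_setIntegral_Iic_eq {μ ν : Measure ℝ} {a b T : ℝ → ℝ}
    (ha : Measurable a) (hb : Measurable b) (hT : Measurable T) (hai : Integrable a μ)
    (hbi : Integrable b ν) (h : ∀ x, ∫ y in Iic x, a y ∂μ = ∫ y in T ⁻¹' Iic x, b y ∂ν)
    {ψ : ℝ → ℝ≥0∞} (hψ : Measurable ψ) :
    ∫⁻ x, ψ x * ‖a x‖ₑ ∂μ ≤ ∫⁻ y, ψ (T y) * ‖b y‖ₑ ∂ν := by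
  set μp := μ.withDensity fun x => ENNReal.ofReal (a x)
  set μm := μ.withDensity fun x => ENNReal.ofReal (-a x)
  set νp := ν.withDensity fun x => ENNReal.ofReal (b x)
  set νm := ν.withDensity fun x => ENNReal.ofReal (-b x)
  have : IsFiniteMeasure μp := isFiniteMeasure_withDensity_ofReal hai.2
  have : IsFiniteMeasure μm := isFiniteMeasure_withDensity_ofReal hai.neg.2
  have : IsFiniteMeasure νp := isFiniteMeasure_withDensity_ofReal hbi.2
  have : IsFiniteMeasure νm := isFiniteMeasure_withDensity_ofReal hbi.neg.2
  have hpm : ∀ {ρ : Measure ℝ} {c : ℝ → ℝ} {s : Set ℝ}, MeasurableSet s → Integrable c ρ →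
      ∫ y in s, c y ∂ρ = (ρ.withDensity (fun x => ENNReal.ofReal (c x)) s).toReal -
        (ρ.withDensity (fun x => ENNReal.ofReal (-c x)) s).toReal := by
    intro ρ c s hs hc
    rw [withDensity_apply _ hs, withDensity_apply _ hs,
      integral_eq_lintegral_pos_part_sub_lintegral_neg_part hc.integrableOn]
  -- Equal integrals over half-lines identify the two signed measures; moving negative parts across
  -- gives an identity between finite positive measures.
  have hmeas : μp + νm.map T = μm + νp.map T := by
    refine Measure.ext_of_Iic _ _ fun x => ?_
    have h1 := h x
    rw [hpm measurableSet_Iic hai, hpm (hT measurableSet_Iic) hbi] at h1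
    rw [Measure.add_apply, Measure.add_apply, Measure.map_apply hT measurableSet_Iic,
      Measure.map_apply hT measurableSet_Iic, ← ENNReal.toReal_eq_toReal_iff' (by finiteness)
      (by finiteness), ENNReal.toReal_add (by finiteness) (by finiteness),
      ENNReal.toReal_add (by finiteness) (by finiteness)]
    linarith
  have hP : MeasurableSet {x | 0 < a x} := measurableSet_lt measurable_const ha
  have hp0 : μp {x | 0 < a x}ᶜ = 0 := by
    rw [withDensity_apply _ hP.compl, setLIntegral_eq_zero_iff hP.compl ha.ennreal_ofReal]
    exact ae_of_all _ fun x hx => ENNReal.ofReal_eq_zero.2 (not_lt.1 hx)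
  have hm0 : μm {x | 0 < a x} = 0 := by
    have hn : Measurable fun x => ENNReal.ofReal (-a x) := ha.neg.ennreal_ofReal
    rw [withDensity_apply _ hP, setLIntegral_eq_zero_iff hP hn]
    exact ae_of_all _ fun x hx => ENNReal.ofReal_eq_zero.2 (neg_nonpos.2 (le_of_lt hx))
  -- On {a > 0}, which carries μp, the measure μm vanishes. Only an inequality results, since images
  -- of positive and negative parts may overlap and cancel.
  have hlep : μp ≤ νp.map T := by
    refine Measure.le_iff.2 fun s _ => ?_
    calc μp s = μp (s ∩ {x | 0 < a x}) := (measure_inter_conull' (measure_mono_null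
          (fun x hx => hx.2) hp0)).symm
      _ ≤ (μp + νm.map T) (s ∩ {x | 0 < a x}) := by
          rw [Measure.add_apply]; exact le_self_add
      _ = νp.map T (s ∩ {x | 0 < a x}) := by
          rw [hmeas, Measure.add_apply, measure_mono_null inter_subset_right hm0, zero_add]
      _ ≤ νp.map T s := measure_mono inter_subset_left
  have hlem : μm ≤ νm.map T := by
    refine Measure.le_iff.2 fun s _ => ?_
    calc μm s = μm (s ∩ {x | 0 < a x}ᶜ) := (measure_inter_conull' (measure_mono_null
          (fun x hx => not_not.1 hx.2) hm0)).symm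
      _ ≤ (μm + νp.map T) (s ∩ {x | 0 < a x}ᶜ) := by
          rw [Measure.add_apply]; exact le_self_add
      _ = νm.map T (s ∩ {x | 0 < a x}ᶜ) := by
          rw [← hmeas, Measure.add_apply, measure_mono_null inter_subset_right hp0, zero_add]
      _ ≤ νm.map T s := measure_mono inter_subset_left
  have habs : ∀ {ρ : Measure ℝ} {c : ℝ → ℝ} {χ : ℝ → ℝ≥0∞}, Measurable c → Measurable χ →
      ∫⁻ y, χ y * ‖c y‖ₑ ∂ρ = ∫⁻ y, χ y ∂(ρ.withDensity fun x => ENNReal.ofReal (c x)) +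
        ∫⁻ y, χ y ∂(ρ.withDensity fun x => ENNReal.ofReal (-c x)) := by
    intro ρ c χ hc hχ
    have hn : Measurable fun x => ENNReal.ofReal (-c x) := hc.neg.ennreal_ofReal
    rw [lintegral_withDensity_eq_lintegral_mul _ hc.ennreal_ofReal hχ,
      lintegral_withDensity_eq_lintegral_mul _ hn hχ,
      ← lintegral_add_left (hc.ennreal_ofReal.mul hχ)]
    refine lintegral_congr fun y => ?_
    simp only [Pi.mul_apply]
    rw [← add_mul, mul_comm]
    congr 1
    rcases le_total 0 (c y) with h | h
    · rw [ENNReal.ofReal_of_nonpos (neg_nonpos.2 h), add_zero, Real.enorm_of_nonneg h]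
    · rw [ENNReal.ofReal_of_nonpos h, zero_add, ← Real.enorm_of_nonneg (neg_nonneg.2 h),
        enorm_neg]
  rw [habs ha hψ, habs (χ := fun y => ψ (T y)) hb (hψ.comp hT)]
  refine add_le_add ((lintegral_mono' hlep le_rfl).trans_eq (lintegral_map hψ hT))
    ((lintegral_mono' hlem le_rfl).trans_eq (lintegral_map hψ hT))

/-- The generator of a strongly continuous semigroup maps `∫₀ᵗ S_s f ds` to `S_t f - f`. -/
theorem GrowthFragmentation.HasGenerator.apply_integral {E : Type*} [NormedAddCommGroup E]
    [NormedSpace ℝ E] [CompleteSpace E] {S : ℝ → E →L[ℝ] E} {A : E → E → Prop}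
    (hA : HasGenerator S A) (hS : IsC0Semigroup S) (f : E) {t : ℝ} (ht : 0 ≤ t) :
    A (∫ s in (0)..t, S s f) (S t f - f) := by
  set u : ℝ → E := fun s => S (max s 0) f with hu
  have huc : Continuous u := (hS.continuousOn f).comp_continuous (by fun_prop)
    fun s => mem_Ici.2 (le_max_right _ _)
  have hu_eq : ∀ s, 0 ≤ s → u s = S s f := fun s hs => by simp only [hu, max_eq_left hs]
  have hint : ∀ a b, IntervalIntegrable u volume a b := fun a b => huc.intervalIntegrable a b
  have hd : ∀ t, HasDerivAt (fun x => ∫ s in (0)..x, u s) (u t) t := fun t =>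
    intervalIntegral.integral_hasDerivAt_right (hint 0 t)
      huc.stronglyMeasurable.stronglyMeasurableAtFilter huc.continuousAt
  have h0 : ∫ s in (0)..t, S s f = ∫ s in (0)..t, u s :=
    intervalIntegral.integral_congr fun s hs => (hu_eq s (uIcc_of_le ht ▸ hs).1).symm
  rw [hA, h0]
  -- S_h shifts the integral to the interval (h, t + h), so the difference quotient is the slope of
  -- the primitive at t minus its slope at 0.
  have hlim := ((hd t).tendsto_slope_zero_right).sub ((hd 0).tendsto_slope_zero_right)
  rw [hu_eq t ht, hu_eq 0 le_rfl, hS.zero, ContinuousLinearMap.id_apply] at hlim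
  refine hlim.congr' ?_
  filter_upwards [self_mem_nhdsWithin] with h hh
  have hh : 0 ≤ h := (mem_Ioi.1 hh).le
  have h1 : S h (∫ s in (0)..t, u s) = ∫ s in h..(t + h), u s := by
    rw [← ContinuousLinearMap.intervalIntegral_comp_comm _ (hint 0 t)]
    have : ∫ s in (0)..t, S h (u s) = ∫ s in (0)..t, u (s + h) := by
      refine intervalIntegral.integral_congr fun s hs => ?_
      have hs0 : 0 ≤ s := (uIcc_of_le ht ▸ hs).1
      rw [hu_eq s hs0, hu_eq _ (add_nonneg hs0 hh), add_comm, hS.add h s hh hs0]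
      rfl
    rw [this, intervalIntegral.integral_comp_add_right, zero_add]
  rw [h1, ← smul_sub]
  congr 1
  rw [zero_add, intervalIntegral.integral_same, sub_zero,
    ← intervalIntegral.integral_interval_sub_left (hint 0 (t + h)) (hint 0 h)]
  abel

namespace Characteristics

variable {τ B : ℝ → ℝ} {τ₁ B₀ B₁ x₀ γ₀ γ₁ : ℝ} (X : Characteristics τ B)

/-- The integrating factor `exp (∫₀ˣ (λ + B) / τ)`, up to a constant. -/
noncomputable def intFactor (lam x : ℝ) : ℝ := Real.exp (lam * X.time x + X.loss x)

theorem continuous_intFactor (lam : ℝ) : Continuous (X.intFactor lam) :=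
  Real.continuous_exp.comp ((continuous_const.mul X.time.continuous).add X.continuous_loss)

theorem intFactor_pos (lam x : ℝ) : 0 < X.intFactor lam x := Real.exp_pos _

theorem hasDerivAt_intFactor (lam : ℝ) {x : ℝ} (hx : 0 < x) :
    HasDerivAt (X.intFactor lam) (X.intFactor lam x * ((lam + B x) / τ x)) x := by
  refine (((X.hasDerivAt_time x hx).const_mul lam).add (X.hasDerivAt_loss x hx)).exp.congr_deriv ?_
  rw [mul_one_div, ← add_div]
  rfl

theorem intFactor_div_intFactor_flow (lam s y : ℝ) :
    X.intFactor lam y / X.intFactor lam (X.flow s y) = Real.exp (-(lam * s)) * X.survival s y := by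
  rw [intFactor, intFactor, survival, ← Real.exp_sub, ← Real.exp_add, X.time_flow]
  congr 1
  ring

theorem intervalIntegrable_deriv_intFactor (h : RegularCoefficients τ B τ₁ B₀ B₁ x₀ γ₀ γ₁)
    (lam a b : ℝ) :
    IntervalIntegrable (fun x => X.intFactor lam x * ((lam + B x) / τ x)) volume a b := by
  refine IntervalIntegrable.continuousOn_mul ?_ (X.continuous_intFactor lam).continuousOn
  refine (((h.intervalIntegrable_inv_growth a b).const_mul lam).add
    (h.intervalIntegrable_frag_div_growth a b)).congr fun x _ => ?_
  ring

/-- This is the product rule for the integrating factor times a primitive of k. Near 0 the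
derivative of the factor is merely integrable, like 1/τ, so the rule is applied to absolutely
continuous functions. -/
theorem intFactor_mul_integral (h : RegularCoefficients τ B τ₁ B₀ B₁ x₀ γ₀ γ₁) (lam : ℝ)
    {k : ℝ → ℝ} {x : ℝ} (hx : 0 ≤ x) (hk : IntervalIntegrable k volume 0 x) :
    X.intFactor lam x * ∫ y in (0)..x, k y = ∫ y in (0)..x, (X.intFactor lam y * k y +
      X.intFactor lam y * ((lam + B y) / τ y) * ∫ z in (0)..y, k z) := by
  set m := X.intFactor lam with hm
  set m' : ℝ → ℝ := fun y => m y * ((lam + B y) / τ y) with hm'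
  have hm'i : ∀ a b, IntervalIntegrable m' volume a b :=
    X.intervalIntegrable_deriv_intFactor h lam
  -- M agrees with m on [0, x] and is absolutely continuous by construction.
  set M : ℝ → ℝ := fun y => m 0 + ∫ z in (0)..y, m' z with hM
  have hMm : ∀ y ∈ Icc 0 x, M y = m y := by
    intro y hy
    rw [hM]
    beta_reduce
    rw [intervalIntegral.integral_eq_sub_of_hasDerivAt_of_le hy.1
      (X.continuous_intFactor lam).continuousOn
      (fun z hz => X.hasDerivAt_intFactor lam hz.1) (hm'i 0 y)]
    ring
  have hMac : AbsolutelyContinuousOnInterval M 0 x :=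
    (LipschitzOnWith.absolutelyContinuousOnInterval
      (LipschitzWith.const (m 0)).lipschitzOnWith).add
      ((hm'i 0 x).absolutelyContinuousOnInterval_intervalIntegral left_mem_uIcc)
  have hKac := hk.absolutelyContinuousOnInterval_intervalIntegral (c := 0) left_mem_uIcc
  have key := hMac.integral_deriv_mul_eq_sub hKac
  rw [intervalIntegral.integral_same, mul_zero, sub_zero, hMm x ⟨hx, le_rfl⟩] at key
  rw [← key]
  refine intervalIntegral.integral_congr_ae ?_
  filter_upwards [hk.ae_hasDerivAt_integral, (hm'i 0 x).ae_hasDerivAt_integral] with y h1 h2 hy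
  have hy' : y ∈ uIcc 0 x := uIoc_subset_uIcc hy
  have h3 : deriv M y = m' y := ((h2 hy' 0 left_mem_uIcc).const_add (m 0)).deriv
  rw [h3, (h1 hy' 0 left_mem_uIcc).deriv, hMm y (uIcc_of_le hx ▸ hy')]
  ring

end Characteristics

/-! ### Weighted L¹ spaces and bounded operators between them -/

/-- A measurable weight on `(0,∞)` that is positive and finite there. -/
structure IsWeight (w : ℝ → ℝ≥0∞) : Prop where
  measurable : Measurable w
  ne_zero : ∀ x, 0 < x → w x ≠ 0
  ne_top : ∀ x, 0 < x → w x ≠ ∞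

/-- The measure `w(x) dx` on `(0,∞)`. -/
noncomputable abbrev weightMeasure (w : ℝ → ℝ≥0∞) : Measure ℝ := halfLine.withDensity w

/-- The weight `(1+x)^α`. -/
noncomputable def powWeight (α : ℝ) (x : ℝ) : ℝ≥0∞ := ENNReal.ofReal ((1 + x) ^ α)

theorem isWeight_powWeight (α : ℝ) : IsWeight (powWeight α) where
  measurable := (measurable_const.add measurable_id).pow_const α |>.ennreal_ofReal
  ne_zero x hx := by
    rw [powWeight, ne_eq, ENNReal.ofReal_eq_zero, not_le]
    positivity
  ne_top x _ := ENNReal.ofReal_ne_top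

theorem ae_halfLine_pos : ∀ᵐ x ∂halfLine, 0 < x := ae_restrict_mem measurableSet_Ioi

namespace IsWeight

variable {w w₁ w₂ : ℝ → ℝ≥0∞}

theorem ae_iff (hw : IsWeight w) {P : ℝ → Prop} :
    (∀ᵐ x ∂weightMeasure w, P x) ↔ ∀ᵐ x ∂halfLine, P x := by
  rw [ae_withDensity_iff hw.measurable]
  refine eventually_congr ?_
  filter_upwards [ae_halfLine_pos] with x hx
  simp [hw.ne_zero x hx]

/-- All weights have the null sets of `halfLine`, so almost everywhere statements pass freely
between the different L¹ spaces. -/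
theorem ae_eq (hw : IsWeight w) : ae (weightMeasure w) = ae halfLine := by
  ext s
  exact hw.ae_iff

theorem aestronglyMeasurable_iff (hw : IsWeight w) {f : ℝ → ℝ} :
    AEStronglyMeasurable f (weightMeasure w) ↔ AEStronglyMeasurable f halfLine := by
  have h : ∀ {μ ν : Measure ℝ}, ae μ = ae ν → AEStronglyMeasurable f μ →
      AEStronglyMeasurable f ν := by
    rintro μ ν h ⟨g, hg, hfg⟩
    exact ⟨g, hg, by rwa [EventuallyEq, ← h]⟩
  exact ⟨h hw.ae_eq, h hw.ae_eq.symm⟩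

theorem lintegral_eq (hw : IsWeight w) (F : ℝ → ℝ≥0∞) :
    ∫⁻ x, F x ∂weightMeasure w = ∫⁻ x, w x * F x ∂halfLine := by
  refine lintegral_withDensity_eq_lintegral_mul_non_measurable _ hw.measurable ?_ F
  filter_upwards [ae_halfLine_pos] with x hx using (hw.ne_top x hx).lt_top

theorem setLIntegral_eq (hw : IsWeight w) {s : Set ℝ} (hs : MeasurableSet s) (F : ℝ → ℝ≥0∞) :
    ∫⁻ x in s, F x ∂weightMeasure w = ∫⁻ x, s.indicator w x * F x ∂halfLine := by
  rw [← lintegral_indicator hs, hw.lintegral_eq]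
  refine lintegral_congr fun x => ?_
  by_cases hx : x ∈ s <;> simp [hx]

theorem enorm_eq (hw : IsWeight w) (f : Lp ℝ 1 (weightMeasure w)) :
    ‖f‖ₑ = ∫⁻ x, w x * ‖f x‖ₑ ∂halfLine := by
  rw [Lp.enorm_def, eLpNorm_one_eq_lintegral_enorm, hw.lintegral_eq]

theorem memLp_iff (hw : IsWeight w) {f : ℝ → ℝ} : MemLp f 1 (weightMeasure w) ↔
    AEStronglyMeasurable f halfLine ∧ ∫⁻ x, w x * ‖f x‖ₑ ∂halfLine < ∞ := by
  rw [MemLp, hw.aestronglyMeasurable_iff, eLpNorm_one_eq_lintegral_enorm, hw.lintegral_eq]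

theorem lintegral_lt_top (hw : IsWeight w) (f : Lp ℝ 1 (weightMeasure w)) :
    ∫⁻ x, w x * ‖f x‖ₑ ∂halfLine < ∞ :=
  (hw.memLp_iff.1 (Lp.memLp f)).2

/-- A linear map on functions that is bounded for weighted `L¹` norms defines a bounded operator. -/
theorem exists_clm (hw₁ : IsWeight w₁) (hw₂ : IsWeight w₂)
    (Φ : Lp ℝ 1 (weightMeasure w₁) → ℝ → ℝ) (hm : ∀ f, AEStronglyMeasurable (Φ f) halfLine)
    (hadd : ∀ f g, Φ (f + g) =ᵐ[halfLine] Φ f + Φ g)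
    (hsmul : ∀ (c : ℝ) f, Φ (c • f) =ᵐ[halfLine] c • Φ f) (C : ℝ)
    (hbd : ∀ f, ∫⁻ x, w₂ x * ‖Φ f x‖ₑ ∂halfLine ≤
      ENNReal.ofReal C * ∫⁻ x, w₁ x * ‖f x‖ₑ ∂halfLine) :
    ∃ T : Lp ℝ 1 (weightMeasure w₁) →L[ℝ] Lp ℝ 1 (weightMeasure w₂),
      ∀ f, T f =ᵐ[halfLine] Φ f := by
  have hmem : ∀ f, MemLp (Φ f) 1 (weightMeasure w₂) := fun f => hw₂.memLp_iff.2
    ⟨hm f, (hbd f).trans_lt (ENNReal.mul_lt_top ENNReal.ofReal_lt_top (hw₁.lintegral_lt_top f))⟩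
  have hae : ∀ {g h : ℝ → ℝ}, g =ᵐ[weightMeasure w₂] h ↔ g =ᵐ[halfLine] h := hw₂.ae_iff
  let T : Lp ℝ 1 (weightMeasure w₁) →ₗ[ℝ] Lp ℝ 1 (weightMeasure w₂) :=
    { toFun := fun f => (hmem f).toLp _
      map_add' := fun f g => by
        rw [← MemLp.toLp_add]
        exact MemLp.toLp_congr _ _ (hae.2 (hadd f g))
      map_smul' := fun c f => by
        rw [RingHom.id_apply, ← MemLp.toLp_const_smul]
        exact MemLp.toLp_congr _ _ (hae.2 (hsmul c f)) }
  have hcoe : ∀ f, T f =ᵐ[halfLine] Φ f := fun f => hae.1 (hmem f).coeFn_toLp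
  refine ⟨T.mkContinuous (max C 0) fun f => ?_, hcoe⟩
  rw [← ENNReal.ofReal_le_ofReal_iff (by positivity), ofReal_norm, ENNReal.ofReal_mul
    (le_max_right _ _), ofReal_norm, hw₂.enorm_eq, hw₁.enorm_eq]
  have hcongr : ∫⁻ x, w₂ x * ‖T f x‖ₑ ∂halfLine = ∫⁻ x, w₂ x * ‖Φ f x‖ₑ ∂halfLine := by
    refine lintegral_congr_ae ?_
    filter_upwards [hcoe f] with x hx
    rw [hx]
  rw [hcongr]
  refine (hbd f).trans ?_
  gcongr
  exact le_max_left _ _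

end IsWeight

theorem one_le_powWeight {α x : ℝ} (hα : 0 ≤ α) (hx : 0 < x) : 1 ≤ powWeight α x := by
  rw [powWeight, ENNReal.one_le_ofReal]
  exact Real.one_le_rpow (by linarith) hα

theorem powWeight_le_powWeight {α β x : ℝ} (h : α ≤ β) (hx : 0 < x) :
    powWeight α x ≤ powWeight β x :=
  ENNReal.ofReal_le_ofReal (Real.rpow_le_rpow_of_exponent_le (by linarith) h)

theorem lintegral_enorm_le_enorm (f : L1 1) : ∫⁻ x, ‖f x‖ₑ ∂halfLine ≤ ‖f‖ₑ := by
  refine le_of_le_of_eq (lintegral_mono_ae ?_) ((isWeight_powWeight 1).enorm_eq f).symm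
  filter_upwards [ae_halfLine_pos] with x hx
  exact le_mul_of_one_le_left zero_le (one_le_powWeight zero_le_one hx)

theorem integrable_halfLine (f : L1 1) : Integrable f halfLine :=
  ⟨(isWeight_powWeight 1).aestronglyMeasurable_iff.1 (Lp.aestronglyMeasurable f),
    (lintegral_enorm_le_enorm f).trans_lt enorm_lt_top⟩

theorem intervalIntegrable_L1 (f : L1 1) {x : ℝ} (hx : 0 ≤ x) : IntervalIntegrable f volume 0 x :=
  (intervalIntegrable_iff_integrableOn_Ioc_of_le hx).2
    (IntegrableOn.mono_set (integrable_halfLine f) fun _ hy => hy.1)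

theorem abs_integral_mul_le {m : ℝ → ℝ} {R M : ℝ}
    (hM : ∀ y ∈ Icc 0 R, |m y| ≤ M) {x : ℝ} (hx : x ∈ Icc 0 R) (f : L1 1) :
    |∫ y in (0)..x, m y * f y| ≤ M * ‖f‖ := by
  have hM0 : 0 ≤ M := (abs_nonneg _).trans (hM x hx)
  have hsub : Ioc 0 x ⊆ Ioi (0 : ℝ) := fun _ hy => hy.1
  have h1 : |∫ y in (0)..x, m y * f y| ≤ ∫ y in (0)..x, M * |f y| := by
    refine intervalIntegral.norm_integral_le_of_norm_le (E := ℝ) hx.1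
      (ae_of_all _ fun y hy => ?_)
      ((intervalIntegrable_L1 f hx.1).norm.const_mul M)
    rw [norm_mul]
    exact mul_le_mul_of_nonneg_right (hM y ⟨hy.1.le, hy.2.trans hx.2⟩) (norm_nonneg _)
  refine h1.trans ?_
  rw [intervalIntegral.integral_const_mul]
  refine mul_le_mul_of_nonneg_left ?_ hM0
  rw [intervalIntegral.integral_of_le hx.1]
  calc ∫ y in Ioc 0 x, |f y| ≤ ∫ y in Ioi 0, |f y| :=
        setIntegral_mono_set (integrable_halfLine f).abs (ae_of_all _ fun _ => abs_nonneg _)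
          hsub.eventuallyLE
    _ = (∫⁻ y, ‖f y‖ₑ ∂halfLine).toReal :=
        integral_norm_eq_lintegral_enorm (integrable_halfLine f).1
    _ ≤ (‖f‖ₑ).toReal := ENNReal.toReal_mono enorm_ne_top (lintegral_enorm_le_enorm f)
    _ = ‖f‖ := toReal_enorm f

/-- Integration against a continuous function over `(0, x)`, as a functional on `L¹_1`. -/
theorem exists_integralFunctional {m : ℝ → ℝ} (hm : Continuous m) {x : ℝ} (hx : 0 ≤ x) :
    ∃ ℓ : L1 1 →L[ℝ] ℝ, ∀ f, ℓ f = ∫ y in (0)..x, m y * f y := by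
  obtain ⟨M, hM⟩ := isCompact_Icc.exists_bound_of_continuousOn (hm.continuousOn (s := Icc 0 x))
  have hcongr : ∀ {u v : ℝ → ℝ}, u =ᵐ[halfLine] v →
      ∫ y in (0)..x, m y * u y = ∫ y in (0)..x, m y * v y := by
    intro u v huv
    refine intervalIntegral.integral_congr_ae ?_
    have := (ae_restrict_iff' measurableSet_Ioi).1 huv
    filter_upwards [this] with y hy hyx
    rw [hy (uIoc_of_le hx ▸ hyx).1]
  have hae : ∀ {u v : ℝ → ℝ}, u =ᵐ[weight 1] v → u =ᵐ[halfLine] v :=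
    fun h => (isWeight_powWeight 1).ae_iff.1 h
  have hint : ∀ f : L1 1, IntervalIntegrable (fun y => m y * f y) volume 0 x := fun f =>
    (intervalIntegrable_L1 f hx).continuousOn_mul hm.continuousOn
  let ℓ : L1 1 →ₗ[ℝ] ℝ :=
    { toFun := fun f => ∫ y in (0)..x, m y * f y
      map_add' := fun f g => by
        rw [hcongr (hae (Lp.coeFn_add f g)), ← intervalIntegral.integral_add (hint f) (hint g)]
        simp only [Pi.add_apply, mul_add]
      map_smul' := fun c f => by
        rw [hcongr (hae (Lp.coeFn_smul c f)), RingHom.id_apply, smul_eq_mul,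
          ← intervalIntegral.integral_const_mul]
        refine intervalIntegral.integral_congr fun y _ => ?_
        simp only [Pi.smul_apply, smul_eq_mul]
        ring }
  exact ⟨ℓ.mkContinuous M fun f => abs_integral_mul_le hM ⟨hx, le_rfl⟩ f, fun f => rfl⟩

/-- The weighted primitive `∫₀ˣ m f` depends continuously on `x` and on `f ∈ L¹_1`. -/
theorem continuousOn_integral_mul {m : ℝ → ℝ} (hm : Continuous m) :
    ContinuousOn (fun q : ℝ × L1 1 => ∫ y in (0)..q.1, m y * q.2 y) (Ici 0 ×ˢ univ) := by
  rintro ⟨x₀, f₀⟩ ⟨hx₀, -⟩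
  have hx₀ : 0 ≤ x₀ := hx₀
  obtain ⟨M, hM⟩ := isCompact_Icc.exists_bound_of_continuousOn
    (hm.continuousOn (s := Icc 0 (x₀ + 1)))
  have hint : ∀ (f : L1 1) {x : ℝ}, 0 ≤ x → IntervalIntegrable (fun y => m y * f y) volume 0 x :=
    fun f x hx => (intervalIntegrable_L1 f hx).continuousOn_mul hm.continuousOn
  have hcont : Tendsto (fun q : ℝ × L1 1 => ∫ y in (0)..q.1, m y * f₀ y)
      (𝓝[Ici 0 ×ˢ univ] (x₀, f₀)) (𝓝 (∫ y in (0)..x₀, m y * f₀ y)) := by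
    have h1 : ContinuousWithinAt (fun x => ∫ y in (0)..x, m y * f₀ y) (Ici 0) x₀ := by
      have h2 := intervalIntegral.continuousOn_primitive_interval (μ := volume)
        (f := fun y => m y * f₀ y) (a := 0) (b := x₀ + 1)
        (((intervalIntegrable_iff_integrableOn_Icc_of_le (by linarith)).1
          (hint f₀ (by linarith))).mono_set (uIcc_of_le (by linarith : (0 : ℝ) ≤ x₀ + 1)).le)
      rw [uIcc_of_le (by linarith)] at h2
      refine (h2 x₀ ⟨hx₀, by linarith⟩).mono_of_mem_nhdsWithin ?_
      rw [← Ici_inter_Iic]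
      exact inter_mem self_mem_nhdsWithin (mem_nhdsWithin_of_mem_nhds (Iic_mem_nhds (by linarith)))
    refine h1.tendsto.comp (tendsto_nhdsWithin_iff.2 ⟨?_, ?_⟩)
    · exact continuous_fst.continuousAt.tendsto.mono_left nhdsWithin_le_nhds
    · filter_upwards [self_mem_nhdsWithin] with q hq using hq.1
  have hbd : Tendsto (fun q : ℝ × L1 1 => M * ‖q.2 - f₀‖) (𝓝[Ici 0 ×ˢ univ] (x₀, f₀)) (𝓝 0) := by
    have : Continuous fun q : ℝ × L1 1 => M * ‖q.2 - f₀‖ := by fun_prop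
    simpa using (this.tendsto (x₀, f₀)).mono_left nhdsWithin_le_nhds
  have hdiff : Tendsto (fun q : ℝ × L1 1 => (∫ y in (0)..q.1, m y * q.2 y) -
      ∫ y in (0)..q.1, m y * f₀ y) (𝓝[Ici 0 ×ˢ univ] (x₀, f₀)) (𝓝 0) := by
    refine squeeze_zero_norm' ?_ hbd
    have hnear : ∀ᶠ q : ℝ × L1 1 in 𝓝[Ici 0 ×ˢ univ] (x₀, f₀), q.1 < x₀ + 1 :=
      mem_nhdsWithin_of_mem_nhds (continuous_fst.continuousAt.preimage_mem_nhds
        (Iio_mem_nhds (by simp)))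
    filter_upwards [self_mem_nhdsWithin, hnear] with q hq hq'
    obtain ⟨ℓ, hℓ⟩ := exists_integralFunctional hm (x := q.1) hq.1
    rw [← hℓ, ← hℓ, ← map_sub, hℓ]
    exact abs_integral_mul_le hM ⟨hq.1, hq'.le⟩ _
  have := hdiff.add hcont
  simpa [ContinuousWithinAt] using this

/-! ### The transport semigroup along characteristics -/

namespace Characteristics

variable {τ B : ℝ → ℝ} {τ₁ B₀ B₁ x₀ γ₀ γ₁ : ℝ} (X : Characteristics τ B)

/-- If k = (τF)' then g = -k - λF - BF, and the derivative of m τ F is m(k + (λ + B)F) = -m g: the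
factor absorbs the terms of order zero. -/
theorem ae_intFactor_mul_of_transportOperator (h : RegularCoefficients τ B τ₁ B₀ B₁ x₀ γ₀ γ₁)
    {lam : ℝ} {F g : L1 1} (hFg : TransportOperator τ B lam F g) :
    ∀ᵐ x ∂halfLine, X.intFactor lam x * (τ x * F x) =
      -∫ y in (0)..x, X.intFactor lam y * g y := by
  obtain ⟨k, h1, -, h3⟩ := hFg
  have h1' := (ae_restrict_iff' measurableSet_Ioi).1 h1
  have h3' := (ae_restrict_iff' measurableSet_Ioi).1 h3
  filter_upwards [h1, ae_halfLine_pos] with x hx hx0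
  rw [hx, ← intervalIntegral.integral_of_le hx0.le,
    X.intFactor_mul_integral h lam hx0.le (intervalIntegrable_L1 k hx0.le),
    ← intervalIntegral.integral_neg]
  refine intervalIntegral.integral_congr_ae ?_
  filter_upwards [h1', h3'] with y hy1 hy3 hy
  have hy0 : 0 < y := (uIoc_of_le hx0.le ▸ hy).1
  rw [intervalIntegral.integral_of_le hy0.le, ← hy1 hy0, hy3 hy0]
  have := (h.growth_pos y).ne'
  field_simp
  ring

/-- The semigroup generated by the transport operator moves the mass along the characteristics,
in integrated form. -/
theorem integral_intFactor_semigroup (h : RegularCoefficients τ B τ₁ B₀ B₁ x₀ γ₀ γ₁)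
    {lam : ℝ} {S : ℝ → L1 1 →L[ℝ] L1 1} (hS : IsC0Semigroup S)
    (hgen : HasGenerator S (TransportOperator τ B lam)) (f : L1 1) {t a : ℝ} (ht : 0 ≤ t)
    (ha : 0 ≤ a) :
    ∫ y in (0)..X.time.symm a, X.intFactor lam y * S t f y =
      ∫ y in (0)..X.time.symm (max (a - t) 0), X.intFactor lam y * f y := by
  set m := X.intFactor lam with hm
  have hmc : Continuous m := X.continuous_intFactor lam
  have hsymm : ∀ a, 0 ≤ a → 0 ≤ X.time.symm a := fun a ha => by
    rwa [X.time.le_symm_apply, X.time_zero]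
  have hv := eq_translation_of_integrated_transport
    (v := fun t a => ∫ y in (0)..X.time.symm a, m y * S t f y) ?_ ?_ ht ha
  · simpa [hS.zero] using hv
  · refine (continuousOn_integral_mul hmc).comp
      (f := fun q : ℝ × ℝ => (X.time.symm q.2, S q.1 f)) ?_ fun q hq => ⟨hsymm _ hq.2, mem_univ _⟩
    refine (X.time.symm.continuous.comp continuous_snd).continuousOn.prodMk ?_
    exact (hS.continuousOn f).comp continuous_fst.continuousOn fun q hq => hq.1
  · intro t ht a ha
    set x := X.time.symm a with hx
    have hx0 : 0 ≤ x := hsymm a ha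
    have hxa : X.time x = a := X.time.apply_symm_apply a
    have hii : IntervalIntegrable (fun s => S s f) volume 0 t :=
      ((hS.continuousOn f).mono fun s hs => mem_Ici.2
        (uIcc_of_le ht ▸ hs).1).intervalIntegrable
    set F : L1 1 := ∫ s in (0)..t, S s f with hF
    -- F lies in the domain of the generator, which sends it to S_t f - f. This needs no regularity
    -- of f.
    have hFg := X.ae_intFactor_mul_of_transportOperator h (hgen.apply_integral hS f ht)
    have hFg' := (ae_restrict_iff' measurableSet_Ioi).1 hFg
    set ρ : ℝ → ℝ := fun r => (∫ y in (0)..X.time.symm r, m y * S 0 f y) -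
      ∫ y in (0)..X.time.symm r, m y * S t f y with hρ
    have hρc : ContinuousOn ρ (Ici 0) := by
      have : ∀ g : L1 1, ContinuousOn (fun r => ∫ y in (0)..X.time.symm r, m y * g y) (Ici 0) :=
        fun g => (continuousOn_integral_mul hmc).comp (f := fun r => (X.time.symm r, g))
          (X.time.symm.continuous.continuousOn.prodMk continuousOn_const)
          fun r hr => ⟨hsymm r hr, mem_univ _⟩
      exact (this _).sub (this _)
    have hρF : ∀ᵐ y, 0 < y → m y * F y = ρ (X.time y) * (1 / τ y) := by
      filter_upwards [hFg'] with y hy hy0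
      obtain ⟨ℓ, hℓ⟩ := exists_integralFunctional hmc hy0.le
      have h1 := hy hy0
      rw [← hℓ, map_sub, hℓ, hℓ] at h1
      simp only [hρ, X.time.symm_apply_apply, hS.zero, ContinuousLinearMap.id_apply]
      have := (h.growth_pos y).ne'
      field_simp
      linarith
    obtain ⟨ℓ, hℓ⟩ := exists_integralFunctional hmc hx0
    calc ∫ s in (0)..t, ∫ y in (0)..x, m y * S s f y = ∫ s in (0)..t, ℓ (S s f) := by
          simp only [hℓ]
      _ = ∫ y in (0)..x, m y * F y := by
          rw [ContinuousLinearMap.intervalIntegral_comp_comm ℓ hii, hℓ]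
      _ = ∫ y in (0)..x, (ρ ∘ X.time) y * (1 / τ y) := by
          refine intervalIntegral.integral_congr_ae ?_
          filter_upwards [hρF] with y hy hyx using hy (uIoc_of_le hx0 ▸ hyx).1
      -- Change of variables r = time y, with dr = dy / τ(y). The coordinate r turns transport at
      -- speed τ into transport at speed 1.
      _ = ∫ r in X.time 0..X.time x, ρ r := by
          have himg : X.time '' uIcc 0 x ⊆ Icc 0 a := by
            rintro _ ⟨y, hy, rfl⟩
            rw [uIcc_of_le hx0] at hy
            exact ⟨X.time_zero ▸ X.time.monotone hy.1, hxa ▸ X.time.monotone hy.2⟩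
          refine intervalIntegral.integral_comp_mul_deriv''' X.time.continuous.continuousOn
            (fun y hy => (X.hasDerivAt_time y ?_).hasDerivWithinAt) ?_ ?_ ?_
          · rw [min_eq_left hx0] at hy
            exact hy.1
          · refine hρc.mono ?_
            rintro _ ⟨y, hy, rfl⟩
            rw [min_eq_left hx0] at hy
            exact (X.time_pos.2 hy.1).le
          · exact ((hρc.mono fun r hr => hr.1).integrableOn_Icc).mono_set himg
          · have hc : ContinuousOn (ρ ∘ X.time) (uIcc 0 x) :=
              hρc.comp X.time.continuous.continuousOn fun y hy => (himg ⟨y, hy, rfl⟩).1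
            exact ((intervalIntegrable_iff' enorm_ne_top).1
              ((h.intervalIntegrable_inv_growth 0 x).continuousOn_mul hc))
      _ = ∫ r in (0)..a, ρ r := by rw [X.time_zero, hxa]

/-- The explicit form of the semigroup generated by the transport operator, as an inequality
between absolute values. -/
theorem lintegral_enorm_semigroup_le (h : RegularCoefficients τ B τ₁ B₀ B₁ x₀ γ₀ γ₁)
    {lam : ℝ} {S : ℝ → L1 1 →L[ℝ] L1 1} (hS : IsC0Semigroup S)
    (hgen : HasGenerator S (TransportOperator τ B lam)) (f : L1 1) {t : ℝ} (ht : 0 ≤ t)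
    {φ : ℝ → ℝ≥0∞} (hφ : Measurable φ) :
    ∫⁻ x, φ x * ‖S t f x‖ₑ ∂halfLine ≤
      ∫⁻ y, φ (X.flow t y) * ENNReal.ofReal (Real.exp (-(lam * t)) * X.survival t y) * ‖f y‖ₑ
        ∂halfLine := by
  set m := X.intFactor lam with hm
  have hmc : Continuous m := X.continuous_intFactor lam
  have hm0 : ∀ x, 0 < m x := X.intFactor_pos lam
  -- The factor m may be unbounded, so integrability of m f is available on bounded intervals only.
  -- The comparison is made on (0, n], and these intervals exhaust the half-line.
  have hunion : Ioi (0 : ℝ) = ⋃ n : ℕ, Ioc (0 : ℝ) n := by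
    ext x
    simp only [mem_Ioi, mem_iUnion, mem_Ioc, exists_and_left]
    exact ⟨fun hx => ⟨hx, exists_nat_ge x⟩, fun hx => hx.1⟩
  have hdir : Directed (· ⊆ ·) fun n : ℕ => Ioc (0 : ℝ) n :=
    Monotone.directed_le fun a b hab => Ioc_subset_Ioc_right (by exact_mod_cast hab)
  have hmono : ∀ n : ℕ, ∫⁻ x in Ioc (0 : ℝ) n, φ x * ‖S t f x‖ₑ ≤
      ∫⁻ y, φ (X.flow t y) * ENNReal.ofReal (Real.exp (-(lam * t)) * X.survival t y) * ‖f y‖ₑ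
        ∂halfLine := by
    intro n
    have hTm : MeasurableSet {y | X.flow t y ≤ n} :=
      measurableSet_le (X.measurable_flow t) measurable_const
    have hn : (0 : ℝ) ≤ n := n.cast_nonneg
    have hsub : Ioi 0 ∩ {y | X.flow t y ≤ n} ⊆ Ioc 0 (n : ℝ) := fun y hy =>
      ⟨hy.1, (X.le_flow ht y).trans hy.2⟩
    have hint : ∀ g : L1 1, IntegrableOn (fun y => m y * g y) (Ioc 0 (n : ℝ)) := fun g =>
      (intervalIntegrable_iff_integrableOn_Ioc_of_le hn).1
        ((intervalIntegrable_L1 g hn).continuousOn_mul hmc.continuousOn)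
    -- The flow carries m f to m S_t f as signed measures. The test function is φ/m, and the
    -- quotient m(y)/m(flow) is exactly the damping factor.
    have key := lintegral_enorm_le_of_setIntegral_Iic_eq (μ := volume.restrict (Ioc 0 (n : ℝ)))
      (ν := volume.restrict (Ioi 0 ∩ {y | X.flow t y ≤ n})) (a := fun y => m y * S t f y)
      (b := fun y => m y * f y) (T := X.flow t) (ψ := fun x => φ x * ENNReal.ofReal (1 / m x))
      (hmc.measurable.mul (Lp.stronglyMeasurable _).measurable)
      (hmc.measurable.mul (Lp.stronglyMeasurable _).measurable) (X.measurable_flow t)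
      (hint _) ((hint _).mono_set hsub) ?_
      (hφ.mul (measurable_const.div hmc.measurable).ennreal_ofReal)
    · refine le_of_eq_of_le (lintegral_congr fun x => ?_) (key.trans
        ((lintegral_mono_set inter_subset_left).trans_eq (lintegral_congr fun y => ?_)))
      · rw [enorm_mul, Real.enorm_of_nonneg (hm0 x).le, mul_assoc, ← mul_assoc (ENNReal.ofReal _),
          ← ENNReal.ofReal_mul (one_div_pos.2 (hm0 x)).le, one_div_mul_cancel (hm0 x).ne',
          ENNReal.ofReal_one, one_mul]
      · rw [enorm_mul, Real.enorm_of_nonneg (hm0 y).le, mul_assoc, ← mul_assoc (ENNReal.ofReal _),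
          ← ENNReal.ofReal_mul (one_div_pos.2 (hm0 _)).le, one_div_mul_eq_div,
          X.intFactor_div_intFactor_flow, mul_assoc]
    · intro x
      set r := max (min x n) 0 with hr
      have hr0 : 0 ≤ r := le_max_right _ _
      have htr : 0 ≤ X.time r := X.time_zero ▸ X.time.monotone hr0
      have hs0 : 0 ≤ X.time.symm (max (X.time r - t) 0) := by
        rw [X.time.le_symm_apply, X.time_zero]
        exact le_max_right _ _
      have hset1 : Iic x ∩ Ioc 0 (n : ℝ) = Ioc 0 r := by
        ext y
        simp only [mem_inter_iff, mem_Iic, mem_Ioc, hr, le_max_iff, le_min_iff]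
        constructor
        · rintro ⟨h1, h2, h3⟩
          exact ⟨h2, Or.inl ⟨h1, h3⟩⟩
        · rintro ⟨h2, ⟨h1, h3⟩ | h3⟩
          · exact ⟨h1, h2, h3⟩
          · exact absurd h2 (not_lt.2 h3)
      -- The preimage is an interval ending where the characteristic through r was a time t earlier;
      -- the cut at 0 covers sizes that no particle present at time 0 could still have.
      have hset2 : X.flow t ⁻¹' Iic x ∩ (Ioi 0 ∩ {y | X.flow t y ≤ n}) =
          Ioc 0 (X.time.symm (max (X.time r - t) 0)) := by
        ext y
        have h1 : y ≤ X.time.symm (max (X.time r - t) 0) ↔ X.flow t y ≤ r ∨ y ≤ 0 := by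
          rw [X.time.le_symm_apply, le_max_iff, le_sub_iff_add_le, X.flow_le_iff]
          refine or_congr Iff.rfl ?_
          rw [← not_lt, X.time_pos, not_lt]
        rw [mem_Ioc, h1, hr]
        simp only [mem_inter_iff, mem_preimage, mem_Iic, mem_Ioi, mem_ofPred_eq, le_max_iff,
          le_min_iff]
        constructor
        · rintro ⟨h1, h2, h3⟩
          exact ⟨h2, Or.inl (Or.inl ⟨h1, h3⟩)⟩
        · rintro ⟨h2, (⟨h1, h3⟩ | h3) | h3⟩
          · exact ⟨h1, h2, h3⟩
          · exact absurd (X.flow_pos ht h2) (not_lt.2 h3)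
          · exact absurd h2 (not_lt.2 h3)
      rw [Measure.restrict_restrict measurableSet_Iic,
        Measure.restrict_restrict (X.measurable_flow t measurableSet_Iic), hset1, hset2,
        ← intervalIntegral.integral_of_le hr0, ← intervalIntegral.integral_of_le hs0,
        ← X.integral_intFactor_semigroup h hS hgen f ht htr, X.time.symm_apply_apply]
  rw [halfLine, hunion, setLIntegral_iUnion_of_directed _ hdir, ← hunion]
  exact iSup_le hmono

end Characteristics

/-! ### The positive part of the fragmentation operator -/

theorem map_div_halfLine {z : ℝ} (hz : 0 < z) :
    halfLine.map (fun x => x / z) = ENNReal.ofReal z • halfLine := by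
  ext s hs
  have hm : Measurable fun x : ℝ => x / z := measurable_id.div_const z
  have hpre : (fun x : ℝ => x / z) ⁻¹' s ∩ Ioi 0 = (fun x => x * z⁻¹) ⁻¹' (s ∩ Ioi 0) := by
    ext x
    simp [div_eq_mul_inv, hz]
  rw [Measure.map_apply hm hs, halfLine, Measure.restrict_apply (hm hs), hpre,
    Real.volume_preimage_mul_right (inv_pos.2 hz).ne', inv_inv, abs_of_pos hz,
    Measure.smul_apply, Measure.restrict_apply hs, smul_eq_mul]

section FragPlus

variable {B : ℝ → ℝ} {p : Measure ℝ} [IsFiniteMeasure p]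

theorem measurable_fragPlus_integrand (hB : Measurable B) {u : ℝ → ℝ} (hu : Measurable u) :
    Measurable fun q : ℝ × ℝ => B (q.1 / q.2) * u (q.1 / q.2) / q.2 := by
  have hq : Measurable fun q : ℝ × ℝ => q.1 / q.2 := measurable_fst.div measurable_snd
  exact ((hB.comp hq).mul (hu.comp hq)).div measurable_snd

/-- The fragmentation operator transports the mass `B |u|` by the contractions `y ↦ z y`. -/
theorem lintegral_lintegral_fragPlus (hB : Measurable B) (hB0 : ∀ x, 0 ≤ B x) {u : ℝ → ℝ}
    (hu : Measurable u) {φ : ℝ → ℝ≥0∞} (hφ : Measurable φ) :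
    ∫⁻ x, φ x * ∫⁻ z in Ioo 0 1, ‖B (x / z) * u (x / z) / z‖ₑ ∂p ∂halfLine =
      ∫⁻ y, ENNReal.ofReal (B y) * ‖u y‖ₑ * ∫⁻ z in Ioo 0 1, φ (z * y) ∂p ∂halfLine := by
  have hint := (measurable_fragPlus_integrand hB hu).enorm
  have : SFinite halfLine := by unfold halfLine; infer_instance
  calc _ = ∫⁻ x, ∫⁻ z in Ioo 0 1, φ x * ‖B (x / z) * u (x / z) / z‖ₑ ∂p ∂halfLine := by
        refine lintegral_congr fun x => (lintegral_const_mul _ ?_).symm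
        exact hint.comp (measurable_const.prodMk measurable_id)
    _ = ∫⁻ z in Ioo 0 1, ∫⁻ x, φ x * ‖B (x / z) * u (x / z) / z‖ₑ ∂halfLine ∂p :=
        lintegral_lintegral_swap ((hφ.comp measurable_fst).mul hint).aemeasurable
    _ = ∫⁻ z in Ioo 0 1, ∫⁻ y, ENNReal.ofReal (B y) * ‖u y‖ₑ * φ (z * y) ∂halfLine ∂p := by
        refine setLIntegral_congr_fun measurableSet_Ioo fun z hz => ?_
        have hz0 : 0 < z := hz.1
        have hF : Measurable fun y => ENNReal.ofReal (B y) * ‖u y‖ₑ * φ (z * y) :=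
          (hB.ennreal_ofReal.mul hu.enorm).mul (hφ.comp (measurable_const_mul z))
        have hmap := lintegral_map (μ := halfLine) hF (measurable_id.div_const z)
        simp only [id] at hmap
        rw [map_div_halfLine hz0, lintegral_smul_measure, smul_eq_mul] at hmap
        have h1 : ∀ x, φ x * ‖B (x / z) * u (x / z) / z‖ₑ = ENNReal.ofReal z⁻¹ *
            (ENNReal.ofReal (B (x / z)) * ‖u (x / z)‖ₑ * φ (z * (x / z))) := by
          intro x
          rw [mul_div_cancel₀ x hz0.ne', div_eq_mul_inv, enorm_mul, enorm_mul,
            Real.enorm_of_nonneg (hB0 _), Real.enorm_of_nonneg (inv_pos.2 hz0).le]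
          ring
        simp only [h1]
        rw [lintegral_const_mul' _ _ ENNReal.ofReal_ne_top, ← hmap, ← mul_assoc,
          ← ENNReal.ofReal_mul (inv_pos.2 hz0).le, inv_mul_cancel₀ hz0.ne', ENNReal.ofReal_one,
          one_mul]
    _ = ∫⁻ y, ∫⁻ z in Ioo 0 1, ENNReal.ofReal (B y) * ‖u y‖ₑ * φ (z * y) ∂p ∂halfLine := by
        refine lintegral_lintegral_swap (Measurable.aemeasurable ?_)
        exact ((hB.ennreal_ofReal.mul hu.enorm).comp measurable_snd).mul
          (hφ.comp (measurable_fst.mul measurable_snd))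
    _ = _ := lintegral_congr fun y => lintegral_const_mul _ (hφ.comp (measurable_mul_const y))

theorem lintegral_enorm_fragPlus_le (hB : Measurable B) (hB0 : ∀ x, 0 ≤ B x) {u : ℝ → ℝ}
    (hu : Measurable u) {φ : ℝ → ℝ≥0∞} (hφ : Measurable φ) :
    ∫⁻ x, φ x * ‖fragPlus B p u x‖ₑ ∂halfLine ≤
      ∫⁻ y, ENNReal.ofReal (B y) * ‖u y‖ₑ * ∫⁻ z in Ioo 0 1, φ (z * y) ∂p ∂halfLine := by
  rw [← lintegral_lintegral_fragPlus hB hB0 hu hφ]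
  exact lintegral_mono fun x => mul_le_mul_right (enorm_integral_le_lintegral_enorm _) _

theorem stronglyMeasurable_fragPlus (hB : Measurable B) {u : ℝ → ℝ} (hu : Measurable u) :
    StronglyMeasurable (fragPlus B p u) :=
  (measurable_fragPlus_integrand hB hu).stronglyMeasurable.integral_prod_right'

/-- For each fixed z the scaling x ↦ x/z preserves null sets; Fubini then makes `fragPlus` well
defined on classes of functions. -/
theorem fragPlus_congr (hB : Measurable B) {u v : ℝ → ℝ} (hu : Measurable u) (hv : Measurable v)
    (huv : u =ᵐ[halfLine] v) : fragPlus B p u =ᵐ[halfLine] fragPlus B p v := by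
  have : SFinite halfLine := by unfold halfLine; infer_instance
  have h1 : ∀ᵐ z ∂(p.restrict (Ioo 0 1)), ∀ᵐ x ∂halfLine, B (x / z) * u (x / z) / z =
      B (x / z) * v (x / z) / z := by
    filter_upwards [ae_restrict_mem measurableSet_Ioo] with z hz
    have h2 : ∀ᵐ y ∂(halfLine.map fun x => x / z), u y = v y := by
      rw [map_div_halfLine hz.1]
      exact Measure.ae_smul_measure huv _
    filter_upwards [ae_of_ae_map (measurable_id.div_const z).aemeasurable h2] with x hx
    simp only [id] at hx
    rw [hx]
  have hms : MeasurableSet {q : ℝ × ℝ | B (q.2 / q.1) * u (q.2 / q.1) / q.1 =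
      B (q.2 / q.1) * v (q.2 / q.1) / q.1} :=
    measurableSet_eq_fun ((measurable_fragPlus_integrand hB hu).comp measurable_swap)
      ((measurable_fragPlus_integrand hB hv).comp measurable_swap)
  filter_upwards [(Measure.ae_ae_comm hms).1 h1] with x hx
  exact integral_congr_ae hx

/-- The transport identity with φ = 1 shows that the double integral is p(0,1) times the integral of
B|u|, hence finite. Linearity of `fragPlus` depends on this convergence. -/
theorem ae_integrable_fragPlus (hB : Measurable B) (hB0 : ∀ x, 0 ≤ B x) {u : ℝ → ℝ}
    (hu : Measurable u) (hBu : ∫⁻ y, ENNReal.ofReal (B y) * ‖u y‖ₑ ∂halfLine < ∞) :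
    ∀ᵐ x ∂halfLine, Integrable (fun z => B (x / z) * u (x / z) / z) (p.restrict (Ioo 0 1)) := by
  have hm := measurable_fragPlus_integrand hB hu
  have h1 := lintegral_lintegral_fragPlus (p := p) hB hB0 hu (φ := fun _ => 1) measurable_const
  simp only [one_mul, lintegral_const, Measure.restrict_apply_univ] at h1
  rw [lintegral_mul_const' _ _ (measure_ne_top p _)] at h1
  have h2 := ae_lt_top hm.enorm.lintegral_prod_right'
    (h1.trans_lt (ENNReal.mul_lt_top hBu (measure_lt_top p _))).ne
  filter_upwards [h2] with x hx
  exact ⟨(hm.comp (measurable_const.prodMk measurable_id)).aestronglyMeasurable, hx⟩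

/-- The weight `(1 + B(x)) (1+x)^α`. -/
noncomputable def fragWeight (B : ℝ → ℝ) (α : ℝ) (x : ℝ) : ℝ≥0∞ :=
  (1 + ENNReal.ofReal (B x)) * powWeight α x

theorem isWeight_fragWeight (hB : Measurable B) (α : ℝ) : IsWeight (fragWeight B α) where
  measurable := (measurable_const.add hB.ennreal_ofReal).mul (isWeight_powWeight α).measurable
  ne_zero x hx := mul_ne_zero (by simp) ((isWeight_powWeight α).ne_zero x hx)
  ne_top x hx := ENNReal.mul_ne_top (by finiteness) ((isWeight_powWeight α).ne_top x hx)

theorem powWeight_le_fragWeight (α x : ℝ) : powWeight α x ≤ fragWeight B α x :=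
  le_mul_of_one_le_left zero_le le_self_add

theorem ofReal_mul_powWeight_le_fragWeight (α x : ℝ) :
    ENNReal.ofReal (B x) * powWeight α x ≤ fragWeight B α x :=
  mul_le_mul_left le_add_self _

/-- `F₊` as a bounded operator from `L¹((1+B(x))(1+x)^α dx)` to `L¹_α`. -/
theorem exists_fragPlus_clm (hB : Measurable B) (hB0 : ∀ x, 0 ≤ B x) {α : ℝ} (hα : 0 ≤ α) :
    ∃ T : Lp ℝ 1 (weightMeasure (fragWeight B α)) →L[ℝ] Lp ℝ 1 (weightMeasure (powWeight α)),
      ∀ u, T u =ᵐ[halfLine] fragPlus B p u := by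
  have hw := isWeight_fragWeight hB α
  have hmeas : ∀ u : Lp ℝ 1 (weightMeasure (fragWeight B α)), Measurable u := fun u =>
    (Lp.stronglyMeasurable u).measurable
  have hfin : ∀ u : Lp ℝ 1 (weightMeasure (fragWeight B α)),
      ∫⁻ y, ENNReal.ofReal (B y) * ‖u y‖ₑ ∂halfLine < ∞ := by
    refine fun u => (lintegral_mono_ae ?_).trans_lt (hw.lintegral_lt_top u)
    filter_upwards [ae_halfLine_pos] with y hy
    gcongr
    refine le_trans ?_ (ofReal_mul_powWeight_le_fragWeight α y)
    exact le_mul_of_one_le_right zero_le (one_le_powWeight hα hy)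
  refine IsWeight.exists_clm hw (isWeight_powWeight α) (fun u => fragPlus B p u)
    (fun u => (stronglyMeasurable_fragPlus hB (hmeas u)).aestronglyMeasurable) ?_ ?_
    (p (Ioo 0 1)).toReal ?_
  · intro u v
    refine (fragPlus_congr hB (hmeas _) ((hmeas u).add (hmeas v))
      (hw.ae_iff.1 (Lp.coeFn_add u v))).trans ?_
    filter_upwards [ae_integrable_fragPlus (p := p) hB hB0 (hmeas u) (hfin u),
      ae_integrable_fragPlus (p := p) hB hB0 (hmeas v) (hfin v)] with x hu hv
    rw [Pi.add_apply, fragPlus, fragPlus, fragPlus, ← integral_add hu hv]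
    refine integral_congr_ae (ae_of_all _ fun z => ?_)
    simp only [Pi.add_apply]
    ring
  · intro c u
    refine (fragPlus_congr hB (hmeas _) ((hmeas u).const_smul c)
      (hw.ae_iff.1 (Lp.coeFn_smul c u))).trans (ae_of_all _ fun x => ?_)
    rw [Pi.smul_apply, fragPlus, fragPlus, ← integral_smul]
    refine integral_congr_ae (ae_of_all _ fun z => ?_)
    simp only [Pi.smul_apply, smul_eq_mul]
    ring
  · intro u
    refine (lintegral_enorm_fragPlus_le hB hB0 (hmeas u) (isWeight_powWeight α).measurable).trans ?_
    rw [ENNReal.ofReal_toReal (measure_ne_top p _), ← lintegral_const_mul' _ _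
      (measure_ne_top p _)]
    refine lintegral_mono_ae ?_
    filter_upwards [ae_halfLine_pos] with y hy
    have h1 : ∫⁻ z in Ioo 0 1, powWeight α (z * y) ∂p ≤ powWeight α y * p (Ioo 0 1) := by
      rw [← setLIntegral_const]
      refine setLIntegral_mono measurable_const fun z hz => ?_
      have hzy : z * y ≤ y := mul_le_of_le_one_left hy.le hz.2.le
      have hzy' : 0 < z * y := mul_pos hz.1 hy
      exact ENNReal.ofReal_le_ofReal (Real.rpow_le_rpow (by linarith) (by linarith) hα)
    calc _ ≤ ENNReal.ofReal (B y) * ‖u y‖ₑ * (powWeight α y * p (Ioo 0 1)) := by gcongr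
      _ = p (Ioo 0 1) * (ENNReal.ofReal (B y) * powWeight α y * ‖u y‖ₑ) := by ring
      _ ≤ _ := by
        gcongr
        exact ofReal_mul_powWeight_le_fragWeight α y

end FragPlus

/-! ### Smoothing and strong continuity of the semigroup in weighted spaces -/

theorem exists_inclusion {w : ℝ → ℝ≥0∞} (hw : IsWeight w)
    (hle : ∀ x, 0 < x → powWeight 1 x ≤ w x) :
    ∃ ι : Lp ℝ 1 (weightMeasure w) →L[ℝ] L1 1, ∀ f, ι f =ᵐ[halfLine] f := by
  refine IsWeight.exists_clm hw (isWeight_powWeight 1) (fun f => f)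
    (fun f => (Lp.stronglyMeasurable f).aestronglyMeasurable)
    (fun f g => hw.ae_iff.1 (Lp.coeFn_add f g)) (fun c f => hw.ae_iff.1 (Lp.coeFn_smul c f)) 1
    fun f => ?_
  rw [ENNReal.ofReal_one, one_mul]
  refine lintegral_mono_ae ?_
  filter_upwards [ae_halfLine_pos] with x hx
  gcongr
  exact hle x hx

theorem L1_ext {f g : L1 1} (h : f =ᵐ[halfLine] g) : f = g :=
  Lp.ext ((isWeight_powWeight 1).ae_iff.2 h)

namespace Characteristics

variable {τ B : ℝ → ℝ} {τ₁ B₀ B₁ x₀ γ₀ γ₁ : ℝ} (X : Characteristics τ B)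

/-- The factor by which mass decays along the characteristic from `y` up to time `t`. -/
noncomputable def decay (lam t y : ℝ) : ℝ≥0∞ :=
  ENNReal.ofReal (Real.exp (-(lam * t)) * X.survival t y)

theorem measurable_decay (lam : ℝ) : Measurable fun q : ℝ × ℝ => X.decay lam q.1 q.2 :=
  (Continuous.mul (by fun_prop) X.continuous_survival).measurable.ennreal_ofReal

theorem decay_le {lam t T y : ℝ} (ht : 0 ≤ t) (htT : t ≤ T) :
    X.decay lam t y ≤ ENNReal.ofReal (Real.exp (|lam| * T)) * ENNReal.ofReal (X.survival t y) := by
  rw [decay, ENNReal.ofReal_mul (Real.exp_pos _).le]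
  gcongr
  calc -(lam * t) ≤ |lam * t| := neg_le_abs _
    _ = |lam| * t := by rw [abs_mul, abs_of_nonneg ht]
    _ ≤ |lam| * T := mul_le_mul_of_nonneg_left htT (abs_nonneg _)

theorem decay_le_const (h : RegularCoefficients τ B τ₁ B₀ B₁ x₀ γ₀ γ₁) {lam t T y : ℝ}
    (ht : 0 ≤ t) (htT : t ≤ T) (hy : 0 < y) :
    X.decay lam t y ≤ ENNReal.ofReal (Real.exp (|lam| * T)) := by
  refine (X.decay_le ht htT).trans (mul_le_of_le_one_right zero_le ?_)
  rw [ENNReal.ofReal_le_one]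
  exact X.survival_le_one h.growth_pos h.frag_nonneg hy ht

theorem powWeight_flow_le (h : RegularCoefficients τ B τ₁ B₀ B₁ x₀ γ₀ γ₁) {α t T y : ℝ}
    (hα : 0 ≤ α) (ht : 0 ≤ t) (htT : t ≤ T) (hy : 0 < y) :
    powWeight α (X.flow t y) ≤ ENNReal.ofReal (Real.exp (τ₁ * T * α)) * powWeight α y := by
  rw [powWeight, powWeight, ← ENNReal.ofReal_mul (Real.exp_pos _).le, Real.exp_mul,
    ← Real.mul_rpow (Real.exp_pos _).le (by linarith)]
  refine ENNReal.ofReal_le_ofReal (Real.rpow_le_rpow (by linarith [X.flow_pos ht hy]) ?_ hα)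
  refine (X.one_add_flow_le h.growth_pos h.growth_le ht hy).trans ?_
  gcongr
  exact h.pos_τ₁.le

/-- A positive time suffices for the loss to compensate the growth of the fragmentation rate. -/
theorem exists_frag_mul_survival_le (h : RegularCoefficients τ B τ₁ B₀ B₁ x₀ γ₀ γ₁) {δ T : ℝ}
    (hδ : 0 < δ) : ∃ C : ℝ, 0 ≤ C ∧ ∀ s ∈ Icc δ T, ∀ y, 0 < y →
      B (X.flow s y) * X.survival s y ≤ C := by
  -- With u = y^γ₀, the growth y^γ₁ of B is a power of u, while survival up to time δ is at most
  -- exp(-δ B₀ u). The exponential wins however large γ₁ is compared with γ₀.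
  have hlim : Tendsto (fun y : ℝ => (y ^ γ₀) ^ (γ₁ / γ₀) * Real.exp (-(δ * B₀) * y ^ γ₀)) atTop
      (𝓝 0) :=
    (tendsto_rpow_mul_exp_neg_mul_atTop_nhds_zero (γ₁ / γ₀) (δ * B₀)
      (mul_pos hδ h.pos_B₀)).comp (tendsto_rpow_atTop h.pos_γ₀)
  obtain ⟨Y, hY1, hYx, hY⟩ := ((eventually_ge_atTop 1).and ((eventually_ge_atTop x₀).and
    (eventually_forall_ge_atTop.2 (hlim.eventually_le_const zero_lt_one)))).exists
  have hB₁ := h.pos_B₁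
  have hγ₁ := h.pos_γ₁
  set K : ℝ := B₁ * Real.exp (τ₁ * T) ^ γ₁ with hK
  have hK0 : 0 ≤ K := by positivity
  refine ⟨max (K * (1 + Y) ^ γ₁) (K * 2 ^ γ₁), le_max_of_le_right (by positivity), ?_⟩
  intro s hs y hy
  have hs0 : 0 ≤ s := hδ.le.trans hs.1
  have hBy : B (X.flow s y) ≤ K * (1 + y) ^ γ₁ := by
    refine (h.frag_le _ (X.flow_pos hs0 hy)).trans ?_
    rw [hK, mul_assoc, ← Real.mul_rpow (Real.exp_pos _).le (by linarith)]
    refine mul_le_mul_of_nonneg_left (Real.rpow_le_rpow (by linarith [X.flow_pos hs0 hy]) ?_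
      hγ₁.le) hB₁.le
    refine (X.one_add_flow_le h.growth_pos h.growth_le hs0 hy).trans ?_
    gcongr
    · exact h.pos_τ₁.le
    · exact hs.2
  have hsurv := X.survival_pos s y
  rcases le_total y Y with hyY | hyY
  · refine le_max_of_le_left ?_
    calc B (X.flow s y) * X.survival s y ≤ K * (1 + y) ^ γ₁ * 1 :=
          mul_le_mul hBy (X.survival_le_one h.growth_pos h.frag_nonneg hy hs0) hsurv.le
            (by positivity)
      _ ≤ K * (1 + Y) ^ γ₁ := by
          rw [mul_one]
          gcongr
  · refine le_max_of_le_right ?_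
    have hdec : X.survival s y ≤ Real.exp (-(δ * B₀) * y ^ γ₀) := by
      refine (X.survival_le_exp h.growth_pos hy hs0 (c := B₀ * y ^ γ₀) fun x hx => ?_).trans ?_
      · refine le_trans ?_ (h.le_frag x (hYx.trans (hyY.trans hx)))
        exact mul_le_mul_of_nonneg_left (Real.rpow_le_rpow hy.le hx h.pos_γ₀.le) h.pos_B₀.le
      · refine Real.exp_le_exp.2 ?_
        rw [neg_mul, neg_le_neg_iff, mul_assoc]
        exact mul_le_mul_of_nonneg_right hs.1
          (mul_nonneg h.pos_B₀.le (Real.rpow_nonneg hy.le _))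
    have hpow : (y ^ γ₀) ^ (γ₁ / γ₀) = y ^ γ₁ := by
      rw [← Real.rpow_mul hy.le, mul_div_cancel₀ _ h.pos_γ₀.ne']
    have h1 : (1 + y) ^ γ₁ ≤ 2 ^ γ₁ * y ^ γ₁ := by
      rw [← Real.mul_rpow zero_le_two hy.le]
      exact Real.rpow_le_rpow (by linarith) (by linarith) hγ₁.le
    calc B (X.flow s y) * X.survival s y
        ≤ K * (2 ^ γ₁ * y ^ γ₁) * Real.exp (-(δ * B₀) * y ^ γ₀) := by
          refine mul_le_mul (hBy.trans (by gcongr)) hdec hsurv.le (by positivity)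
      _ = K * 2 ^ γ₁ * ((y ^ γ₀) ^ (γ₁ / γ₀) * Real.exp (-(δ * B₀) * y ^ γ₀)) := by
          rw [hpow]; ring
      _ ≤ K * 2 ^ γ₁ := mul_le_of_le_one_right (by positivity) (hY y hyY)

/-- This is the smoothing effect of the loss term: at positive times the semigroup takes values in
the domain of `F₊`, with a bound uniform in s ≥ δ. -/
theorem exists_fragWeight_flow_mul_decay_le (h : RegularCoefficients τ B τ₁ B₀ B₁ x₀ γ₀ γ₁)
    (lam : ℝ) {α δ T : ℝ} (hα : 0 ≤ α) (hδ : 0 < δ) : ∃ C : ℝ, ∀ s ∈ Icc δ T, ∀ y, 0 < y →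
      fragWeight B α (X.flow s y) * X.decay lam s y ≤ ENNReal.ofReal C * powWeight α y := by
  obtain ⟨C, hC, hCb⟩ := X.exists_frag_mul_survival_le h (T := T) hδ
  refine ⟨(1 + C) * Real.exp (τ₁ * T * α) * Real.exp (|lam| * T), fun s hs y hy => ?_⟩
  have hs0 : 0 ≤ s := hδ.le.trans hs.1
  have h1 : (1 + ENNReal.ofReal (B (X.flow s y))) * ENNReal.ofReal (X.survival s y) ≤
      ENNReal.ofReal (1 + C) := by
    rw [← ENNReal.ofReal_one, ← ENNReal.ofReal_add zero_le_one (h.frag_nonneg _),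
      ← ENNReal.ofReal_mul (add_nonneg zero_le_one (h.frag_nonneg _))]
    refine ENNReal.ofReal_le_ofReal ?_
    rw [add_mul, one_mul]
    exact add_le_add (X.survival_le_one h.growth_pos h.frag_nonneg hy hs0) (hCb s hs y hy)
  calc fragWeight B α (X.flow s y) * X.decay lam s y
      ≤ (1 + ENNReal.ofReal (B (X.flow s y))) * (ENNReal.ofReal (Real.exp (τ₁ * T * α)) *
          powWeight α y) * (ENNReal.ofReal (Real.exp (|lam| * T)) *
            ENNReal.ofReal (X.survival s y)) := by
        rw [fragWeight]
        gcongr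
        · exact X.powWeight_flow_le h hα hs0 hs.2 hy
        · exact X.decay_le hs0 hs.2
    _ = ((1 + ENNReal.ofReal (B (X.flow s y))) * ENNReal.ofReal (X.survival s y)) *
          ENNReal.ofReal (Real.exp (τ₁ * T * α)) * ENNReal.ofReal (Real.exp (|lam| * T)) *
          powWeight α y := by ring
    _ ≤ _ := by
        rw [ENNReal.ofReal_mul (by positivity), ENNReal.ofReal_mul (by positivity)]
        gcongr

section Semigroup

variable {lam : ℝ} {S : ℝ → L1 1 →L[ℝ] L1 1} {w₁ w₂ : ℝ → ℝ≥0∞}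

theorem exists_semigroup_clm (h : RegularCoefficients τ B τ₁ B₀ B₁ x₀ γ₀ γ₁)
    (hS : IsC0Semigroup S) (hgen : HasGenerator S (TransportOperator τ B lam))
    (hw₁ : IsWeight w₁) (hw₂ : IsWeight w₂) (hle : ∀ x, 0 < x → powWeight 1 x ≤ w₁ x)
    {t : ℝ} (ht : 0 ≤ t) {C : ℝ}
    (hC : ∀ y, 0 < y → w₂ (X.flow t y) * X.decay lam t y ≤ ENNReal.ofReal C * w₁ y) :
    ∃ T : Lp ℝ 1 (weightMeasure w₁) →L[ℝ] Lp ℝ 1 (weightMeasure w₂),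
      ∀ (f : Lp ℝ 1 (weightMeasure w₁)) (f₁ : L1 1), f₁ =ᵐ[halfLine] f →
        T f =ᵐ[halfLine] S t f₁ := by
  obtain ⟨ι, hι⟩ := exists_inclusion hw₁ hle
  obtain ⟨T, hT⟩ := IsWeight.exists_clm hw₁ hw₂ (fun f => S t (ι f))
    (fun f => (Lp.stronglyMeasurable _).aestronglyMeasurable)
    (fun f g => by
      rw [map_add, map_add]
      exact (isWeight_powWeight 1).ae_iff.1 (Lp.coeFn_add _ _))
    (fun c f => by
      rw [map_smul, map_smul]
      exact (isWeight_powWeight 1).ae_iff.1 (Lp.coeFn_smul _ _)) C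
    (fun f => by
      refine (X.lintegral_enorm_semigroup_le h hS hgen (ι f) ht hw₂.measurable).trans ?_
      rw [← lintegral_const_mul' _ _ ENNReal.ofReal_ne_top]
      refine lintegral_mono_ae ?_
      filter_upwards [ae_halfLine_pos, hι f] with y hy hιy
      rw [hιy, ← mul_assoc]
      exact mul_le_mul_left (hC y hy) _)
  refine ⟨T, fun f f₁ hf => ?_⟩
  rw [L1_ext (hf.trans (hι f).symm)]
  exact hT f

theorem tendsto_tail {w : ℝ → ℝ≥0∞} (hw : IsWeight w) (f : Lp ℝ 1 (weightMeasure w)) :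
    Tendsto (fun N : ℕ => ∫⁻ x, (Ioi (N : ℝ)).indicator w x * ‖f x‖ₑ ∂halfLine) atTop (𝓝 0) := by
  have := tendsto_lintegral_of_dominated_convergence (μ := halfLine)
    (F := fun (N : ℕ) x => (Ioi (N : ℝ)).indicator w x * ‖f x‖ₑ) (f := fun _ => 0)
    (fun x => w x * ‖f x‖ₑ)
    (fun N => (hw.measurable.indicator measurableSet_Ioi).mul
      (Lp.stronglyMeasurable f).measurable.enorm)
    (fun N => ae_of_all _ fun x => mul_le_mul_left (indicator_le_self _ _ x) _)
    (hw.lintegral_lt_top f).ne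
    (ae_of_all _ fun x => by
      refine tendsto_const_nhds.congr' ?_
      filter_upwards [eventually_ge_atTop ⌈x⌉₊] with N hN
      rw [indicator_of_notMem, zero_mul]
      exact not_lt.2 (Nat.ceil_le.1 hN))
  simpa using this

/-- Continuity is known only in L¹_1. On a bounded interval the target weight is bounded, so that
continuity suffices; far away, the mass must have started far out, and it is controlled by the tail
of f uniformly in time. -/
theorem continuousOn_semigroup (h : RegularCoefficients τ B τ₁ B₀ B₁ x₀ γ₀ γ₁)
    (hS : IsC0Semigroup S) (hgen : HasGenerator S (TransportOperator τ B lam))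
    (hw₁ : IsWeight w₁) (hw₂ : IsWeight w₂) (hle : ∀ x, 0 < x → powWeight 1 x ≤ w₁ x)
    {J : Set ℝ} (hJ : J ⊆ Ici 0)
    {T : ℝ → Lp ℝ 1 (weightMeasure w₁) →L[ℝ] Lp ℝ 1 (weightMeasure w₂)}
    (hT : ∀ s ∈ J, ∀ (f : Lp ℝ 1 (weightMeasure w₁)) (f₁ : L1 1), f₁ =ᵐ[halfLine] f →
        T s f =ᵐ[halfLine] S s f₁)
    (hbd : ∀ s₀ ∈ J, ∃ C : ℝ, ∀ᶠ s in 𝓝[J] s₀, ∀ y, 0 < y →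
      w₂ (X.flow s y) * X.decay lam s y ≤ ENNReal.ofReal C * w₁ y)
    (hloc : ∀ R : ℝ, ∃ C : ℝ, ∀ x ∈ Ioc 0 R, w₂ x ≤ ENNReal.ofReal C)
    (f : Lp ℝ 1 (weightMeasure w₁)) : ContinuousOn (fun s => T s f) J := by
  intro s₀ hs₀
  obtain ⟨C, hC⟩ := hbd s₀ hs₀
  obtain ⟨ι, hι⟩ := exists_inclusion hw₁ hle
  rw [ContinuousWithinAt, tendsto_iff_edist_tendsto_0, ENNReal.tendsto_nhds_zero]
  intro ε hε
  have hε3 : 0 < ε / 3 := ENNReal.div_pos hε.ne' (by simp)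
  have htail := ENNReal.Tendsto.const_mul (a := ENNReal.ofReal C) (tendsto_tail hw₁ f)
    (Or.inr ENNReal.ofReal_ne_top)
  rw [mul_zero] at htail
  obtain ⟨N, hN⟩ := (htail.eventually_le_const hε3).exists
  rw [← lintegral_const_mul' _ _ ENNReal.ofReal_ne_top] at hN
  -- A particle that starts below N remains below R up to time s₀ + 1, so mass beyond R comes from
  -- the tail y > N.
  set R := X.flow (s₀ + 1) N
  obtain ⟨K, hK⟩ := hloc R
  have hnear : Tendsto (fun s => ENNReal.ofReal K * ‖S s (ι f) - S s₀ (ι f)‖ₑ) (𝓝[J] s₀) (𝓝 0) := by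
    have h1 : Tendsto (fun s => ‖S s (ι f) - S s₀ (ι f)‖ₑ) (𝓝[J] s₀) (𝓝 0) := by
      have h2 := (((hS.continuousOn (ι f)).mono hJ) s₀ hs₀).tendsto
      rw [tendsto_iff_edist_tendsto_0] at h2
      simpa only [edist_eq_enorm_sub] using h2
    simpa using ENNReal.Tendsto.const_mul (a := ENNReal.ofReal K) h1
      (Or.inr ENNReal.ofReal_ne_top)
  have hφ : Measurable ((Ioi R).indicator w₂) := hw₂.measurable.indicator measurableSet_Ioi
  have hfar : ∀ s ∈ J, s ≤ s₀ + 1 →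
      (∀ y, 0 < y → w₂ (X.flow s y) * X.decay lam s y ≤ ENNReal.ofReal C * w₁ y) →
      ∫⁻ x, (Ioi R).indicator w₂ x * ‖S s (ι f) x‖ₑ ∂halfLine ≤ ε / 3 := by
    intro s hs hs1 hCs
    refine (X.lintegral_enorm_semigroup_le h hS hgen (ι f) (hJ hs) hφ).trans (le_trans ?_ hN)
    refine lintegral_mono_ae ?_
    filter_upwards [ae_halfLine_pos, hι f] with y hy hιy
    rw [hιy, ← mul_assoc]
    refine mul_le_mul_left ?_ _
    by_cases hyR : X.flow s y ∈ Ioi R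
    · have hyN : y ∈ Ioi (N : ℝ) := by
        by_contra hcon
        exact absurd (X.flow_le_flow hs1 (not_lt.1 hcon)) (not_le.2 hyR)
      rw [indicator_of_mem hyR, indicator_of_mem hyN]
      exact hCs y hy
    · rw [indicator_of_notMem hyR, zero_mul]
      exact zero_le
  have hs1 : ∀ᶠ s in 𝓝[J] s₀, s < s₀ + 1 :=
    mem_nhdsWithin_of_mem_nhds (Iio_mem_nhds (by linarith))
  filter_upwards [hC, hnear.eventually_le_const hε3, hs1, self_mem_nhdsWithin]
    with s hCs hns hs1 hsJ
  rw [edist_eq_enorm_sub, hw₂.enorm_eq]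
  have hsub : ∀ᵐ x ∂halfLine, (T s f - T s₀ f) x = (S s (ι f) - S s₀ (ι f)) x ∧
      (S s (ι f) - S s₀ (ι f)) x = S s (ι f) x - S s₀ (ι f) x := by
    filter_upwards [hw₂.ae_iff.1 (Lp.coeFn_sub (T s f) (T s₀ f)),
      (isWeight_powWeight 1).ae_iff.1 (Lp.coeFn_sub (S s (ι f)) (S s₀ (ι f))),
      hT s hsJ f _ (hι f), hT s₀ hs₀ f _ (hι f)] with x h1 h2 h3 h4
    have h2' : (S s (ι f) - S s₀ (ι f)) x = S s (ι f) x - S s₀ (ι f) x := h2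
    exact ⟨by rw [h1, h2', Pi.sub_apply, h3, h4], h2'⟩
  have hm : ∀ g : L1 1, Measurable fun x => (Ioi R).indicator w₂ x * ‖g x‖ₑ := fun g =>
    hφ.mul (Lp.stronglyMeasurable g).measurable.enorm
  calc ∫⁻ x, w₂ x * ‖(T s f - T s₀ f) x‖ₑ ∂halfLine
      ≤ ∫⁻ x, (ENNReal.ofReal K * ‖(S s (ι f) - S s₀ (ι f)) x‖ₑ +
          (Ioi R).indicator w₂ x * ‖S s (ι f) x‖ₑ) +
          (Ioi R).indicator w₂ x * ‖S s₀ (ι f) x‖ₑ ∂halfLine := by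
        refine lintegral_mono_ae ?_
        filter_upwards [hsub, ae_halfLine_pos] with x hx hx0
        by_cases hxR : x ∈ Ioi R
        · rw [hx.1, hx.2, indicator_of_mem hxR, add_assoc, ← mul_add]
          refine le_add_left ?_
          gcongr
          exact enorm_sub_le
        · rw [hx.1, indicator_of_notMem hxR, zero_mul, zero_mul, add_zero, add_zero]
          gcongr
          exact hK x ⟨hx0, not_lt.1 hxR⟩
    _ = ENNReal.ofReal K * ∫⁻ x, ‖(S s (ι f) - S s₀ (ι f)) x‖ₑ ∂halfLine +
          ∫⁻ x, (Ioi R).indicator w₂ x * ‖S s (ι f) x‖ₑ ∂halfLine +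
          ∫⁻ x, (Ioi R).indicator w₂ x * ‖S s₀ (ι f) x‖ₑ ∂halfLine := by
        rw [lintegral_add_right _ (hm _), lintegral_add_right _ (hm _),
          lintegral_const_mul' _ _ ENNReal.ofReal_ne_top]
    _ ≤ ε / 3 + ε / 3 + ε / 3 := by
        gcongr
        · exact le_trans (by gcongr; exact lintegral_enorm_le_enorm _) hns
        · exact hfar s hsJ hs1.le hCs
        · exact hfar s₀ hs₀ (by linarith) (hC.self_of_nhdsWithin hs₀)
    _ = ε := ENNReal.add_thirds ε

end Semigroup

end Characteristics

/-! ### The operators of the Duhamel integral and their kernel -/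

theorem exists_inclusion_of_le {w w' : ℝ → ℝ≥0∞} (hw : IsWeight w) (hw' : IsWeight w')
    (hle : ∀ x, 0 < x → w' x ≤ w x) :
    ∃ ι : Lp ℝ 1 (weightMeasure w) →L[ℝ] Lp ℝ 1 (weightMeasure w'), ∀ f, ι f =ᵐ[halfLine] f := by
  refine IsWeight.exists_clm hw hw' (fun f => f)
    (fun f => (Lp.stronglyMeasurable f).aestronglyMeasurable)
    (fun f g => hw.ae_iff.1 (Lp.coeFn_add f g)) (fun c f => hw.ae_iff.1 (Lp.coeFn_smul c f)) 1
    fun f => ?_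
  rw [ENNReal.ofReal_one, one_mul]
  refine lintegral_mono_ae ?_
  filter_upwards [ae_halfLine_pos] with x hx
  gcongr
  exact hle x hx

theorem exists_indicator_clm {w : ℝ → ℝ≥0∞} (hw : IsWeight w) {A : Set ℝ} (hA : MeasurableSet A) :
    ∃ P : Lp ℝ 1 (weightMeasure w) →L[ℝ] Lp ℝ 1 (weightMeasure w),
      ∀ f, P f =ᵐ[halfLine] A.indicator f := by
  refine IsWeight.exists_clm hw hw (fun f => A.indicator f)
    (fun f => ((Lp.stronglyMeasurable f).indicator hA).aestronglyMeasurable) ?_ ?_ 1 fun f => ?_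
  · intro f g
    filter_upwards [hw.ae_iff.1 (Lp.coeFn_add f g)] with x hx
    by_cases hxA : x ∈ A
    · simp only [Pi.add_apply, indicator_of_mem hxA]
      exact hx
    · simp [hxA]
  · intro c f
    filter_upwards [hw.ae_iff.1 (Lp.coeFn_smul c f)] with x hx
    by_cases hxA : x ∈ A
    · simp only [Pi.smul_apply, indicator_of_mem hxA]
      exact hx
    · simp [hxA]
  · rw [ENNReal.ofReal_one, one_mul]
    refine lintegral_mono fun x => ?_
    by_cases hxA : x ∈ A <;> simp [hxA]

namespace Characteristics

variable {τ B : ℝ → ℝ} {τ₁ B₀ B₁ x₀ γ₀ γ₁ : ℝ} (X : Characteristics τ B)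

/-- The expected value of `φ` at time `t` for a particle that starts from `y`, splits at time `s`
and is not allowed to split at any other time. -/
noncomputable def duhamelKernel (lam : ℝ) (p : Measure ℝ) (t : ℝ) (φ : ℝ → ℝ≥0∞) (s y : ℝ) :
    ℝ≥0∞ :=
  ENNReal.ofReal (B (X.flow s y)) * (∫⁻ z in Ioo 0 1, φ (X.flow (t - s) (z * X.flow s y)) *
    X.decay lam (t - s) (z * X.flow s y) ∂p) * X.decay lam s y

theorem measurable_duhamelKernel (hB : Measurable B) (lam : ℝ) (p : Measure ℝ) [IsFiniteMeasure p]
    (t : ℝ) {φ : ℝ → ℝ≥0∞} (hφ : Measurable φ) :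
    Measurable (Function.uncurry (X.duhamelKernel lam p t φ)) := by
  have hflow : Measurable fun q : ℝ × ℝ => X.flow q.1 q.2 := X.continuous_flow.measurable
  have hd := X.measurable_decay lam
  have h1 : Measurable fun q : (ℝ × ℝ) × ℝ => (t - q.1.1, q.2 * X.flow q.1.1 q.1.2) :=
    (measurable_const.sub (measurable_fst.comp measurable_fst)).prodMk
      (measurable_snd.mul (hflow.comp measurable_fst))
  have h2 : Measurable fun q : (ℝ × ℝ) × ℝ => φ (X.flow (t - q.1.1) (q.2 * X.flow q.1.1 q.1.2)) *
      X.decay lam (t - q.1.1) (q.2 * X.flow q.1.1 q.1.2) :=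
    (hφ.comp (hflow.comp h1)).mul (hd.comp h1)
  exact ((hB.comp hflow).ennreal_ofReal.mul h2.lintegral_prod_right').mul hd

variable {lam : ℝ} {S : ℝ → L1 1 →L[ℝ] L1 1} {p : Measure ℝ} [IsFiniteMeasure p]

theorem enorm_le_of_semigroup (h : RegularCoefficients τ B τ₁ B₀ B₁ x₀ γ₀ γ₁)
    (hS : IsC0Semigroup S) (hgen : HasGenerator S (TransportOperator τ B lam))
    {w₁ w₂ : ℝ → ℝ≥0∞} (hw₁ : IsWeight w₁) (hw₂ : IsWeight w₂) {t : ℝ} (ht : 0 ≤ t) {C : ℝ}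
    (hC : ∀ y, 0 < y → w₂ (X.flow t y) * X.decay lam t y ≤ ENNReal.ofReal C * w₁ y)
    {f : Lp ℝ 1 (weightMeasure w₁)} {g : Lp ℝ 1 (weightMeasure w₂)} {f₁ : L1 1}
    (hf : f₁ =ᵐ[halfLine] f) (hg : g =ᵐ[halfLine] S t f₁) : ‖g‖ₑ ≤ ENNReal.ofReal C * ‖f‖ₑ := by
  rw [hw₁.enorm_eq, hw₂.enorm_eq, ← lintegral_const_mul' _ _ ENNReal.ofReal_ne_top]
  have h1 : ∫⁻ x, w₂ x * ‖g x‖ₑ ∂halfLine = ∫⁻ x, w₂ x * ‖S t f₁ x‖ₑ ∂halfLine := by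
    refine lintegral_congr_ae ?_
    filter_upwards [hg] with x hx
    rw [hx]
  rw [h1]
  refine (X.lintegral_enorm_semigroup_le h hS hgen f₁ ht hw₂.measurable).trans ?_
  refine lintegral_mono_ae ?_
  filter_upwards [ae_halfLine_pos, hf] with y hy hfy
  rw [hfy, ← mul_assoc]
  exact mul_le_mul_left (hC y hy) _

/-- The operators `S_{t-s} F₊ S_s` on `L¹_α`. -/
theorem exists_duhamel (h : RegularCoefficients τ B τ₁ B₀ B₁ x₀ γ₀ γ₁)
    (hS : IsC0Semigroup S) (hgen : HasGenerator S (TransportOperator τ B lam))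
    {α : ℝ} (hα : 1 ≤ α) (t : ℝ) :
    ∃ U : ℝ → Lp ℝ 1 (weightMeasure (powWeight α)) →L[ℝ] Lp ℝ 1 (weightMeasure (powWeight α)),
      (∀ s ∈ Ioo 0 t, ∀ f, DuhamelTerm (α := α) S B p t s f (U s f)) ∧
      (∀ f, ContinuousOn (fun s => U s f) (Ioo 0 t)) ∧
      ∀ s ∈ Ioo 0 t, ∀ f, ∀ φ : ℝ → ℝ≥0∞, Measurable φ →
        ∫⁻ x, φ x * ‖U s f x‖ₑ ∂halfLine ≤
          ∫⁻ y, X.duhamelKernel lam p t φ s y * ‖f y‖ₑ ∂halfLine := by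
  have hα0 : 0 ≤ α := zero_le_one.trans hα
  have hB := h.measurable_frag
  have hw := isWeight_powWeight α
  have hwB := isWeight_fragWeight hB α
  have hle : ∀ x, 0 < x → powWeight 1 x ≤ powWeight α x := fun x hx => powWeight_le_powWeight hα hx
  have hbdR : ∀ r ∈ Ioo 0 t, ∀ y, 0 < y → powWeight α (X.flow r y) * X.decay lam r y ≤
      ENNReal.ofReal (Real.exp (τ₁ * t * α) * Real.exp (|lam| * t)) * powWeight α y := by
    intro r hr y hy
    rw [ENNReal.ofReal_mul (Real.exp_pos _).le, mul_right_comm]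
    exact mul_le_mul' (X.powWeight_flow_le h hα0 hr.1.le hr.2.le hy)
      (X.decay_le_const h hr.1.le hr.2.le hy)
  have hbdB : ∀ δ, 0 < δ → ∃ C : ℝ, ∀ s ∈ Icc δ t, ∀ y, 0 < y →
      fragWeight B α (X.flow s y) * X.decay lam s y ≤ ENNReal.ofReal C * powWeight α y :=
    fun δ hδ => X.exists_fragWeight_flow_mul_decay_le h lam hα0 hδ
  have hR : ∀ r, ∃ T : Lp ℝ 1 (weightMeasure (powWeight α)) →L[ℝ]
      Lp ℝ 1 (weightMeasure (powWeight α)), r ∈ Ioo 0 t →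
        ∀ (f : Lp ℝ 1 (weightMeasure (powWeight α))) (f₁ : L1 1), f₁ =ᵐ[halfLine] f → T f =ᵐ[halfLine] S r f₁ := by
    intro r
    by_cases hr : r ∈ Ioo 0 t
    · obtain ⟨T, hT⟩ := X.exists_semigroup_clm h hS hgen hw hw hle hr.1.le (hbdR r hr)
      exact ⟨T, fun _ => hT⟩
    · exact ⟨0, fun hr' => absurd hr' hr⟩
  have hTB : ∀ s, ∃ T : Lp ℝ 1 (weightMeasure (powWeight α)) →L[ℝ]
      Lp ℝ 1 (weightMeasure (fragWeight B α)), s ∈ Ioo 0 t →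
        ∀ (f : Lp ℝ 1 (weightMeasure (powWeight α))) (f₁ : L1 1), f₁ =ᵐ[halfLine] f → T f =ᵐ[halfLine] S s f₁ := by
    intro s
    by_cases hs : s ∈ Ioo 0 t
    · obtain ⟨C, hC⟩ := hbdB s hs.1
      obtain ⟨T, hT⟩ := X.exists_semigroup_clm h hS hgen hw hwB hle hs.1.le
        (hC s ⟨le_rfl, hs.2.le⟩)
      exact ⟨T, fun _ => hT⟩
    · exact ⟨0, fun hs' => absurd hs' hs⟩
  choose R hR using hR
  choose Q hQ using hTB
  obtain ⟨F, hF⟩ := exists_fragPlus_clm (p := p) hB h.frag_nonneg hα0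
  obtain ⟨ι, hι⟩ := exists_inclusion hw hle
  obtain ⟨j, hj⟩ := exists_inclusion_of_le hwB hw fun x _ => powWeight_le_fragWeight α x
  have hmem : ∀ s ∈ Ioo 0 t, t - s ∈ Ioo 0 t := fun s hs => ⟨sub_pos.2 hs.2, by linarith [hs.1]⟩
  have hIoo : Ioo 0 t ⊆ Ici 0 := fun s hs => mem_Ici.2 hs.1.le
  have hBint : ∀ u, ∫⁻ x, powWeight α x * ‖B x * j u x‖ₑ ∂halfLine ≤
      ∫⁻ x, fragWeight B α x * ‖u x‖ₑ ∂halfLine := by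
    intro u
    refine lintegral_mono_ae ?_
    filter_upwards [hj u] with x hx
    rw [hx, enorm_mul, ← mul_assoc, Real.enorm_of_nonneg (h.frag_nonneg x),
      mul_comm (powWeight α x)]
    exact mul_le_mul_left (ofReal_mul_powWeight_le_fragWeight α x) _
  -- The product factors through L¹ with weight (1 + B)(1 + x)^α, on which `F₊` is bounded.
  refine ⟨fun s => (R (t - s)).comp (F.comp (Q s)), ?_, ?_, ?_⟩
  · intro s hs (f : Lp ℝ 1 (weightMeasure (powWeight α)))
    refine ⟨j (Q s f), F (Q s f), ⟨ι f, hι f, ?_⟩, ⟨?_, ?_⟩, ⟨ι (F (Q s f)), hι _, ?_⟩⟩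
    · exact ((hj _).trans (hQ s hs f _ (hι f))).symm
    · refine ⟨hw.aestronglyMeasurable_iff.2
        (hB.mul (Lp.stronglyMeasurable _).measurable).aestronglyMeasurable, ?_⟩
      exact lt_of_eq_of_lt (hw.lintegral_eq _) ((hBint _).trans_lt (hwB.lintegral_lt_top (Q s f)))
    · exact (hF _).trans (fragPlus_congr hB (Lp.stronglyMeasurable _).measurable
        (Lp.stronglyMeasurable _).measurable (hj _).symm)
    · exact (hR (t - s) (hmem s hs) _ _ (hι _)).symm
  · intro f
    have hQc : ContinuousOn (fun s => F (Q s f)) (Ioo 0 t) := by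
      refine F.continuous.comp_continuousOn ?_
      refine X.continuousOn_semigroup h hS hgen hw hwB hle hIoo hQ (fun s₀ hs₀ => ?_)
        (fun K => ?_) f
      · obtain ⟨C, hC⟩ := hbdB (s₀ / 2) (half_pos hs₀.1)
        refine ⟨C, ?_⟩
        filter_upwards [self_mem_nhdsWithin,
          mem_nhdsWithin_of_mem_nhds (lt_mem_nhds (half_lt_self hs₀.1))] with s hs hs'
        exact hC s ⟨le_of_lt hs', hs.2.le⟩
      · refine ⟨(1 + B₁ * (1 + K) ^ γ₁) * (1 + K) ^ α, fun x hx => ?_⟩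
        have hK : 0 < K := hx.1.trans_le hx.2
        have := h.pos_B₁
        rw [fragWeight, powWeight, ENNReal.ofReal_mul (by positivity),
          ENNReal.ofReal_add zero_le_one (by positivity), ENNReal.ofReal_one]
        gcongr
        · exact h.frag_le_of_le hK.le hx.2
        · linarith [hx.1]
        · exact hx.2
    have hRc : ∀ v, ContinuousOn (fun s => R (t - s) v) (Ioo 0 t) := by
      intro v
      have := X.continuousOn_semigroup h hS hgen hw hw hle hIoo hR
        (fun s₀ hs₀ => ⟨_, by filter_upwards [self_mem_nhdsWithin] with s hs using hbdR s hs⟩)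
        (fun K => ⟨(1 + K) ^ α, fun x hx => ENNReal.ofReal_le_ofReal
          (Real.rpow_le_rpow (by linarith [hx.1]) (by linarith [hx.2]) hα0)⟩) v
      exact this.comp (by fun_prop : Continuous fun s => t - s).continuousOn hmem
    set C := Real.exp (τ₁ * t * α) * Real.exp (|lam| * t)
    have hRn : ∀ r ∈ Ioo 0 t, ∀ v, ‖R r v‖ₑ ≤ ENNReal.ofReal C * ‖v‖ₑ := fun r hr v =>
      X.enorm_le_of_semigroup h hS hgen hw hw hr.1.le (hbdR r hr) (hι v) (hR r hr v _ (hι v))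
    intro s₀ hs₀
    have h1 : Tendsto (fun s => ENNReal.ofReal C * ‖F (Q s f) - F (Q s₀ f)‖ₑ)
        (𝓝[Ioo 0 t] s₀) (𝓝 0) := by
      have h2 := (hQc s₀ hs₀).tendsto
      rw [tendsto_iff_edist_tendsto_0] at h2
      simp only [edist_eq_enorm_sub] at h2
      simpa using ENNReal.Tendsto.const_mul (a := ENNReal.ofReal C) h2
        (Or.inr ENNReal.ofReal_ne_top)
    have h3 := (hRc (F (Q s₀ f)) s₀ hs₀).tendsto
    rw [tendsto_iff_edist_tendsto_0] at h3
    rw [ContinuousWithinAt, tendsto_iff_edist_tendsto_0]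
    have h4 := h1.add h3
    rw [add_zero] at h4
    -- Both factors vary with s: the bound on R, uniform in time, handles the moving argument, and
    -- strong continuity handles R at a fixed argument.
    refine tendsto_of_tendsto_of_tendsto_of_le_of_le' tendsto_const_nhds h4
      (Eventually.of_forall fun _ => zero_le) ?_
    filter_upwards [self_mem_nhdsWithin] with s hs
    refine (edist_triangle _ (R (t - s) (F (Q s₀ f))) _).trans (add_le_add ?_ le_rfl)
    rw [edist_eq_enorm_sub]
    simp only [ContinuousLinearMap.comp_apply]
    rw [← map_sub]
    exact hRn _ (hmem s hs) _
  · intro s hs f φ hφ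
    set u := Q s f with hu
    have hum : Measurable u := (Lp.stronglyMeasurable u).measurable
    -- The test function is pulled back through the three operators in turn, from the last to the
    -- first; the result is the Duhamel kernel.
    set φ₁ : ℝ → ℝ≥0∞ := fun x => φ (X.flow (t - s) x) * X.decay lam (t - s) x with hφ₁
    have hφ₁m : Measurable φ₁ := (hφ.comp (X.measurable_flow _)).mul
      ((X.measurable_decay lam).comp (measurable_const.prodMk measurable_id))
    set φ₂ : ℝ → ℝ≥0∞ := fun y => ENNReal.ofReal (B y) * ∫⁻ z in Ioo 0 1, φ₁ (z * y) ∂p with hφ₂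
    have hφ₂m : Measurable φ₂ := hB.ennreal_ofReal.mul
      (hφ₁m.comp (measurable_snd.mul measurable_fst)).lintegral_prod_right'
    calc ∫⁻ x, φ x * ‖R (t - s) (F u) x‖ₑ ∂halfLine
        = ∫⁻ x, φ x * ‖S (t - s) (ι (F u)) x‖ₑ ∂halfLine := by
          refine lintegral_congr_ae ?_
          filter_upwards [hR (t - s) (hmem s hs) (F u) _ (hι _)] with x hx
          rw [hx]
      _ ≤ ∫⁻ x, φ₁ x * ‖ι (F u) x‖ₑ ∂halfLine :=
          X.lintegral_enorm_semigroup_le h hS hgen _ (sub_nonneg.2 hs.2.le) hφ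
      _ = ∫⁻ x, φ₁ x * ‖fragPlus B p u x‖ₑ ∂halfLine := by
          refine lintegral_congr_ae ?_
          filter_upwards [hι (F u), hF u] with x hx hx'
          rw [hx, hx']
      _ ≤ ∫⁻ y, φ₂ y * ‖u y‖ₑ ∂halfLine := by
          refine (lintegral_enorm_fragPlus_le hB h.frag_nonneg hum hφ₁m).trans_eq
            (lintegral_congr fun y => ?_)
          rw [hφ₂]
          ring
      _ = ∫⁻ y, φ₂ y * ‖S s (ι f) y‖ₑ ∂halfLine := by
          refine lintegral_congr_ae ?_
          filter_upwards [hQ s hs f _ (hι f)] with y hy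
          rw [hu, hy]
      _ ≤ ∫⁻ y, X.duhamelKernel lam p t φ s y * ‖ι f y‖ₑ ∂halfLine :=
          X.lintegral_enorm_semigroup_le h hS hgen _ hs.1.le hφ₂m
      _ = ∫⁻ y, X.duhamelKernel lam p t φ s y * ‖f y‖ₑ ∂halfLine := by
          refine lintegral_congr_ae ?_
          filter_upwards [hι f] with y hy
          rw [hy]

end Characteristics

/-! ### Dispersion of the final position -/

/-- Preimages under a map that expands distances by at least `κ` have controlled measure. -/
theorem volume_inter_preimage_le {f : ℝ → ℝ} {J : Set ℝ} {κ : ℝ} (hκ : 0 < κ)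
    (hf : ∀ x ∈ J, ∀ y ∈ J, κ * |x - y| ≤ |f x - f y|) (A : Set ℝ) :
    volume (J ∩ f ⁻¹' A) ≤ ENNReal.ofReal κ⁻¹ * volume A := by
  have hinj : InjOn f J := by
    intro x hx y hy hxy
    have := hf x hx y hy
    rw [hxy, sub_self, abs_zero] at this
    have h0 : |x - y| ≤ 0 := nonpos_of_mul_nonpos_right this hκ
    exact sub_eq_zero.1 (abs_nonpos_iff.1 h0)
  -- The inverse is Lipschitz with constant 1/κ, and one-dimensional Hausdorff measure is Lebesgue
  -- measure. No measurability is required.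
  set g := Function.invFunOn f J with hg
  have hgf : ∀ x ∈ J, g (f x) = x := fun x hx => hinj.leftInvOn_invFunOn hx
  have hlip : LipschitzOnWith (Real.toNNReal κ⁻¹) g (f '' J) := by
    refine LipschitzOnWith.of_dist_le_mul ?_
    rintro _ ⟨x, hx, rfl⟩ _ ⟨y, hy, rfl⟩
    rw [hgf x hx, hgf y hy, Real.dist_eq, Real.dist_eq, Real.coe_toNNReal _ (inv_pos.2 hκ).le,
      inv_mul_eq_div, le_div_iff₀' hκ]
    exact hf x hx y hy
  have hsub : J ∩ f ⁻¹' A ⊆ g '' (A ∩ f '' J) := fun x hx =>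
    ⟨f x, ⟨hx.2, x, hx.1, rfl⟩, hgf x hx.1⟩
  have h1 := (hlip.mono (inter_subset_right (s := A))).hausdorffMeasure_image_le zero_le_one
  rw [hausdorffMeasure_real, ENNReal.rpow_one] at h1
  calc volume (J ∩ f ⁻¹' A) ≤ volume (g '' (A ∩ f '' J)) := measure_mono hsub
    _ ≤ ENNReal.ofReal κ⁻¹ * volume (A ∩ f '' J) := h1
    _ ≤ _ := by gcongr; exact inter_subset_left

/-- The uniform form of absolute continuity of a finite measure. -/
theorem exists_pos_forall_measure_le {p : Measure ℝ} [IsFiniteMeasure p] (hp : p ≪ volume)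
    {ε : ℝ≥0∞} (hε : ε ≠ 0) : ∃ δ : ℝ, 0 < δ ∧ ∀ s : Set ℝ, volume s ≤ ENNReal.ofReal δ →
      p s ≤ ε := by
  have hfin : ∫⁻ x, p.rnDeriv volume x ∂volume ≠ ∞ := (Measure.lintegral_rnDeriv_lt_top p _).ne
  obtain ⟨δ, hδ, h⟩ := exists_pos_setLIntegral_lt_of_measure_lt hfin hε
  obtain ⟨η, hη0, hη⟩ := ENNReal.lt_iff_exists_nnreal_btwn.1 hδ
  refine ⟨η, by exact_mod_cast hη0, fun s hs => ?_⟩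
  rw [ENNReal.ofReal_coe_nnreal] at hs
  have h1 := h (toMeasurable volume s) ((measure_toMeasurable s).trans_lt (hs.trans_lt hη))
  calc p s ≤ p (toMeasurable volume s) := measure_mono (subset_toMeasurable _ _)
    _ = ∫⁻ x in toMeasurable volume s, p.rnDeriv volume x := by
        rw [Measure.setLIntegral_rnDeriv hp]
    _ ≤ ε := h1.le

namespace Characteristics

variable {τ B : ℝ → ℝ} {τ₁ B₀ B₁ x₀ γ₀ γ₁ : ℝ} (X : Characteristics τ B)

/-- The position at time `t` of a fragment, averaged over the splitting time and the size of the
fragment, has a uniformly absolutely continuous law as long as the initial size is bounded. -/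
def IsDispersing (p : Measure ℝ) (t : ℝ) : Prop :=
  ∀ Y : ℝ, 0 < Y → ∀ ε : ℝ≥0∞, ε ≠ 0 → ∃ δ : ℝ, 0 < δ ∧ ∀ A : Set ℝ, MeasurableSet A →
    volume A ≤ ENNReal.ofReal δ → ∀ y ∈ Ioc 0 Y,
      ∫⁻ s in Ioo 0 t, p (Ioo 0 1 ∩ {z | X.flow (t - s) (z * X.flow s y) ∈ A}) ≤ ε

theorem exists_time_sub_eq {x y : ℝ} (hx : 0 ≤ x) (hxy : x < y) :
    ∃ ξ ∈ Ioo x y, X.time y - X.time x = (y - x) / τ ξ := by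
  obtain ⟨ξ, hξ, h⟩ := exists_hasDerivAt_eq_slope X.time (fun x => 1 / τ x) hxy
    X.time.continuous.continuousOn fun z hz => X.hasDerivAt_time z (hx.trans_lt hz.1)
  refine ⟨ξ, hξ, ?_⟩
  have : y - x ≠ 0 := (sub_pos.2 hxy).ne'
  rw [eq_div_iff this] at h
  rw [← h]
  ring

theorem flow_eq_of_growth_const {c : ℝ} (hc : 0 < c) (hτ : ∀ x, 0 < x → τ x = c) {s y : ℝ}
    (hs : 0 ≤ s) (hy : 0 < y) : X.flow s y = y + c * s := by
  have htime : ∀ x, 0 < x → X.time x = x / c := by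
    intro x hx
    obtain ⟨ξ, hξ, h⟩ := X.exists_time_sub_eq le_rfl hx
    rw [X.time_zero, sub_zero, sub_zero, hτ ξ hξ.1] at h
    exact h
  have hpos : 0 < y + c * s := by positivity
  refine X.time.injective ?_
  rw [X.time_flow, htime y hy, htime _ hpos]
  field_simp

variable {p : Measure ℝ} [IsFiniteMeasure p]

/-- For fixed z the position is affine in the splitting time with slope -c(1 - z), of modulus at
least cε. Hence the times that lead into A have measure at most |A|/(cε), whatever the law of z. -/
theorem isDispersing_of_growth_const {c ε : ℝ} (hc : 0 < c) (hτ : ∀ x, 0 < x → τ x = c)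
    (hε : 0 < ε) (hp : ∀ᵐ z ∂p, z ≤ 1 - ε) (t : ℝ) : X.IsDispersing p t := by
  intro Y hY η hη
  have hcε : 0 < c * ε := mul_pos hc hε
  set K : ℝ≥0∞ := ENNReal.ofReal (c * ε)⁻¹ * p univ with hK
  have hKtop : K ≠ ∞ := by finiteness
  obtain ⟨δ, hδ0, hδ⟩ : ∃ δ : ℝ, 0 < δ ∧ K * ENNReal.ofReal δ ≤ η := by
    have h1 : Tendsto (fun δ : ℝ => K * ENNReal.ofReal δ) (𝓝[>] 0) (𝓝 0) := by
      have := ENNReal.Tendsto.const_mul (a := K)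
        ((ENNReal.continuous_ofReal.tendsto 0).mono_left (nhdsWithin_le_nhds (s := Ioi (0 : ℝ))))
        (Or.inr hKtop)
      simpa using this
    obtain ⟨δ, h2, h3⟩ := ((h1.eventually_le_const (pos_iff_ne_zero.2 hη)).and
      self_mem_nhdsWithin).exists
    exact ⟨δ, h3, h2⟩
  refine ⟨δ, hδ0, fun A hA hAδ y hy => ?_⟩
  have hpos : ∀ s ∈ Ioo 0 t, ∀ z ∈ Ioo (0 : ℝ) 1, X.flow (t - s) (z * X.flow s y) =
      z * (y + c * s) + c * (t - s) := by
    intro s hs z hz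
    rw [X.flow_eq_of_growth_const hc hτ (sub_nonneg.2 hs.2.le)
      (mul_pos hz.1 (X.flow_pos hs.1.le hy.1)), X.flow_eq_of_growth_const hc hτ hs.1.le hy.1]
  set G : ℝ → ℝ → ℝ := fun s z => z * (y + c * s) + c * (t - s) with hG
  have hGm : Measurable (Function.uncurry G) := by
    have : Continuous (Function.uncurry G) := by
      simp only [hG, Function.uncurry_def]
      fun_prop
    exact this.measurable
  have hAm : MeasurableSet {q : ℝ × ℝ | G q.1 q.2 ∈ A} := hGm hA
  calc ∫⁻ s in Ioo 0 t, p (Ioo 0 1 ∩ {z | X.flow (t - s) (z * X.flow s y) ∈ A})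
      ≤ ∫⁻ s in Ioo 0 t, p {z | G s z ∈ A} := by
        refine setLIntegral_mono' measurableSet_Ioo fun s hs => measure_mono ?_
        rintro z ⟨hz, hzA⟩
        rw [mem_ofPred_eq, hpos s hs z hz] at hzA
        exact hzA
    -- Tonelli: the slices in s, rather than those in z, are the ones under control.
    _ = ∫⁻ z, volume (Ioo 0 t ∩ {s | G s z ∈ A}) ∂p := by
        have h1 := Measure.prod_apply (μ := volume.restrict (Ioo 0 t)) (ν := p) hAm
        have h2 := Measure.prod_apply_symm (μ := volume.restrict (Ioo 0 t)) (ν := p) hAm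
        refine h1.symm.trans (h2.trans (lintegral_congr fun z => ?_))
        have hz : MeasurableSet ((fun s => (s, z)) ⁻¹' {q : ℝ × ℝ | G q.1 q.2 ∈ A}) :=
          measurable_prodMk_right hAm
        rw [Measure.restrict_apply hz, inter_comm]
        rfl
    _ ≤ ∫⁻ _, ENNReal.ofReal (c * ε)⁻¹ * volume A ∂p := by
        refine lintegral_mono_ae ?_
        filter_upwards [hp] with z hz
        refine volume_inter_preimage_le hcε (f := fun s => G s z) (fun s _ s' _ => ?_) A
        have : G s z - G s' z = -(c * (1 - z) * (s - s')) := by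
          simp only [hG]
          ring
        rw [this, abs_neg, abs_mul, abs_of_nonneg (mul_nonneg hc.le (by linarith))]
        exact mul_le_mul_of_nonneg_right (mul_le_mul_of_nonneg_left (by linarith) hc.le)
          (abs_nonneg _)
    _ = K * volume A := by rw [lintegral_const, hK]; ring
    _ ≤ η := le_trans (by gcongr) hδ

/-- For fixed s the position is expanding in z, so a small A has a Lebesgue-small, hence p-small,
preimage. The expansion factor could degenerate when the parent or the final fragment is close to 0;
discarding splitting times within θ of 0 and of t excludes this. -/
theorem isDispersing_of_absolutelyContinuous (h : RegularCoefficients τ B τ₁ B₀ B₁ x₀ γ₀ γ₁)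
    (hp : p ≪ volume) {t : ℝ} (ht : 0 < t) : X.IsDispersing p t := by
  intro Y hY η hη
  obtain ⟨θ, hθ0, hθt, hθ⟩ : ∃ θ : ℝ, 0 < θ ∧ θ < t / 2 ∧ p univ * ENNReal.ofReal θ ≤ η / 3 := by
    have h1 : Tendsto (fun δ : ℝ => p univ * ENNReal.ofReal δ) (𝓝[>] 0) (𝓝 0) := by
      have := ENNReal.Tendsto.const_mul (a := p univ)
        ((ENNReal.continuous_ofReal.tendsto 0).mono_left (nhdsWithin_le_nhds (s := Ioi (0 : ℝ))))
        (Or.inr (measure_ne_top p _))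
      simpa using this
    obtain ⟨δ, ⟨h2, h3⟩, h4⟩ := (((h1.eventually_le_const
      (ENNReal.div_pos hη (by simp : (3 : ℝ≥0∞) ≠ ∞))).and self_mem_nhdsWithin).and
      (mem_nhdsWithin_of_mem_nhds (Iio_mem_nhds (half_pos ht)))).exists
    exact ⟨δ, h3, h4, h2⟩
  obtain ⟨δ₁, hδ₁, hδp⟩ := exists_pos_forall_measure_le hp (ε := η / 3 / ENNReal.ofReal t)
    (ENNReal.div_pos (ENNReal.div_pos hη (by simp)).ne' ENNReal.ofReal_ne_top).ne'
  -- Even from size 0 a particle exceeds ρ > 0 after time θ. This bounds below both the parent at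
  -- time s and the fragment at time t.
  set ρ := X.flow θ 0 with hρ
  have hρ0 : 0 < ρ := by
    rw [← X.time_pos, X.time_flow, X.time_zero, zero_add]
    exact hθ0
  set R := X.flow t Y with hR
  have hR0 : 0 < R := X.flow_pos ht.le hY
  obtain ⟨c, hc0, hc⟩ : ∃ c, 0 < c ∧ ∀ x ∈ Icc ρ (X.flow t R), c ≤ τ x := by
    have hne : (Icc ρ (X.flow t R)).Nonempty := ⟨_, ⟨X.flow_le_flow (by linarith) hR0.le, le_rfl⟩⟩
    obtain ⟨x, hx, hmin⟩ := isCompact_Icc.exists_isMinOn hne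
      (h.growth_continuousOn.mono fun x (hx : x ∈ Icc ρ (X.flow t R)) => hρ0.trans_le hx.1)
    exact ⟨τ x, h.growth_pos x, fun y hy => hmin hy⟩
  set M := τ₁ * (1 + R) with hM
  have hM0 : 0 < M := mul_pos h.pos_τ₁ (by linarith)
  -- Two fragments keep their difference in travel time. It is at least (z - z')ρ/M at the split,
  -- since τ ≤ M there, and at most (F - F')/c at time t, since τ ≥ c there.
  set κ := c * ρ / M with hκ
  have hκ0 : 0 < κ := by positivity
  refine ⟨κ * δ₁, by positivity, fun A hA hAδ y hy => ?_⟩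
  have hmid : ∀ s ∈ Icc θ (t - θ),
      p (Ioo 0 1 ∩ {z | X.flow (t - s) (z * X.flow s y) ∈ A}) ≤ η / 3 / ENNReal.ofReal t := by
    intro s hs
    refine hδp _ ?_
    have hexp : ∀ z ∈ Ioo (0 : ℝ) 1, ∀ z' ∈ Ioo (0 : ℝ) 1, z' < z →
        κ * (z - z') ≤ X.flow (t - s) (z * X.flow s y) - X.flow (t - s) (z' * X.flow s y) := by
      intro z hz z' hz' hzz
      set b := X.flow s y with hb
      have hbρ : ρ ≤ b := X.flow_le_flow hs.1 hy.1.le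
      have hb0 : 0 < b := hρ0.trans_le hbρ
      have hbR : b ≤ R := X.flow_le_flow (by linarith [hs.2]) hy.2
      have hlt : z' * b < z * b := mul_lt_mul_of_pos_right hzz hb0
      have hzb : z * b ≤ R := (mul_le_of_le_one_left hb0.le hz.2.le).trans hbR
      have hz'b : 0 < z' * b := mul_pos hz'.1 hb0
      obtain ⟨ξ, hξ, hξe⟩ := X.exists_time_sub_eq hz'b.le hlt
      set F := X.flow (t - s) (z * b) with hF
      set F' := X.flow (t - s) (z' * b) with hF'
      have hFF : F' < F := X.time.symm.strictMono (add_lt_add_left (X.time.strictMono hlt) _)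
      have hF'ρ : ρ ≤ F' := X.flow_le_flow (by linarith [hs.2]) hz'b.le
      have hFR : F ≤ X.flow t R := X.flow_le_flow (by linarith [hs.1]) hzb
      obtain ⟨ζ, hζ, hζe⟩ := X.exists_time_sub_eq (hρ0.trans_le hF'ρ).le hFF
      have heq : X.time F - X.time F' = X.time (z * b) - X.time (z' * b) := by
        rw [hF, hF', X.time_flow, X.time_flow]
        ring
      have h1 : (z * b - z' * b) / M ≤ (z * b - z' * b) / τ ξ := by
        refine div_le_div_of_nonneg_left (sub_nonneg.2 hlt.le) (h.growth_pos ξ) ?_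
        refine (h.growth_le ξ (hz'b.trans hξ.1)).trans ?_
        rw [hM]
        exact mul_le_mul_of_nonneg_left (by linarith [hξ.2]) h.pos_τ₁.le
      have h2 : (F - F') / τ ζ ≤ (F - F') / c :=
        div_le_div_of_nonneg_left (sub_nonneg.2 hFF.le) hc0
          (hc ζ ⟨hF'ρ.trans hζ.1.le, hζ.2.le.trans hFR⟩)
      have h3 : (z * b - z' * b) / M ≤ (F - F') / c := by
        refine h1.trans (le_trans (le_of_eq ?_) h2)
        rw [← hξe, ← hζe, heq]
      rw [le_div_iff₀ hc0] at h3
      refine le_trans ?_ h3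
      have h4 : κ * (z - z') = (z - z') * ρ / M * c := by rw [hκ]; ring
      rw [h4, ← sub_mul]
      gcongr
    refine (volume_inter_preimage_le hκ0 (f := fun z => X.flow (t - s) (z * X.flow s y))
      (fun z hz z' hz' => ?_) A).trans ?_
    · rcases lt_trichotomy z z' with hlt | rfl | hlt
      · rw [abs_sub_comm z z', abs_of_pos (sub_pos.2 hlt), abs_sub_comm]
        exact (hexp z' hz' z hz hlt).trans (le_abs_self _)
      · simp
      · rw [abs_of_pos (sub_pos.2 hlt)]
        exact (hexp z hz z' hz' hlt).trans (le_abs_self _)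
    · calc ENNReal.ofReal κ⁻¹ * volume A ≤ ENNReal.ofReal κ⁻¹ * ENNReal.ofReal (κ * δ₁) := by gcongr
        _ = ENNReal.ofReal δ₁ := by
          rw [← ENNReal.ofReal_mul (inv_pos.2 hκ0).le, inv_mul_cancel_left₀ hκ0.ne']
  set g : ℝ → ℝ≥0∞ := fun s => p (Ioo 0 1 ∩ {z | X.flow (t - s) (z * X.flow s y) ∈ A}) with hg
  have hgP : ∀ s, g s ≤ p univ := fun s => measure_mono (subset_univ _)
  have hcover : Ioo 0 t ⊆ (Ioo 0 θ ∪ Icc θ (t - θ)) ∪ Ioo (t - θ) t := by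
    intro s hs
    rcases lt_or_ge s θ with h1 | h1
    · exact Or.inl (Or.inl ⟨hs.1, h1⟩)
    · rcases le_or_gt s (t - θ) with h2 | h2
      · exact Or.inl (Or.inr ⟨h1, h2⟩)
      · exact Or.inr ⟨h2, hs.2⟩
  calc ∫⁻ s in Ioo 0 t, g s ≤ ∫⁻ s in (Ioo 0 θ ∪ Icc θ (t - θ)) ∪ Ioo (t - θ) t, g s :=
        lintegral_mono_set hcover
    _ ≤ (∫⁻ s in Ioo 0 θ, g s) + (∫⁻ s in Icc θ (t - θ), g s) + ∫⁻ s in Ioo (t - θ) t, g s :=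
        (lintegral_union_le _ _ _).trans (add_le_add (lintegral_union_le _ _ _) le_rfl)
    _ ≤ η / 3 + η / 3 + η / 3 := by
        refine add_le_add (add_le_add ?_ ?_) ?_
        · refine (lintegral_mono hgP).trans ?_
          rw [setLIntegral_const, Real.volume_Ioo, sub_zero]
          exact hθ
        · refine (setLIntegral_mono measurable_const hmid).trans ?_
          rw [setLIntegral_const, Real.volume_Icc]
          calc η / 3 / ENNReal.ofReal t * ENNReal.ofReal (t - θ - θ)
              ≤ η / 3 / ENNReal.ofReal t * ENNReal.ofReal t := by gcongr; linarith
            _ = η / 3 := ENNReal.div_mul_cancel (ENNReal.ofReal_pos.2 ht).ne' ENNReal.ofReal_ne_top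
        · refine (lintegral_mono hgP).trans ?_
          rw [setLIntegral_const, Real.volume_Ioo, sub_sub_cancel]
          exact hθ
    _ = η := ENNReal.add_thirds η

end Characteristics

/-! ### Estimates of the Duhamel kernel -/

namespace Characteristics

variable {τ B : ℝ → ℝ} {τ₁ B₀ B₁ x₀ γ₀ γ₁ : ℝ} (X : Characteristics τ B)
variable (p : Measure ℝ)

theorem duhamelKernel_mono (lam t : ℝ) {φ ψ : ℝ → ℝ≥0∞} {s y : ℝ}
    (hφ : ∀ z ∈ Ioo (0 : ℝ) 1, φ (X.flow (t - s) (z * X.flow s y)) ≤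
      ψ (X.flow (t - s) (z * X.flow s y))) :
    X.duhamelKernel lam p t φ s y ≤ X.duhamelKernel lam p t ψ s y := by
  exact mul_le_mul' (mul_le_mul' le_rfl (setLIntegral_mono' measurableSet_Ioo
    fun z hz => mul_le_mul' (hφ z hz) le_rfl)) le_rfl

theorem flow_mul_flow_le {t s y z : ℝ}
    (hs : s ∈ Ioo 0 t) (hy : 0 < y) (hz : z ∈ Ioo (0 : ℝ) 1) :
    X.flow (t - s) (z * X.flow s y) ≤ X.flow t y := by
  have hb : 0 < X.flow s y := X.flow_pos hs.1.le hy
  calc X.flow (t - s) (z * X.flow s y) ≤ X.flow (t - s) (X.flow s y) :=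
        X.flow_le_flow le_rfl (mul_le_of_le_one_left hb.le hz.2.le)
    _ = X.flow t y := by rw [X.flow_flow, add_sub_cancel]

/-- A fragment never overtakes the unsplit particle, which grows at most exponentially, so the final
weight is at most a constant times the initial one. What remains is the density of the splitting
time and the survival of the fragment. -/
theorem exists_duhamelKernel_le (h : RegularCoefficients τ B τ₁ B₀ B₁ x₀ γ₀ γ₁) (lam t : ℝ)
    {α : ℝ} (hα : 0 ≤ α) : ∃ C : ℝ, ∀ A : Set ℝ, ∀ s ∈ Ioo 0 t, ∀ y, 0 < y →
      X.duhamelKernel lam p t (A.indicator (powWeight α)) s y ≤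
        ENNReal.ofReal C * powWeight α y * ENNReal.ofReal (B (X.flow s y) * X.survival s y) *
          ∫⁻ z in Ioo 0 1, {z | X.flow (t - s) (z * X.flow s y) ∈ A}.indicator 1 z *
            ENNReal.ofReal (X.survival (t - s) (z * X.flow s y)) ∂p := by
  refine ⟨Real.exp (τ₁ * t * α) * Real.exp (|lam| * t) * Real.exp (|lam| * t),
    fun A s hs y hy => ?_⟩
  set a := ENNReal.ofReal (Real.exp (τ₁ * t * α)) with ha
  set b := ENNReal.ofReal (Real.exp (|lam| * t)) with hb
  have ht : 0 ≤ t := hs.1.le.trans hs.2.le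
  have hfs : 0 < X.flow s y := X.flow_pos hs.1.le hy
  have hI : ∫⁻ z in Ioo 0 1, A.indicator (powWeight α) (X.flow (t - s) (z * X.flow s y)) *
      X.decay lam (t - s) (z * X.flow s y) ∂p ≤
      a * powWeight α y * b * ∫⁻ z in Ioo 0 1,
        {z | X.flow (t - s) (z * X.flow s y) ∈ A}.indicator 1 z *
          ENNReal.ofReal (X.survival (t - s) (z * X.flow s y)) ∂p := by
    have hne : a * powWeight α y * b ≠ ∞ := ENNReal.mul_ne_top (ENNReal.mul_ne_top
      ENNReal.ofReal_ne_top ENNReal.ofReal_ne_top) ENNReal.ofReal_ne_top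
    rw [← lintegral_const_mul' _ _ hne]
    refine setLIntegral_mono' measurableSet_Ioo fun z hz => ?_
    by_cases hzA : X.flow (t - s) (z * X.flow s y) ∈ A
    · have hzA' : z ∈ {z | X.flow (t - s) (z * X.flow s y) ∈ A} := hzA
      rw [indicator_of_mem hzA, indicator_of_mem hzA', Pi.one_apply, one_mul, mul_assoc]
      refine mul_le_mul' ?_ (X.decay_le (sub_nonneg.2 hs.2.le) (by linarith [hs.1]))
      refine le_trans ?_ (X.powWeight_flow_le h hα ht le_rfl hy)
      have h0 : 0 < X.flow (t - s) (z * X.flow s y) :=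
        X.flow_pos (sub_nonneg.2 hs.2.le) (mul_pos hz.1 hfs)
      exact ENNReal.ofReal_le_ofReal (Real.rpow_le_rpow (by linarith)
        (by linarith [X.flow_mul_flow_le hs hy hz]) hα)
    · rw [indicator_of_notMem hzA, zero_mul]
      exact zero_le
  rw [ENNReal.ofReal_mul (by positivity), ENNReal.ofReal_mul (by positivity), ← ha, ← hb,
    ENNReal.ofReal_mul (h.frag_nonneg _)]
  refine (mul_le_mul' (mul_le_mul' le_rfl hI) (X.decay_le hs.1.le hs.2.le)).trans_eq ?_
  ring

theorem lintegral_indicator_mul_survival_le (h : RegularCoefficients τ B τ₁ B₀ B₁ x₀ γ₀ γ₁)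
    {t s y : ℝ} (hs : s ∈ Ioo 0 t) (hy : 0 < y) (A : Set ℝ) :
    ∫⁻ z in Ioo 0 1, A.indicator 1 z *
      ENNReal.ofReal (X.survival (t - s) (z * X.flow s y)) ∂p ≤
      ∫⁻ z in Ioo 0 1, A.indicator 1 z ∂p := by
  refine setLIntegral_mono' measurableSet_Ioo fun z hz => mul_le_of_le_one_right zero_le ?_
  rw [ENNReal.ofReal_le_one]
  exact X.survival_le_one h.growth_pos h.frag_nonneg (mul_pos hz.1 (X.flow_pos hs.1.le hy))
    (sub_nonneg.2 hs.2.le)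

variable [IsFiniteMeasure p]

/-- No bound that is uniform in s is needed near s = 0: the splitting density integrates to at most
1 over all splitting times, for every y. -/
theorem exists_lintegral_duhamelKernel_le (h : RegularCoefficients τ B τ₁ B₀ B₁ x₀ γ₀ γ₁)
    (lam : ℝ) {t α : ℝ} (ht : 0 < t) (hα : 0 ≤ α) : ∃ C : ℝ≥0∞, C ≠ ∞ ∧ ∀ y, 0 < y →
      ∫⁻ s in Ioo 0 t, X.duhamelKernel lam p t (powWeight α) s y ≤ C * powWeight α y := by
  obtain ⟨C, hC⟩ := X.exists_duhamelKernel_le p h lam t hα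
  refine ⟨ENNReal.ofReal C * p univ, ENNReal.mul_ne_top ENNReal.ofReal_ne_top (measure_ne_top p _),
    fun y hy => ?_⟩
  calc ∫⁻ s in Ioo 0 t, X.duhamelKernel lam p t (powWeight α) s y
      ≤ ∫⁻ s in Ioo 0 t, ENNReal.ofReal C * powWeight α y * p univ *
          ENNReal.ofReal (B (X.flow s y) * X.survival s y) := by
        refine setLIntegral_mono' measurableSet_Ioo fun s hs => ?_
        have h1 := hC univ s hs y hy
        rw [indicator_univ] at h1
        refine h1.trans ?_
        rw [mul_right_comm (ENNReal.ofReal C * powWeight α y)]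
        refine mul_le_mul' (mul_le_mul' le_rfl
          ((X.lintegral_indicator_mul_survival_le p h hs hy _).trans ?_)) le_rfl
        refine (lintegral_mono fun z => indicator_le_self _ _ z).trans ?_
        simp only [Pi.one_apply, lintegral_const, one_mul]
        exact Measure.restrict_apply_le _ _
    _ = ENNReal.ofReal C * powWeight α y * p univ *
          ∫⁻ s in Ioo 0 t, ENNReal.ofReal (B (X.flow s y) * X.survival s y) :=
        lintegral_const_mul' _ _ (ENNReal.mul_ne_top (ENNReal.mul_ne_top ENNReal.ofReal_ne_top
          ENNReal.ofReal_ne_top) (measure_ne_top p _))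
    _ ≤ ENNReal.ofReal C * powWeight α y * p univ * 1 := by
        refine mul_le_mul' le_rfl ((X.lintegral_frag_mul_survival_le h.growth_pos h.frag_nonneg hy
          le_rfl ht.le).trans ?_)
        rw [ENNReal.ofReal_le_one]
        exact X.survival_le_one h.growth_pos h.frag_nonneg hy le_rfl
    _ = _ := by ring

/-- Large particles contribute little, since they split again before time `t`. -/
theorem exists_lintegral_duhamelKernel_tail_le
    (h : RegularCoefficients τ B τ₁ B₀ B₁ x₀ γ₀ γ₁)
    (lam : ℝ) {t α : ℝ} (ht : 0 < t) (hα : 0 ≤ α) {ε : ℝ≥0∞} (hε : ε ≠ 0) :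
    ∃ Y : ℝ, 0 < Y ∧ ∀ y, Y ≤ y →
      ∫⁻ s in Ioo 0 t, X.duhamelKernel lam p t (powWeight α) s y ≤ ε * powWeight α y := by
  obtain ⟨C, hC⟩ := X.exists_duhamelKernel_le p h lam t hα
  have hCP : ENNReal.ofReal C * p univ ≠ ∞ :=
    ENNReal.mul_ne_top ENNReal.ofReal_ne_top (measure_ne_top p _)
  have hε2 : 0 < ε / 2 := ENNReal.half_pos hε
  -- The intervals (0, 1/(n+1)) decrease to the empty set, so the finite measure p gives little mass
  -- to tiny fragments.
  obtain ⟨δ, hδ0, hδ1, hδ⟩ : ∃ δ : ℝ, 0 < δ ∧ δ ≤ 1 ∧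
      ENNReal.ofReal C * p (Ioo 0 δ) ≤ ε / 2 := by
    have h1 : Tendsto (fun n : ℕ => p (Ioo 0 (1 / ((n : ℝ) + 1)))) atTop (𝓝 0) := by
      have h2 := tendsto_measure_iInter_atTop (μ := p)
        (s := fun n : ℕ => Ioo (0 : ℝ) (1 / ((n : ℝ) + 1)))
        (fun _ => measurableSet_Ioo.nullMeasurableSet)
        (fun m n hmn x hx => ⟨hx.1, hx.2.trans_le (one_div_le_one_div_of_le (by positivity)
          (by simpa using hmn))⟩) ⟨0, measure_ne_top p _⟩
      have h3 : ⋂ n : ℕ, Ioo (0 : ℝ) (1 / ((n : ℝ) + 1)) = ∅ := by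
        refine eq_empty_of_forall_notMem fun x hx => ?_
        have hx' := mem_iInter.1 hx
        obtain ⟨n, hn⟩ := exists_nat_one_div_lt (hx' 0).1
        exact lt_asymm hn (hx' n).2
      rwa [h3, measure_empty] at h2
    have h2 := ENNReal.Tendsto.const_mul (a := ENNReal.ofReal C) h1
      (Or.inr ENNReal.ofReal_ne_top)
    rw [mul_zero] at h2
    obtain ⟨n, hn⟩ := (h2.eventually_le_const hε2).exists
    exact ⟨1 / ((n : ℝ) + 1), by positivity, by
      rw [div_le_one (by positivity)]
      linarith [(n.cast_nonneg : (0 : ℝ) ≤ n)], hn⟩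
  set e : ℝ → ℝ≥0∞ := fun y => ENNReal.ofReal (Real.exp (-(t / 2 * (B₀ * (δ * y) ^ γ₀)))) with he
  have hlim : Tendsto (fun y => ENNReal.ofReal C * p univ * (2 * e y)) atTop (𝓝 0) := by
    have h1 : Tendsto (fun y : ℝ => t / 2 * (B₀ * (δ * y) ^ γ₀)) atTop atTop :=
      (((tendsto_rpow_atTop h.pos_γ₀).comp (tendsto_id.const_mul_atTop hδ0)).const_mul_atTop
        h.pos_B₀).const_mul_atTop (half_pos ht)
    have h2 : Tendsto e atTop (𝓝 0) := by
      have := ENNReal.tendsto_ofReal (Real.tendsto_exp_neg_atTop_nhds_zero.comp h1)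
      rwa [ENNReal.ofReal_zero] at this
    have h3 := ENNReal.Tendsto.const_mul (a := ENNReal.ofReal C * p univ)
      (ENNReal.Tendsto.const_mul (a := 2) h2 (Or.inr (by simp))) (Or.inr hCP)
    simpa only [mul_zero] using h3
  obtain ⟨Y, hY⟩ := ((hlim.eventually_le_const hε2).and (eventually_ge_atTop
    (x₀ / δ))).exists_forall_of_atTop
  have hx₀δ : 0 < x₀ / δ := div_pos h.pos_x₀ hδ0
  refine ⟨max Y (x₀ / δ), lt_max_of_lt_right hx₀δ, fun y hy => ?_⟩
  have hyY := hY y ((le_max_left _ _).trans hy)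
  have hyx : x₀ ≤ δ * y := by
    have := hyY.2
    rwa [div_le_iff₀' hδ0] at this
  have hy0 : 0 < y := hx₀δ.trans_le hyY.2
  -- One bound serves both roles: survival for at least t/2 from a size of at least δy, for the
  -- parent as for a fragment that is not tiny.
  have hsurv : ∀ r, t / 2 ≤ r → ∀ x, δ * y ≤ x → ENNReal.ofReal (X.survival r x) ≤ e y := by
    intro r hr x hx
    have hx0 : 0 < x := (h.pos_x₀.trans_le hyx).trans_le hx
    refine ENNReal.ofReal_le_ofReal ((X.survival_le_exp h.growth_pos hx0 (by linarith)
      (c := B₀ * (δ * y) ^ γ₀) fun x' hx' => ?_).trans ?_)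
    · refine le_trans ?_ (h.le_frag x' ((hyx.trans hx).trans hx'))
      have := h.pos_B₀
      have := h.pos_γ₀
      gcongr
      exact hx.trans hx'
    · refine Real.exp_le_exp.2 (neg_le_neg (mul_le_mul_of_nonneg_right hr ?_))
      have := h.pos_B₀
      positivity
  have hδy : δ * y ≤ y := mul_le_of_le_one_left hy0.le hδ1
  set q := fun s => ENNReal.ofReal (B (X.flow s y) * X.survival s y) with hq
  have hker : ∀ s ∈ Ioo 0 t, ∀ b, (∫⁻ z in Ioo 0 1,
        ENNReal.ofReal (X.survival (t - s) (z * X.flow s y)) ∂p) ≤ b →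
      X.duhamelKernel lam p t (powWeight α) s y ≤ ENNReal.ofReal C * powWeight α y * b * q s := by
    intro s hs b hb
    have h1 := hC univ s hs y hy0
    simp only [indicator_univ, mem_univ, ofPred_true, Pi.one_apply, one_mul] at h1
    refine h1.trans ?_
    rw [mul_right_comm (ENNReal.ofReal C * powWeight α y)]
    exact mul_le_mul' (mul_le_mul' le_rfl hb) le_rfl
  have hpart : ∀ (J : Set ℝ) (a b : ℝ) (c : ℝ≥0∞), MeasurableSet J → J ⊆ Ioo 0 t →
      J =ᵐ[volume] Ioo a b → 0 ≤ a → a ≤ b → c ≠ ∞ → (∀ s ∈ J, ∫⁻ z in Ioo 0 1,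
        ENNReal.ofReal (X.survival (t - s) (z * X.flow s y)) ∂p ≤ c) →
      ∫⁻ s in J, X.duhamelKernel lam p t (powWeight α) s y ≤
        ENNReal.ofReal C * powWeight α y * c * ENNReal.ofReal (X.survival a y) := by
    intro J a b c hJ hJt hJab ha hab hc hbd
    have hne : ENNReal.ofReal C * powWeight α y * c ≠ ∞ := ENNReal.mul_ne_top
      (ENNReal.mul_ne_top ENNReal.ofReal_ne_top ENNReal.ofReal_ne_top) hc
    refine (setLIntegral_mono' hJ fun s hs => hker s (hJt hs) c (hbd s hs)).trans ?_
    rw [lintegral_const_mul' _ _ hne, setLIntegral_congr hJab]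
    exact mul_le_mul' le_rfl (X.lintegral_frag_mul_survival_le h.growth_pos h.frag_nonneg hy0 ha hab)
  have ht2 : t / 2 < t := half_lt_self ht
  have hP : p (Ioo 0 1) ≤ p univ := measure_mono (subset_univ _)
  have hone : ∀ s ∈ Ioo 0 t, ∀ z ∈ Ioo (0 : ℝ) 1,
      ENNReal.ofReal (X.survival (t - s) (z * X.flow s y)) ≤ 1 := by
    intro s hs z hz
    rw [ENNReal.ofReal_le_one]
    exact X.survival_le_one h.growth_pos h.frag_nonneg (mul_pos hz.1 (X.flow_pos hs.1.le hy0))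
      (sub_nonneg.2 hs.2.le)
  -- Early split: the fragment has at least t/2 left to survive. Either z < δ, which has small
  -- p-mass, or its size is at least δy.
  have hearly := hpart (Ioo 0 (t / 2)) 0 (t / 2) (p (Ioo 0 δ) + p univ * e y) measurableSet_Ioo
    (Ioo_subset_Ioo_right ht2.le) (Filter.EventuallyEq.refl _ _) le_rfl (half_pos ht).le
    (ENNReal.add_ne_top.2 ⟨measure_ne_top p _, ENNReal.mul_ne_top (measure_ne_top p _)
      ENNReal.ofReal_ne_top⟩) (fun s hs => by
        calc ∫⁻ z in Ioo 0 1, ENNReal.ofReal (X.survival (t - s) (z * X.flow s y)) ∂p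
            ≤ ∫⁻ z in Ioo 0 1, ((Ioo 0 δ).indicator 1 z + e y) ∂p := by
              refine setLIntegral_mono' measurableSet_Ioo fun z hz => ?_
              rcases lt_or_ge z δ with hzδ | hzδ
              · rw [indicator_of_mem (show z ∈ Ioo 0 δ from ⟨hz.1, hzδ⟩), Pi.one_apply]
                exact (hone s (Ioo_subset_Ioo_right ht2.le hs) z hz).trans le_self_add
              · refine (hsurv _ (by linarith [hs.2]) _ ?_).trans le_add_self
                exact mul_le_mul hzδ (X.le_flow hs.1.le y) hy0.le hz.1.le
          _ = p (Ioo 0 δ ∩ Ioo 0 1) + e y * p (Ioo 0 1) := by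
              have hm : Measurable ((Ioo (0 : ℝ) δ).indicator (1 : ℝ → ℝ≥0∞)) :=
                measurable_one.indicator measurableSet_Ioo
              rw [lintegral_add_left hm, lintegral_indicator_one measurableSet_Ioo,
                Measure.restrict_apply measurableSet_Ioo, setLIntegral_const]
          _ ≤ _ := by
              rw [mul_comm (e y)]
              gcongr
              exact inter_subset_left)
  -- Late split: the parent has already survived until t/2, and no information about the fragment is
  -- needed.
  have hlate := hpart (Ico (t / 2) t) (t / 2) t (p univ) measurableSet_Ico
    (fun s hs => ⟨(half_pos ht).trans_le hs.1, hs.2⟩) Ioo_ae_eq_Ico.symm (half_pos ht).le ht2.le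
    (measure_ne_top p _) (fun s hs => by
      refine (setLIntegral_mono measurable_const
        (hone s ⟨(half_pos ht).trans_le hs.1, hs.2⟩)).trans ?_
      rw [setLIntegral_const, one_mul]
      exact hP)
  calc ∫⁻ s in Ioo 0 t, X.duhamelKernel lam p t (powWeight α) s y
      ≤ ∫⁻ s in Ioo 0 (t / 2) ∪ Ico (t / 2) t, X.duhamelKernel lam p t (powWeight α) s y := by
        refine lintegral_mono_set fun s hs => ?_
        rcases lt_or_ge s (t / 2) with h1 | h1
        · exact Or.inl ⟨hs.1, h1⟩
        · exact Or.inr ⟨h1, hs.2⟩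
    _ ≤ ENNReal.ofReal C * powWeight α y * (p (Ioo 0 δ) + p univ * e y) * 1 +
          ENNReal.ofReal C * powWeight α y * p univ * e y := by
        refine (lintegral_union_le _ _ _).trans (add_le_add (hearly.trans ?_) (hlate.trans ?_))
        · refine mul_le_mul' le_rfl ?_
          rw [ENNReal.ofReal_le_one]
          exact X.survival_le_one h.growth_pos h.frag_nonneg hy0 le_rfl
        · exact mul_le_mul' le_rfl (hsurv _ le_rfl y hδy)
    _ = (ENNReal.ofReal C * p (Ioo 0 δ) + ENNReal.ofReal C * p univ * (2 * e y)) *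
          powWeight α y := by ring
    _ ≤ (ε / 2 + ε / 2) * powWeight α y := mul_le_mul' (add_le_add hδ hyY.1) le_rfl
    _ = ε * powWeight α y := by rw [ENNReal.add_halves]

/-- Medium-sized particles spread out, if the law of the positions is dispersing. -/
theorem IsDispersing.exists_lintegral_duhamelKernel_le {X : Characteristics τ B} {p : Measure ℝ}
    [IsFiniteMeasure p] {t : ℝ} (hX : X.IsDispersing p t)
    (h : RegularCoefficients τ B τ₁ B₀ B₁ x₀ γ₀ γ₁)
    (lam : ℝ) {α : ℝ} (hα : 0 ≤ α) {Y : ℝ} (hY : 0 < Y) {ε : ℝ≥0∞} (hε : ε ≠ 0) :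
    ∃ δ : ℝ, 0 < δ ∧ ∀ A : Set ℝ, MeasurableSet A → volume A ≤ ENNReal.ofReal δ →
      ∀ y ∈ Ioc 0 Y, ∫⁻ s in Ioo 0 t, X.duhamelKernel lam p t (A.indicator (powWeight α)) s y ≤
        ε * powWeight α y := by
  obtain ⟨C, hC⟩ := X.exists_duhamelKernel_le p h lam t hα
  -- Parents that start below Y remain below flow t Y, where B is bounded, so the splitting density
  -- is at most a constant and dispersion applies directly.
  set M := ENNReal.ofReal C * ENNReal.ofReal (B₁ * (1 + X.flow t Y) ^ γ₁) with hM
  have hMt : M ≠ ∞ := ENNReal.mul_ne_top ENNReal.ofReal_ne_top ENNReal.ofReal_ne_top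
  obtain ⟨δ, hδ0, hδ⟩ := hX Y hY (ε / M) (ENNReal.div_pos hε hMt).ne'
  refine ⟨δ, hδ0, fun A hA hAδ y hy => ?_⟩
  set g : ℝ → ℝ≥0∞ := fun s => p (Ioo 0 1 ∩ {z | X.flow (t - s) (z * X.flow s y) ∈ A}) with hg
  calc ∫⁻ s in Ioo 0 t, X.duhamelKernel lam p t (A.indicator (powWeight α)) s y
      ≤ ∫⁻ s in Ioo 0 t, M * powWeight α y * g s := by
        refine setLIntegral_mono' measurableSet_Ioo fun s hs => (hC A s hs y hy.1).trans ?_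
        refine mul_le_mul' ?_ ?_
        · rw [hM, mul_right_comm]
          refine mul_le_mul' (mul_le_mul' le_rfl (ENNReal.ofReal_le_ofReal ?_)) le_rfl
          have hfY : X.flow s y ≤ X.flow t Y :=
            X.flow_le_flow hs.2.le hy.2
          refine (mul_le_of_le_one_right (h.frag_nonneg _)
            (X.survival_le_one h.growth_pos h.frag_nonneg hy.1 hs.1.le)).trans ?_
          exact h.frag_le_of_le ((X.flow_pos hs.1.le hy.1).le.trans hfY) hfY
        · refine (X.lintegral_indicator_mul_survival_le p h hs hy.1 _).trans_eq ?_
          have hm : MeasurableSet {z | X.flow (t - s) (z * X.flow s y) ∈ A} :=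
            ((X.measurable_flow (t - s)).comp (measurable_id.mul_const _)) hA
          rw [lintegral_indicator_one hm, Measure.restrict_apply hm, inter_comm]
    _ = M * powWeight α y * ∫⁻ s in Ioo 0 t, g s :=
        lintegral_const_mul' _ _ (ENNReal.mul_ne_top hMt ENNReal.ofReal_ne_top)
    _ ≤ M * powWeight α y * (ε / M) := mul_le_mul' le_rfl (hδ A hA hAδ y hy)
    _ = M * (ε / M) * powWeight α y := by ring
    _ ≤ ε * powWeight α y := mul_le_mul' ENNReal.mul_div_le le_rfl

end Characteristics

/-! ### The Duhamel integral and its weak compactness -/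

/-- The integral of a family of bounded operators, in the strong sense. -/
theorem exists_integral_clm {E : Type*} [NormedAddCommGroup E] [NormedSpace ℝ E] {U : ℝ → E →L[ℝ] E}
    {J : Set ℝ} {C : ℝ≥0∞} (hC : C ≠ ∞) (hU : ∀ f, IntegrableOn (fun s => U s f) J)
    (hle : ∀ f, ∫⁻ s in J, ‖U s f‖ₑ ≤ C * ‖f‖ₑ) :
    ∃ K : E →L[ℝ] E, ∀ f, K f = ∫ s in J, U s f := by
  let K₀ : E →ₗ[ℝ] E :=
    { toFun := fun f => ∫ s in J, U s f
      map_add' := fun f g => by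
        simp only [map_add]
        exact integral_add (hU f) (hU g)
      map_smul' := fun c f => by
        simp only [map_smul, RingHom.id_apply]
        exact integral_smul c _ }
  refine ⟨K₀.mkContinuous C.toReal fun f => ?_, fun f => rfl⟩
  have h1 := (enorm_integral_le_lintegral_enorm (μ := volume.restrict J) fun s => U s f).trans (hle f)
  have h2 := ENNReal.toReal_mono (ENNReal.mul_ne_top hC enorm_ne_top) h1
  rwa [ENNReal.toReal_mul, toReal_enorm, toReal_enorm] at h2

theorem volume_le_weightMeasure {α : ℝ} (hα : 0 ≤ α) {D : Set ℝ} (hD : MeasurableSet D)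
    (hpos : D ⊆ Ioi 0) : volume D ≤ weightMeasure (powWeight α) D := by
  have h1 : volume D = halfLine D := by
    rw [halfLine, Measure.restrict_apply hD, inter_eq_left.2 hpos]
  rw [h1, withDensity_apply _ hD, ← setLIntegral_one]
  exact setLIntegral_mono' hD fun x hx => one_le_powWeight hα (hpos hx)

theorem weightMeasure_Ioc_ne_top {α : ℝ} (hα : 0 ≤ α) (R : ℝ) :
    weightMeasure (powWeight α) (Ioc 0 R) ≠ ∞ := by
  rw [withDensity_apply _ measurableSet_Ioc]
  refine ne_top_of_le_ne_top ?_ (setLIntegral_mono' (g := fun _ => powWeight α R) measurableSet_Ioc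
    fun x hx => ENNReal.ofReal_le_ofReal (Real.rpow_le_rpow (by linarith [hx.1])
      (by linarith [hx.2]) hα))
  rw [setLIntegral_const]
  refine ENNReal.mul_ne_top ENNReal.ofReal_ne_top ?_
  exact ne_top_of_le_ne_top measure_Ioc_lt_top.ne (Measure.restrict_apply_le _ _)

namespace Characteristics

variable {τ B : ℝ → ℝ} {τ₁ B₀ B₁ x₀ γ₀ γ₁ : ℝ} (X : Characteristics τ B)
variable {lam : ℝ} {S : ℝ → L1 1 →L[ℝ] L1 1} {p : Measure ℝ} [IsFiniteMeasure p]

/-- Testing with the weight restricted to D turns uniform integrability of the image of the unit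
ball into a kernel bound at each y. Large y is covered by the tail estimate, bounded y by
dispersion. -/
theorem exists_weaklyCompact_duhamel (h : RegularCoefficients τ B τ₁ B₀ B₁ x₀ γ₀ γ₁)
    (hS : IsC0Semigroup S) (hgen : HasGenerator S (TransportOperator τ B lam))
    {α : ℝ} (hα : 1 ≤ α) {t : ℝ} (ht : 0 < t) (hX : X.IsDispersing p t) :
    ∃ (U : ℝ → Lp ℝ 1 (weightMeasure (powWeight α)) →L[ℝ] Lp ℝ 1 (weightMeasure (powWeight α)))
      (K : Lp ℝ 1 (weightMeasure (powWeight α)) →L[ℝ] Lp ℝ 1 (weightMeasure (powWeight α))),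
      (∀ s ∈ Ioo 0 t, ∀ f, DuhamelTerm (α := α) S B p t s f (U s f)) ∧
      (∀ f, IntegrableOn (fun s => U s f) (Ioo 0 t) ∧ K f = ∫ s in Ioo 0 t, U s f) ∧
      IsWeaklyCompact K := by
  have hα0 : 0 ≤ α := zero_le_one.trans hα
  have hw := isWeight_powWeight α
  have hsf : SFinite halfLine := by
    rw [halfLine]
    infer_instance
  obtain ⟨U, hU, hUc, hUle⟩ := X.exists_duhamel (p := p) h hS hgen hα t
  have hker : ∀ f, ∀ φ : ℝ → ℝ≥0∞, Measurable φ →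
      ∫⁻ s in Ioo 0 t, ∫⁻ x, φ x * ‖U s f x‖ₑ ∂halfLine ≤
        ∫⁻ y, (∫⁻ s in Ioo 0 t, X.duhamelKernel lam p t φ s y) * ‖f y‖ₑ ∂halfLine := by
    intro f φ hφ
    refine (setLIntegral_mono' measurableSet_Ioo fun s hs => hUle s hs f φ hφ).trans_eq ?_
    have hm : Measurable (Function.uncurry fun s y => X.duhamelKernel lam p t φ s y * ‖f y‖ₑ) :=
      (X.measurable_duhamelKernel h.measurable_frag lam p t hφ).mul
        ((Lp.stronglyMeasurable f).measurable.enorm.comp measurable_snd)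
    rw [lintegral_lintegral_swap hm.aemeasurable]
    exact lintegral_congr fun y => lintegral_mul_const' _ _ enorm_ne_top
  have hnorm : ∀ f, ∀ φ : ℝ → ℝ≥0∞, Measurable φ → ∀ c : ℝ≥0∞, c ≠ ∞ →
      (∀ y, 0 < y → ∫⁻ s in Ioo 0 t, X.duhamelKernel lam p t φ s y ≤ c * powWeight α y) →
      ∫⁻ s in Ioo 0 t, ∫⁻ x, φ x * ‖U s f x‖ₑ ∂halfLine ≤ c * ‖f‖ₑ := by
    intro f φ hφ c hc hle
    rw [hw.enorm_eq, ← lintegral_const_mul' _ _ hc]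
    refine (hker f φ hφ).trans (lintegral_mono_ae ?_)
    filter_upwards [ae_halfLine_pos] with y hy
    rw [← mul_assoc]
    exact mul_le_mul' (hle y hy) le_rfl
  obtain ⟨C, hC, hCle⟩ := X.exists_lintegral_duhamelKernel_le p h lam ht hα0
  have hbd : ∀ f, ∫⁻ s in Ioo 0 t, ‖U s f‖ₑ ≤ C * ‖f‖ₑ := by
    intro f
    simp only [hw.enorm_eq (U _ f)]
    exact hnorm f _ hw.measurable C hC hCle
  have hint : ∀ f, IntegrableOn (fun s => U s f) (Ioo 0 t) := fun f =>
    ⟨(hUc f).aestronglyMeasurable measurableSet_Ioo,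
      (hbd f).trans_lt (ENNReal.mul_lt_top hC.lt_top enorm_lt_top)⟩
  obtain ⟨K, hK⟩ := exists_integral_clm hC hint hbd
  have hKle : ∀ f, ∀ D, MeasurableSet D → ∫⁻ x in D, ‖K f x‖ₑ ∂weightMeasure (powWeight α) ≤
      ∫⁻ s in Ioo 0 t, ∫⁻ x, D.indicator (powWeight α) x * ‖U s f x‖ₑ ∂halfLine := by
    intro f D hD
    -- Restriction to D is a bounded operator, so it commutes with the Bochner integral and no
    -- pointwise representative of the integral is needed.
    obtain ⟨P, hP⟩ := exists_indicator_clm hw hD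
    have hPe : ∀ g, ‖P g‖ₑ = ∫⁻ x, D.indicator (powWeight α) x * ‖g x‖ₑ ∂halfLine := by
      intro g
      rw [hw.enorm_eq]
      refine lintegral_congr_ae ?_
      filter_upwards [hP g] with x hx
      rw [hx]
      by_cases hxD : x ∈ D <;> simp [hxD]
    rw [hw.setLIntegral_eq hD, ← hPe, hK, ← P.integral_comp_comm (hint f)]
    refine (enorm_integral_le_lintegral_enorm _).trans_eq ?_
    simp only [hPe]
  refine ⟨U, K, hU, fun f => ⟨hint f, hK f⟩, ?_⟩
  refine isCompact_closure_weak_of_uniformlyIntegrable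
    (K.lipschitz.isBounded_image Metric.isBounded_closedBall) fun ε hε => ?_
  have hε' : ENNReal.ofReal ε ≠ 0 := (ENNReal.ofReal_pos.2 hε).ne'
  obtain ⟨Y, hY, htail⟩ := X.exists_lintegral_duhamelKernel_tail_le p h lam ht hα0 hε'
  obtain ⟨δ, hδ, hsmall⟩ := hX.exists_lintegral_duhamelKernel_le h lam hα0 hY hε'
  -- Particles that start below Y end in this set, so for them D may be replaced by its trace on it,
  -- whose Lebesgue measure is at most its weighted measure.
  refine ⟨Ioc 0 (X.flow t Y), measurableSet_Ioc, weightMeasure_Ioc_ne_top hα0 _, δ, hδ, ?_⟩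
  rintro _ ⟨f, hf, rfl⟩ D hD hDδ
  have hDA := hD.inter (measurableSet_Ioc (a := 0) (b := X.flow t Y))
  have hf1 : ‖f‖ₑ ≤ 1 := by
    rw [← ofReal_norm, ENNReal.ofReal_le_one]
    exact mem_closedBall_zero_iff.1 hf
  calc ∫⁻ x in D, ‖K f x‖ₑ ∂weightMeasure (powWeight α)
      ≤ ENNReal.ofReal ε * ‖f‖ₑ := by
        refine (hKle f D hD).trans (hnorm f _ (hw.measurable.indicator hD) _
          ENNReal.ofReal_ne_top fun y hy => ?_)
        rcases le_total Y y with hyY | hyY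
        · refine le_trans (lintegral_mono fun s => ?_) (htail y hyY)
          exact X.duhamelKernel_mono p lam t fun z _ => indicator_le_self _ _ _
        · refine le_trans (setLIntegral_mono' measurableSet_Ioo fun s hs => ?_)
            (hsmall _ hDA ((volume_le_weightMeasure hα0 hDA fun x hx => hx.2.1).trans hDδ)
              y ⟨hy, hyY⟩)
          refine X.duhamelKernel_mono p lam t fun z hz => ?_
          have hmem : X.flow (t - s) (z * X.flow s y) ∈ Ioc 0 (X.flow t Y) :=
            ⟨X.flow_pos (sub_nonneg.2 hs.2.le) (mul_pos hz.1 (X.flow_pos hs.1.le hy)),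
              (X.flow_mul_flow_le hs hy hz).trans (X.flow_le_flow le_rfl hyY)⟩
          by_cases hxD : X.flow (t - s) (z * X.flow s y) ∈ D
          · rw [indicator_of_mem hxD, indicator_of_mem (mem_inter hxD hmem)]
          · rw [indicator_of_notMem hxD]
            exact zero_le
    _ ≤ ENNReal.ofReal ε := mul_le_of_le_one_right zero_le hf1

end Characteristics

/-! ### Reduction to normalised coefficients and conclusion -/

/-- The extension of a coefficient on `(0,∞)` by a constant. -/
noncomputable def extendBy (c : ℝ) (f : ℝ → ℝ) (x : ℝ) : ℝ := if 0 < x then f x else c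

theorem extendBy_of_pos {c x : ℝ} (f : ℝ → ℝ) (hx : 0 < x) : extendBy c f x = f x := if_pos hx

theorem extendBy_of_nonpos {c x : ℝ} (f : ℝ → ℝ) (hx : x ≤ 0) : extendBy c f x = c :=
  if_neg hx.not_gt

theorem exists_regularCoefficients {τ B : ℝ → ℝ} {γ₀ γ₁ : ℝ} (hτ : IsGrowthRate τ)
    (hB : IsFragmentationRate B γ₀ γ₁) : ∃ τ₁ B₀ B₁ x₀ : ℝ,
      RegularCoefficients (extendBy 1 τ) (extendBy 0 B) τ₁ B₀ B₁ x₀ γ₀ γ₁ := by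
  obtain ⟨ν₀, τ₀, τ₁, -, hτ₀, hτ₀₁, -, hτ₁⟩ := hτ.bounds
  obtain ⟨B₀, B₁, x₀, hB₀, hB₀₁, hx₀, hBl, hBu⟩ := hB.bounds
  have hγ₁ : 0 < γ₁ := hB.exponent_pos.trans_le hB.exponent_le
  refine ⟨τ₁, B₀, B₁, x₀, ?_⟩
  exact
    { growth_pos := fun x => by
        rcases lt_or_ge 0 x with hx | hx
        · rw [extendBy_of_pos τ hx]
          exact hτ.pos x hx
        · rw [extendBy_of_nonpos τ hx]
          exact one_pos
      growth_eq_one := fun x hx => extendBy_of_nonpos τ hx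
      growth_continuousOn := hτ.contDiffOn.continuousOn.congr fun x hx => extendBy_of_pos τ hx
      growth_integrable := hτ.integrableOn_inv.congr_fun
        (fun x hx => by simp only [extendBy_of_pos τ hx.1]) measurableSet_Ioo
      growth_le := fun x hx => by
        rw [extendBy_of_pos τ hx]
        refine (hτ₁ x hx).trans (mul_le_mul_of_nonneg_left ?_ (hτ₀.le.trans hτ₀₁))
        exact max_le (by linarith) (by linarith)
      frag_nonneg := fun x => by
        rcases lt_or_ge 0 x with hx | hx
        · rw [extendBy_of_pos B hx]
          exact hB.nonneg x hx
        · rw [extendBy_of_nonpos B hx]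
      frag_eq_zero := fun x hx => extendBy_of_nonpos B hx
      frag_continuousOn := hB.continuousOn.congr fun x hx => extendBy_of_pos B hx
      frag_le := fun x hx => by
        rw [extendBy_of_pos B hx]
        refine (hBu x hx).trans (mul_le_mul_of_nonneg_left ?_ (hB₀.le.trans hB₀₁))
        exact max_le (Real.one_le_rpow (by linarith) hγ₁.le)
          (Real.rpow_le_rpow hx.le (by linarith) hγ₁.le)
      le_frag := fun x hx => by
        rw [extendBy_of_pos B (hx₀.trans_le hx)]
        exact hBl x hx
      pos_γ₀ := hB.exponent_pos
      pos_γ₁ := hγ₁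
      pos_x₀ := hx₀
      pos_B₀ := hB₀
      pos_B₁ := hB₀.trans_le hB₀₁
      pos_τ₁ := hτ₀.trans_le hτ₀₁ }

theorem integrable_weight_congr {α : ℝ} {f g : ℝ → ℝ} (h : f =ᵐ[halfLine] g)
    (hf : Integrable f (weight α)) : Integrable g (weight α) :=
  hf.congr ((isWeight_powWeight α).ae_iff.2 h)

/-- Every condition is imposed almost everywhere on (0,∞), so values elsewhere are immaterial and
the same semigroup can be used. -/
theorem transportOperator_extendBy (τ B : ℝ → ℝ) (lam : ℝ) :
    TransportOperator (extendBy 1 τ) (extendBy 0 B) lam = TransportOperator τ B lam := by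
  have hτ : ∀ᵐ x ∂halfLine, extendBy 1 τ x = τ x := by
    filter_upwards [ae_halfLine_pos] with x hx using extendBy_of_pos τ hx
  have hB : ∀ᵐ x ∂halfLine, extendBy 0 B x = B x := by
    filter_upwards [ae_halfLine_pos] with x hx using extendBy_of_pos B hx
  ext f g
  refine exists_congr fun k => and_congr ?_ (and_congr ⟨fun h => ?_, fun h => ?_⟩ ?_)
  · exact eventually_congr (hτ.mono fun x hx => by rw [hx])
  · exact integrable_weight_congr (hB.mono fun x hx => by simp only [hx]) h
  · exact integrable_weight_congr (hB.mono fun x hx => by simp only [hx]) h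
  · exact eventually_congr (hB.mono fun x hx => by rw [hx])

theorem duhamelTerm_of_extendBy {S : ℝ → L1 1 →L[ℝ] L1 1} {B : ℝ → ℝ} {p : Measure ℝ} {t s α : ℝ}
    {f g : L1 α} (h : DuhamelTerm S (extendBy 0 B) p t s f g) : DuhamelTerm S B p t s f g := by
  obtain ⟨u, v, hu, ⟨hint, hv⟩, hg⟩ := h
  refine ⟨u, v, hu, ⟨integrable_weight_congr ?_ hint, hv.trans ?_⟩, hg⟩
  · filter_upwards [ae_halfLine_pos] with x hx
    rw [extendBy_of_pos B hx]
  · filter_upwards [ae_halfLine_pos] with x hx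
    refine setIntegral_congr_fun measurableSet_Ioo fun z hz => ?_
    simp only [extendBy_of_pos B (div_pos hx hz.1)]

theorem proposition3p4
    (τ B : ℝ → ℝ) (γ₀ γ₁ : ℝ) (p : Measure ℝ)
    (hτ : IsGrowthRate τ) (hB : IsFragmentationRate B γ₀ γ₁) (hp : IsFragmentationKernel p)
    (hcase : p ≪ volume ∨
      ((∃ ε : ℝ, 0 < ε ∧ p.support ⊆ Icc ε (1 - ε)) ∧ ∃ c : ℝ, ∀ x, 0 < x → τ x = c))
    (lam : ℝ) (S : ℝ → L1 1 →L[ℝ] L1 1)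
    (hS : IsC0Semigroup S) (hgen : HasGenerator S (TransportOperator τ B lam))
    (α : ℝ) (hα : max 1 (alphaInf p + ((γ₁ - γ₀ : ℝ) : EReal)) < (α : EReal))
    (t : ℝ) (ht : 0 < t) :
    ∃ (U : ℝ → L1 α →L[ℝ] L1 α) (K : L1 α →L[ℝ] L1 α),
      (∀ s ∈ Ioo 0 t, ∀ f : L1 α, DuhamelTerm S B p t s f (U s f)) ∧
      (∀ f : L1 α, IntegrableOn (fun s => U s f) (Ioo 0 t) ∧ K f = ∫ s in Ioo 0 t, U s f) ∧
      IsWeaklyCompact K := by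
  obtain ⟨τ₁, B₀, B₁, x₀, h⟩ := exists_regularCoefficients hτ hB
  obtain ⟨X⟩ := h.exists_characteristics
  have := hp.finite
  have hα1 : (1 : ℝ) ≤ α := by
    have h1 : ((1 : ℝ) : EReal) < α := (le_max_left _ _).trans_lt hα
    exact (EReal.coe_lt_coe_iff.1 h1).le
  rw [← transportOperator_extendBy] at hgen
  -- The only point where the two cases of the assumption are treated separately.
  have hX : X.IsDispersing p t := by
    rcases hcase with hac | ⟨⟨ε, hε, hsupp⟩, c, hc⟩
    · exact X.isDispersing_of_absolutelyContinuous h hac ht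
    · have hc0 : 0 < c := by
        rw [← hc 1 one_pos]
        exact hτ.pos 1 one_pos
      refine X.isDispersing_of_growth_const hc0
        (fun x hx => (extendBy_of_pos τ hx).trans (hc x hx)) hε ?_ t
      filter_upwards [Measure.support_mem_ae] with z hz using (hsupp hz).2
  obtain ⟨U, K, hU, hK, hc⟩ := X.exists_weaklyCompact_duhamel (p := p) h hS hgen hα1 ht hX
  exact ⟨U, K, fun s hs f => duhamelTerm_of_extendBy (hU s hs f), hK, hc⟩
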